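/- All rings are unital and non-zero. Let $R$ be a commutative ring. A group $G$ is of type $\mathrm{FP}_k(R)$ if the trivial $RG$-module $R$ has a projective resolution whose terms in degrees $\leqslant k$ are finitely generated, and of type $\mathrm{FP}(R)$ if it has a projective resolution of finite length by finitely generated modules. A group pair $(G,\mathcal H)$ consists of a group $G$ and a (possibly empty) tuple $\mathcal H$ of subgroups of $G$; for $\mathcal H\neq\varnothing$ let $\Delta_{G/\mathcal H}$ be the kernel of the augmentation $\bigoplus_{H\in\mathcal H}R[G/H]\to R$. The pair $(G,\mathcal H)$ with $\mathcal H\neq\varnothing$ is an orientable Poincaré-duality pair of dimension $n$ over $R$ if $G$ is of type $\mathrm{FP}(R)$, $H^i(G;RG)=0$ for $i\neq n-1$, and $H^{n-1}(G;RG)\cong\Delta_{G/\mathcal H}$ as $RG$-modules; $(G,\varnothing)$ is one if $G$ is of type $\mathrm{FP}(R)$, $H^i(G;RG)=0$ for $i\neq n$, and $H^n(G;RG)\cong R$ with trivial $G$-action. For a homomorphism $\phi$ with domain $G$, let $\mathcal H_\phi$ be the tuple of subgroups of $\ker\phi$ obtained from $\mathcal H$ by replacing each $H\in\mathcal H$ by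 the subgroups $x^{-1}Hx\cap\ker\phi$, where $x$ runs over a set of representatives of the double cosets $H\backslash G/\ker\phi$. Theorem. Let $(G,\mathcal H)$ be an orientable Poincaré-duality pair of dimension $n$ over $R$, and let $\phi\colon G\to\mathbb Z$ be a non-trivial homomorphism whose restriction to every $H\in\mathcal H$ is non-trivial. If $\ker\phi$ is of type $\mathrm{FP}_{\lfloor n/2\rfloor}(R)$ and $\ker\phi|_H$ is of type $\mathrm{FP}_{\lfloor (n-1)/2\rfloor}(R)$ for every $H\in\mathcal H$, then $(\ker\phi,\mathcal H_\phi)$ is an orientable Poincaré-duality pair of dimension $n-1$ over $R$. -/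

import Mathlib

universe u v

open CategoryTheory

noncomputable section

namespace PDPair

/-! ### Finiteness properties over `R` -/

section Finiteness

variable (R G : Type u) [CommRing R] [Group G]

/-- `G` is of type `FP_k(R)`: the trivial `RG`-module `R` has a projective resolution whose terms in
degrees `i ≤ k` are finitely generated `RG`-modules. (For negative `k` this is no condition.) -/
def IsFPn (k : ℤ) : Prop :=
  ∃ P : ProjectiveResolution (Rep.trivial R G R),
    ∀ i : ℕ, (i : ℤ) ≤ k → Module.Finite (MonoidAlgebra R G) (P.complex.X i).ρ.asModule

/-- `G` is of type `FP(R)`: the trivial `RG`-module `R` has a projective resolution of finite length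
all of whose terms are finitely generated `RG`-modules. -/
def IsFP : Prop :=
  ∃ P : ProjectiveResolution (Rep.trivial R G R),
    (∀ i : ℕ, Module.Finite (MonoidAlgebra R G) (P.complex.X i).ρ.asModule) ∧
    ∃ N : ℕ, ∀ i : ℕ, N < i → Subsingleton (P.complex.X i)

end Finiteness

/-! ### The `RG`-module structure on `Hⁱ(G; RG)` -/

section Cohomology

variable (R G : Type u) [CommRing R] [Group G]

/-- Right multiplication by `g⁻¹` on `RG`, an endomorphism of the left `RG`-module `RG`. -/
def rightMulInv (g : G) : Rep.leftRegular R G ⟶ Rep.leftRegular R G :=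
  Rep.ofHom
    { LinearMap.mulRight R (MonoidAlgebra.single g⁻¹ (1 : R) : MonoidAlgebra R G) with
      isIntertwining' := fun h => by
        ext x
        simp [Representation.ofMulAction_single, MonoidAlgebra.single_mul_single, mul_assoc] }

theorem rightMulInv_single (g x : G) (r : R) :
    (rightMulInv R G g).hom (MonoidAlgebra.single x r) = MonoidAlgebra.single (x * g⁻¹) r := by
  change MonoidAlgebra.single x r * MonoidAlgebra.single g⁻¹ 1 = _
  simp [MonoidAlgebra.single_mul_single]

theorem rightMulInv_one : rightMulInv R G 1 = 𝟙 _ := by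
  apply Rep.hom_ext
  apply Representation.IntertwiningMap.ext
  refine MonoidAlgebra.lhom_ext' fun x => LinearMap.ext_ring ?_
  change (MonoidAlgebra.single x (1 : R) * MonoidAlgebra.single (1 : G)⁻¹ 1 : MonoidAlgebra R G) =
    MonoidAlgebra.single x 1
  simp [MonoidAlgebra.single_mul_single]

theorem rightMulInv_mul (g h : G) :
    rightMulInv R G (g * h) = rightMulInv R G h ≫ rightMulInv R G g := by
  apply Rep.hom_ext
  apply Representation.IntertwiningMap.ext
  refine MonoidAlgebra.lhom_ext' fun x => LinearMap.ext_ring ?_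
  change (MonoidAlgebra.single x (1 : R) * MonoidAlgebra.single (g * h)⁻¹ 1 : MonoidAlgebra R G) =
    MonoidAlgebra.single x 1 * MonoidAlgebra.single h⁻¹ 1 * MonoidAlgebra.single g⁻¹ 1
  simp [MonoidAlgebra.single_mul_single, mul_assoc]

/-- The `RG`-module `Hⁱ(G; RG)`, as a representation of `G`: the right `RG`-module structure of the
coefficient bimodule `RG`, turned into a left one by `g ↦ g⁻¹`. -/
def cohomologyRep (i : ℕ) :
    Representation R G (groupCohomology (Rep.leftRegular R G) i) where
  toFun g := ((groupCohomology.functor R G i).map (rightMulInv R G g)).hom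
  map_one' := by
    rw [rightMulInv_one, CategoryTheory.Functor.map_id]
    rfl
  map_mul' g h := by
    rw [rightMulInv_mul, CategoryTheory.Functor.map_comp]
    rfl

end Cohomology

/-! ### Group pairs -/

section Pairs

/-- The augmentation `R[X] → R` of the permutation module on a set `X`. -/
def augmentation (R : Type*) [CommRing R] (X : Type*) : MonoidAlgebra R X →ₗ[R] R :=
  Finsupp.linearCombination R (fun _ : X => (1 : R)) ∘ₗ
    (MonoidAlgebra.coeffLinearEquiv R).toLinearMap

variable (R : Type*) [CommRing R] {G : Type*} [Group G] {ι : Type*}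

/-- The associated module of a group pair: the kernel of the augmentation
`⨁ i, R[G ⧸ H i] → R`, where the direct sum is realised as the permutation module on the
disjoint union of the coset spaces `G ⧸ H i`. -/
def assocModule (H : ι → Subgroup G) :
    Subrepresentation (Representation.ofMulAction R G (Σ i, G ⧸ H i)) where
  toSubmodule := LinearMap.ker (augmentation R (Σ i, G ⧸ H i))
  apply_mem_toSubmodule g v hv := by
    have key : augmentation R (Σ i, G ⧸ H i) ∘ₗ Representation.ofMulAction R G (Σ i, G ⧸ H i) g =
        augmentation R (Σ i, G ⧸ H i) := by
      ext x
      simp [augmentation, Representation.ofMulAction_single]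
    rw [LinearMap.mem_ker] at hv ⊢
    rw [← hv]
    exact LinearMap.congr_fun key v

/-- For a tuple `H` of subgroups of `G`, a subgroup `K` and representatives `x i q` of the double
cosets `q ∈ H i \ G / K`, the tuple of the subgroups `x⁻¹ H x ∩ K` of `K`. -/
def restrictTuple (H : ι → Subgroup G) (K : Subgroup G)
    (x : ∀ i, DoubleCoset.Quotient (H i : Set G) (K : Set G) → G) :
    (Σ i, DoubleCoset.Quotient (H i : Set G) (K : Set G)) → Subgroup K :=
  fun p => ((H p.1).map (MulAut.conj (x p.1 p.2)⁻¹).toMonoidHom).subgroupOf K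

end Pairs

/-! ### Poincaré duality -/

section PoincareDuality

variable (R : Type u) {G : Type u} [CommRing R] [Group G]

variable (G) in
/-- `G` is an orientable Poincaré-duality group of dimension `n` over `R`: it is of type `FP(R)`,
`Hⁱ(G; RG) = 0` for `i ≠ n`, and `Hⁿ(G; RG)` is `R` with the trivial action. -/
def IsOrientablePDGroup (n : ℤ) : Prop :=
  IsFP R G ∧ ∃ m : ℕ, (m : ℤ) = n ∧
    (∀ i : ℕ, i ≠ m → Subsingleton (groupCohomology (Rep.leftRegular R G) i)) ∧
    Nonempty ((cohomologyRep R G m).Equiv (Representation.trivial R G R))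

/-- `(G, H)` is an orientable Poincaré-duality pair of dimension `n` over `R`. For a non-empty tuple:
`G` is of type `FP(R)`, `Hⁱ(G; RG) = 0` for `i ≠ n - 1`, and `Hⁿ⁻¹(G; RG)` is isomorphic to the
associated module as an `RG`-module. For the empty tuple: `G` is an orientable Poincaré-duality group
of dimension `n`. -/
def IsOrientablePDPair {ι : Type v} (H : ι → Subgroup G) (n : ℤ) : Prop :=
  (IsEmpty ι → IsOrientablePDGroup R G n) ∧
  (Nonempty ι →
    IsFP R G ∧ ∃ m : ℕ, (m : ℤ) = n - 1 ∧
      (∀ i : ℕ, i ≠ m → Subsingleton (groupCohomology (Rep.leftRegular R G) i)) ∧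
      Nonempty ((cohomologyRep R G m).Equiv (assocModule R H).toRepresentation))

end PoincareDuality

end PDPair

end

/-! Write K for the kernel of φ, A = RG and B = RK. If t generates G modulo K, then A is a ring of
twisted Laurent polynomials in t over B. The coinduced module Hom_B(A, N) contains two Novikov
submodules, the elements supported in levels bounded on one side or on the other. For N = B their
sum is everything and their intersection is A. Cohomology of G in Novikov modules controls both
conclusions:

(a) If it vanishes in all degrees, then the sequence 0 → A → Nov₊ ⊕ Nov₋ → Hom_B(A, B) → 0 and
Shapiro's lemma give Hⁱ(K; B) ≅ Hⁱ⁺¹(G; A), equivariantly for K (`exists_cohomology_shift`).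
Together with the finiteness of G it also shows that K is of type FP (`modFP_of_extZero_nov`,
`isFP_ker`).

(b) If K is of type FP_k, the Novikov cohomology of G vanishes in degrees ≤ k (`extZero_of_modFP`).
An A-module that is finitely generated over B is a quotient of the cokernel of some matrix t + t⁻¹ -
S with S over B. That cokernel is finite free over B, and its Ext into a Novikov module vanishes
because t + t⁻¹ - S is invertible there by a geometric series. Dimension shifting does the rest.

(c) High degrees come from duality. If C is a finite projective resolution whose dual has cohomology
L₀ in degree d only, then Hⁱ(G; M) is Tor of L₀ and M in degree d - i, and its character dual is Ext
from L₀ to the character module of M. Hence vanishing of Extᵉ from L₀ for e ≤ k' gives vanishing of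
Hⁱ(G; M) for i ≥ d - k' (`homExact_of_duality`). Inversion of group elements exchanges u and u⁻¹, so
invertibility of all u + u⁻¹ - S passes to character modules; this is why the Novikov condition is
expressed by these symmetric operators (`LaurentBij`, `IsNovikov`).

For a group, L₀ is R and (b) applies to it again. For a pair, L₀ is the kernel of the augmentation
of the permutation module. Its Ext is controlled by that of R over G and, through Shapiro's lemma,
by that of R over the subgroups H, to which (b) applies with the kernels of the restrictions of φ.
The two ranges cover all degrees as soon as d ≤ k + k' + 1, which is what the bounds ⌊n/2⌋ and
⌊(n-1)/2⌋ provide.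

Finally, the union of the sets G/H splits into K-orbits indexed by double cosets, so the module of
the pair restricted to K is the module of the restricted pair. -/

noncomputable section

namespace PDPair

/-! ### Vanishing of Ext and dimension shifting -/

section ExtZero

open Abelian

variable (A : Type u) [Ring A]

/-- `Extⁱ_A(L, M) = 0`. -/
def ExtZero (L M : Type u) [AddCommGroup L] [Module A L] [AddCommGroup M] [Module A M]
    (i : ℕ) : Prop :=
  Subsingleton (Ext (ModuleCat.of A L) (ModuleCat.of A M) i)

variable {A}
variable {L' F L M M' I : Type u} [AddCommGroup L'] [Module A L'] [AddCommGroup F] [Module A F]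
  [AddCommGroup L] [Module A L] [AddCommGroup M] [Module A M] [AddCommGroup M'] [Module A M']
  [AddCommGroup I] [Module A I]

theorem extZero_zero_iff : ExtZero A L M 0 ↔ ∀ f : L →ₗ[A] M, f = 0 := by
  have e : Ext (ModuleCat.of A L) (ModuleCat.of A M) 0 ≃ (L →ₗ[A] M) :=
    Ext.homEquiv₀.trans ModuleCat.homEquiv
  constructor
  · intro h f
    have : Subsingleton (L →ₗ[A] M) := @Equiv.subsingleton _ _ e.symm h
    exact Subsingleton.elim _ _
  · intro h
    have : Subsingleton (L →ₗ[A] M) := subsingleton_of_forall_eq 0 h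
    exact e.subsingleton

theorem shortExact_of_exact {f : L' →ₗ[A] F} {g : F →ₗ[A] L} (hf : Function.Injective f)
    (hg : Function.Surjective g) (h : Function.Exact f g) :
    (ShortComplex.mk (ModuleCat.ofHom f) (ModuleCat.ofHom g)
      (by ext x; exact h.apply_apply_eq_zero x)).ShortExact where
  exact := (ShortComplex.ShortExact.moduleCat_exact_iff_function_exact _).2 h
  mono_f := (ModuleCat.mono_iff_injective _).2 hf
  epi_g := (ModuleCat.epi_iff_surjective _).2 hg

theorem extZero_of_linearEquiv (e : L ≃ₗ[A] L') {i : ℕ} (h : ExtZero A L M i) :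
    ExtZero A L' M i := by
  refine subsingleton_of_forall_eq 0 fun x => ?_
  have h1 : (Ext.mk₀ (ModuleCat.ofHom e.toLinearMap)).comp x (zero_add i) = 0 :=
    @Subsingleton.elim _ h _ _
  have h2 : (Ext.mk₀ (ModuleCat.ofHom e.symm.toLinearMap)).comp
      ((Ext.mk₀ (ModuleCat.ofHom e.toLinearMap)).comp x (zero_add i)) (zero_add i) = x := by
    rw [Ext.mk₀_comp_mk₀_assoc]
    have : ModuleCat.ofHom e.symm.toLinearMap ≫ ModuleCat.ofHom e.toLinearMap = 𝟙 _ := by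
      ext x; simp
    rw [this, Ext.mk₀_id_comp]
  rw [← h2, h1, Ext.comp_zero]

theorem extZero_of_projective [Module.Projective A L] (i : ℕ) : ExtZero A L M (i + 1) := by
  have : Projective (ModuleCat.of A L) := (IsProjective.iff_projective L).1 inferInstance
  exact Ext.subsingleton_of_projective _ _ _

theorem extZero_of_injective [Module.Injective A M] (i : ℕ) : ExtZero A L M (i + 1) := by
  have : Injective (ModuleCat.of A M) := Module.injective_object_of_injective_module A M
  exact Ext.subsingleton_of_injective _ _ _

theorem extZero_of_subsingleton [Subsingleton L] (i : ℕ) : ExtZero A L M i := by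
  cases i with
  | zero => exact extZero_zero_iff.2 fun f => by ext x; simp [Subsingleton.elim x 0]
  | succ i =>
    have : Module.Projective A L := by
      have : Module.Free A L := inferInstance
      infer_instance
    exact extZero_of_projective i

section Contravariant

variable {f : L' →ₗ[A] F} {g : F →ₗ[A] L}

theorem extZero_quotient (hf : Function.Injective f)
    (hg : Function.Surjective g) (h : Function.Exact f g)
    {e : ℕ} (h1 : ExtZero A L' M e) (h2 : ExtZero A F M (e + 1)) :
    ExtZero A L M (e + 1) := by
  refine subsingleton_of_forall_eq 0 fun x => ?_
  obtain ⟨y, rfl⟩ := Ext.contravariant_sequence_exact₃ (shortExact_of_exact hf hg h) _ x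
    (@Subsingleton.elim _ h2 _ _) (add_comm 1 e)
  have : y = 0 := @Subsingleton.elim _ h1 _ _
  rw [this, Ext.comp_zero]

theorem extZero_sub (hf : Function.Injective f)
    (hg : Function.Surjective g) (h : Function.Exact f g)
    {e : ℕ} (h1 : ExtZero A F M e) (h2 : ExtZero A L M (e + 1)) :
    ExtZero A L' M e := by
  refine subsingleton_of_forall_eq 0 fun x => ?_
  obtain ⟨y, rfl⟩ := Ext.contravariant_sequence_exact₁ (shortExact_of_exact hf hg h) _ x
    (add_comm 1 e) (@Subsingleton.elim _ h2 _ _)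
  have : y = 0 := @Subsingleton.elim _ h1 _ _
  rw [this, Ext.comp_zero]

theorem extZero_middle (hf : Function.Injective f)
    (hg : Function.Surjective g) (h : Function.Exact f g)
    {e : ℕ} (h1 : ExtZero A L' M e) (h2 : ExtZero A L M e) :
    ExtZero A F M e := by
  refine subsingleton_of_forall_eq 0 fun x => ?_
  obtain ⟨y, rfl⟩ := Ext.contravariant_sequence_exact₂ (shortExact_of_exact hf hg h) _ x
    (@Subsingleton.elim _ h1 _ _)
  have : y = 0 := @Subsingleton.elim _ h2 _ _
  rw [this, Ext.comp_zero]

/-- With `extZero_one_of_extend`, this turns vanishing in degree one into an extension problem for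
homomorphisms. Higher degrees are reached by dimension shifting. -/
theorem extend_of_extZero (hf : Function.Injective f)
    (hg : Function.Surjective g) (h : Function.Exact f g)
    (h1 : ExtZero A L M 1) (k : L' →ₗ[A] M) :
    ∃ k' : F →ₗ[A] M, k' ∘ₗ f = k := by
  obtain ⟨y, hy⟩ := Ext.contravariant_sequence_exact₁ (shortExact_of_exact hf hg h) _
    (Ext.mk₀ (ModuleCat.ofHom k)) (add_comm 1 0) (@Subsingleton.elim _ h1 _ _)
  obtain ⟨z, rfl⟩ := Ext.mk₀_bijective _ _ |>.2 y
  rw [Ext.mk₀_comp_mk₀] at hy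
  have := (Ext.mk₀_bijective _ _).1 hy
  exact ⟨z.hom, by simpa using congrArg ModuleCat.Hom.hom this⟩

theorem extZero_one_of_extend (hf : Function.Injective f)
    (hg : Function.Surjective g) (h : Function.Exact f g)
    (h1 : ExtZero A F M 1)
    (h2 : ∀ k : L' →ₗ[A] M, ∃ k' : F →ₗ[A] M, k' ∘ₗ f = k) : ExtZero A L M 1 := by
  refine subsingleton_of_forall_eq 0 fun x => ?_
  obtain ⟨y, rfl⟩ := Ext.contravariant_sequence_exact₃ (shortExact_of_exact hf hg h) _ x
    (@Subsingleton.elim _ h1 _ _) (add_comm 1 0)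
  obtain ⟨z, rfl⟩ := Ext.mk₀_bijective _ _ |>.2 y
  obtain ⟨k, hk⟩ := h2 z.hom
  have : z = ModuleCat.ofHom f ≫ ModuleCat.ofHom k := ModuleCat.hom_ext hk.symm
  rw [this, ← Ext.mk₀_comp_mk₀]
  exact (shortExact_of_exact hf hg h).extClass_comp_assoc _

end Contravariant

section Covariant

variable {f : M →ₗ[A] I} {g : I →ₗ[A] M'}

theorem extZero_right_sub (hf : Function.Injective f)
    (hg : Function.Surjective g) (h : Function.Exact f g)
    {e : ℕ} (h1 : ExtZero A L M' e) (h2 : ExtZero A L I (e + 1)) :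
    ExtZero A L M (e + 1) := by
  refine subsingleton_of_forall_eq 0 fun x => ?_
  obtain ⟨y, rfl⟩ := Ext.covariant_sequence_exact₁ _ (shortExact_of_exact hf hg h) x
    (@Subsingleton.elim _ h2 _ _) rfl
  have : y = 0 := @Subsingleton.elim _ h1 _ _
  rw [this, Ext.zero_comp]

theorem extZero_right_quotient (hf : Function.Injective f)
    (hg : Function.Surjective g) (h : Function.Exact f g)
    {e : ℕ} (h1 : ExtZero A L I e) (h2 : ExtZero A L M (e + 1)) :
    ExtZero A L M' e := by
  refine subsingleton_of_forall_eq 0 fun x => ?_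
  obtain ⟨y, rfl⟩ := Ext.covariant_sequence_exact₃ _ (shortExact_of_exact hf hg h) x rfl
    (@Subsingleton.elim _ h2 _ _)
  have : y = 0 := @Subsingleton.elim _ h1 _ _
  rw [this, Ext.zero_comp]

theorem lift_of_extZero (hf : Function.Injective f)
    (hg : Function.Surjective g) (h : Function.Exact f g)
    (h1 : ExtZero A L M 1) (k : L →ₗ[A] M') :
    ∃ k' : L →ₗ[A] I, g ∘ₗ k' = k := by
  obtain ⟨y, hy⟩ := Ext.covariant_sequence_exact₃ _ (shortExact_of_exact hf hg h)
    (Ext.mk₀ (ModuleCat.ofHom k)) rfl (@Subsingleton.elim _ h1 _ _)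
  obtain ⟨z, rfl⟩ := Ext.mk₀_bijective _ _ |>.2 y
  rw [Ext.mk₀_comp_mk₀] at hy
  have := (Ext.mk₀_bijective _ _).1 hy
  exact ⟨z.hom, by simpa using congrArg ModuleCat.Hom.hom this⟩

theorem extZero_one_of_lift (hf : Function.Injective f)
    (hg : Function.Surjective g) (h : Function.Exact f g)
    (h1 : ExtZero A L I 1)
    (h2 : ∀ k : L →ₗ[A] M', ∃ k' : L →ₗ[A] I, g ∘ₗ k' = k) : ExtZero A L M 1 := by
  refine subsingleton_of_forall_eq 0 fun x => ?_
  obtain ⟨y, rfl⟩ := Ext.covariant_sequence_exact₁ _ (shortExact_of_exact hf hg h) x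
    (@Subsingleton.elim _ h1 _ _) rfl
  obtain ⟨z, rfl⟩ := Ext.mk₀_bijective _ _ |>.2 y
  obtain ⟨k, hk⟩ := h2 z.hom
  have : z = ModuleCat.ofHom k ≫ ModuleCat.ofHom g := ModuleCat.hom_ext hk.symm
  rw [this, ← Ext.mk₀_comp_mk₀, Ext.comp_assoc _ _ _ (by rfl) (zero_add 1) (by rfl)]
  have := (shortExact_of_exact hf hg h).comp_extClass
  erw [this]
  exact Ext.comp_zero _ _ _ _ _

end Covariant

end ExtZero

/-! ### Projective resolutions by linear maps -/

section Resolutions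

theorem exists_factor {A : Type*} [Ring A] {X Y L M : Type*} [AddCommGroup X] [Module A X]
    [AddCommGroup Y] [Module A Y] [AddCommGroup L] [Module A L] [AddCommGroup M] [Module A M]
    {g : Y →ₗ[A] X} {p : X →ₗ[A] L} {f : X →ₗ[A] M} (hp : Function.Surjective p)
    (hgp : Function.Exact g p) (hf : f ∘ₗ g = 0) : ∃ k : L →ₗ[A] M, f = k ∘ₗ p := by
  have hk : LinearMap.ker p ≤ LinearMap.ker f := by
    intro x hx
    obtain ⟨y, rfl⟩ := (hgp x).1 hx
    exact LinearMap.congr_fun hf y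
  refine ⟨(LinearMap.ker p).liftQ f hk ∘ₗ (p.quotKerEquivOfSurjective hp).symm.toLinearMap,
    LinearMap.ext fun x => ?_⟩
  have h3 : (p.quotKerEquivOfSurjective hp).symm (p x) = Submodule.Quotient.mk x := by
    rw [LinearEquiv.symm_apply_eq]; rfl
  simp [h3]

/-- A projective resolution of the `A`-module `L`, in terms of linear maps. -/
structure ProjRes (A : Type u) [Ring A] (L : Type u) [AddCommGroup L] [Module A L] where
  X : ℕ → ModuleCat.{u} A
  d : ∀ i, X (i + 1) →ₗ[A] X i
  ε : X 0 →ₗ[A] L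
  proj : ∀ i, Module.Projective A (X i)
  surj : Function.Surjective ε
  exact_zero : Function.Exact (d 0) ε
  exact_succ : ∀ i, Function.Exact (d (i + 1)) (d i)

namespace ProjRes

variable {A : Type u} [Ring A] {L : Type u} [AddCommGroup L] [Module A L]

instance (C : ProjRes A L) (i : ℕ) : Module.Projective A (C.X i) := C.proj i

theorem d_comp_d (C : ProjRes A L) (i : ℕ) : C.d i ∘ₗ C.d (i + 1) = 0 :=
  (C.exact_succ i).linearMap_comp_eq_zero

theorem ε_comp_d (C : ProjRes A L) : C.ε ∘ₗ C.d 0 = 0 :=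
  C.exact_zero.linearMap_comp_eq_zero

/-- A cochain `f : Xᵢ → M` is a coboundary. -/
def IsCobdry (C : ProjRes A L) {M : Type*} [AddCommGroup M] [Module A M] :
    ∀ i, (C.X i →ₗ[A] M) → Prop
  | 0, f => f = 0
  | i + 1, f => ∃ h : C.X i →ₗ[A] M, f = h ∘ₗ C.d i

/-- The complex `Hom_A(C, M)` is exact in degree `i`. -/
def HomExact (C : ProjRes A L) (M : Type*) [AddCommGroup M] [Module A M] (i : ℕ) : Prop :=
  ∀ f : C.X i →ₗ[A] M, f ∘ₗ C.d i = 0 → C.IsCobdry i f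

/-- The resolution of the first syzygy. -/
def tail (C : ProjRes A L) : ProjRes A (LinearMap.ker C.ε) where
  X i := C.X (i + 1)
  d i := C.d (i + 1)
  ε := (C.d 0).codRestrict _ fun x => C.exact_zero.apply_apply_eq_zero x
  proj i := C.proj (i + 1)
  surj := fun ⟨y, hy⟩ => by
    obtain ⟨x, rfl⟩ := (C.exact_zero y).1 hy
    exact ⟨x, rfl⟩
  exact_zero x := by
    rw [← C.exact_succ 0 x]
    exact Subtype.ext_iff
  exact_succ i := C.exact_succ (i + 1)

/-- Extend a resolution of the kernel of a surjection from a projective module. -/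
def cons (P : ModuleCat.{u} A) [hP : Module.Projective A P] (π : P →ₗ[A] L)
    (hπ : Function.Surjective π) (C : ProjRes A (LinearMap.ker π)) : ProjRes A L where
  X := fun i => Nat.casesOn i P C.X
  d := fun i => match i with
    | 0 => (LinearMap.ker π).subtype ∘ₗ C.ε
    | i + 1 => C.d i
  ε := π
  proj := fun i => match i with
    | 0 => hP
    | i + 1 => C.proj i
  surj := hπ
  exact_zero x := by
    constructor
    · intro hx
      obtain ⟨y, hy⟩ := C.surj ⟨x, hx⟩
      exact ⟨y, congrArg Subtype.val hy⟩
    · rintro ⟨y, rfl⟩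
      exact (C.ε y).2
  exact_succ := fun i => match i with
    | 0 => fun x => by
      rw [← C.exact_zero x]
      exact (Subtype.ext_iff (a2 := (0 : LinearMap.ker π))).symm
    | i + 1 => C.exact_succ i

/-- The resolution of length zero of a projective module. -/
def ofProjective [hL : Module.Projective A L] : ProjRes A L where
  X := fun i => Nat.casesOn i (ModuleCat.of A L) (fun _ => ModuleCat.of A PUnit.{u + 1})
  d := fun i => match i with
    | 0 => 0
    | _ + 1 => 0
  ε := LinearMap.id
  proj := fun i => match i with
    | 0 => hL
    | _ + 1 => inferInstanceAs (Module.Projective A PUnit.{u + 1})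
  surj := Function.surjective_id
  exact_zero x := by
    constructor
    · intro hx
      exact ⟨0, by rw [map_zero]; exact hx.symm⟩
    · rintro ⟨y, rfl⟩
      rfl
  exact_succ := fun i => match i with
    | 0 => fun x => ⟨fun _ => ⟨0, Subsingleton.elim (α := PUnit.{u + 1}) _ _⟩, fun _ => rfl⟩
    | _ + 1 => fun x => ⟨fun _ => ⟨0, Subsingleton.elim (α := PUnit.{u + 1}) _ _⟩, fun _ => rfl⟩

/-- Induction on the degree, passing to the first syzygy. Since the right side does not mention C,
vanishing can be moved between resolutions and shifted along short exact sequences. -/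
theorem homExact_iff (M : Type u) [AddCommGroup M] [Module A M] (i : ℕ) :
    ∀ {L : Type u} [AddCommGroup L] [Module A L] (C : ProjRes A L),
      C.HomExact M i ↔ ExtZero A L M i := by
  induction i with
  | zero =>
    intro L _ _ C
    rw [extZero_zero_iff]
    constructor
    · intro h f
      have h1 : f ∘ₗ C.ε = 0 := h (f ∘ₗ C.ε) (by rw [LinearMap.comp_assoc, C.ε_comp_d]; simp)
      ext x
      obtain ⟨y, rfl⟩ := C.surj x
      exact LinearMap.congr_fun h1 y
    · intro h f hf
      obtain ⟨k, rfl⟩ := exists_factor C.surj C.exact_zero hf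
      rw [h k]
      exact LinearMap.zero_comp _
  | succ i ih =>
    intro L _ _ C
    have hx := LinearMap.exact_subtype_ker_map C.ε
    have hi := Submodule.injective_subtype (LinearMap.ker C.ε)
    cases i with
    | zero =>
      let p : C.X 1 →ₗ[A] LinearMap.ker C.ε := C.tail.ε
      have hp : Function.Surjective p := C.tail.surj
      have hpe : Function.Exact (C.d 1) p := C.tail.exact_zero
      constructor
      · intro h
        refine extZero_one_of_extend hi C.surj hx (extZero_of_projective 0) fun k => ?_
        obtain ⟨g, hg⟩ := h (k ∘ₗ p) (by
          rw [LinearMap.comp_assoc, hpe.linearMap_comp_eq_zero, LinearMap.comp_zero])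
        refine ⟨g, LinearMap.ext fun x => ?_⟩
        obtain ⟨y, rfl⟩ := hp x
        exact (LinearMap.congr_fun hg y).symm
      · intro h f hf
        obtain ⟨k, hk⟩ := exists_factor hp hpe hf
        obtain ⟨k', hk'⟩ := extend_of_extZero hi C.surj hx h k
        refine ⟨k', ?_⟩
        rw [hk, ← hk']
        rfl
    | succ i =>
      -- From degree two on, cocycles and coboundaries of `C` are literally those of `C.tail` one
      -- degree lower. In degree one this fails, because degree-zero coboundaries are zero by
      -- convention.
      refine Iff.trans (Iff.of_eq rfl) ((ih C.tail).trans ⟨fun h => ?_, fun h => ?_⟩)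
      · exact extZero_quotient hi C.surj hx h (extZero_of_projective _)
      · exact extZero_sub hi C.surj hx (extZero_of_projective _) h

end ProjRes

end Resolutions

/-! ### Modules of type FP_k -/

section ModFP

variable (B : Type u) [Ring B]

/-- The module `L` is of type `FP_k` over `B`. -/
def ModFP : ℕ → ∀ (L : Type u) [AddCommGroup L] [Module B L], Prop
  | 0, L, _, _ => Module.Finite B L
  | k + 1, L, _, _ => ∃ (P : ModuleCat.{u} B) (f : P →ₗ[B] L), Module.Finite B P ∧
      Module.Projective B P ∧ Function.Surjective f ∧ ModFP k (LinearMap.ker f)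

variable {B}
variable {L L' N P : Type u} [AddCommGroup L] [Module B L] [AddCommGroup L'] [Module B L']
  [AddCommGroup N] [Module B N] [AddCommGroup P] [Module B P]

theorem ModFP.finite {k : ℕ} (h : ModFP B k L) : Module.Finite B L := by
  cases k with
  | zero => exact h
  | succ k =>
    obtain ⟨P, f, h1, -, h2, -⟩ := h
    exact Module.Finite.of_surjective f h2

theorem ModFP.congr {k : ℕ} (e : L ≃ₗ[B] L') (h : ModFP B k L) : ModFP B k L' := by
  induction k generalizing L L' with
  | zero => exact @Module.Finite.equiv _ _ _ _ _ _ _ _ h e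
  | succ k ih =>
    obtain ⟨P, f, h1, h1', h2, h3⟩ := h
    refine ⟨P, e.toLinearMap ∘ₗ f, h1, h1', e.surjective.comp h2, ?_⟩
    rwa [LinearEquiv.ker_comp]

/-- A surjection onto a projective module splits. -/
def prodEquivOfProjective [Module.Projective B P] (g : N →ₗ[B] P)
    (hg : Function.Surjective g) : (LinearMap.ker g × P) ≃ₗ[B] N :=
  let s := Classical.choose (Module.projective_lifting_property g LinearMap.id hg)
  have hs : ∀ x, g (s x) = x := fun x => LinearMap.congr_fun
    (Classical.choose_spec (Module.projective_lifting_property g LinearMap.id hg)) x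
  LinearEquiv.ofBijective ((LinearMap.ker g).subtype.coprod s) (by
    constructor
    · rw [injective_iff_map_eq_zero]
      rintro ⟨⟨a, ha⟩, b⟩ h
      rw [LinearMap.mem_ker] at ha
      have h' : a + s b = 0 := h
      have hb : b = 0 := by
        have := congrArg g h'
        rwa [map_add, ha, hs, zero_add, map_zero] at this
      subst hb
      rw [map_zero, add_zero] at h'
      simp [h']
    · intro x
      refine ⟨(⟨x - s (g x), by simp [hs]⟩, g x), ?_⟩
      simp)

theorem ModFP.prod {k : ℕ} [Module.Finite B P] [Module.Projective B P] (h : ModFP B k L) :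
    ModFP B k (L × P) := by
  cases k with
  | zero =>
    have : Module.Finite B L := h
    exact inferInstanceAs (Module.Finite B (L × P))
  | succ k =>
    obtain ⟨Q, f, h1, h1', h2, h3⟩ := h
    refine ⟨ModuleCat.of B (Q × P), f.prodMap LinearMap.id, inferInstanceAs (Module.Finite B (Q × P)),
      inferInstanceAs (Module.Projective B (Q × P)), ?_, ?_⟩
    · exact Function.Surjective.prodMap h2 Function.surjective_id
    · refine h3.congr (LinearEquiv.ofBijective ((LinearMap.inl B Q P ∘ₗ
        (LinearMap.ker f).subtype).codRestrict _ fun x => ?_) ⟨?_, ?_⟩)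
      · simp
      · intro x y hxy
        have := congrArg (fun z => z.1.1) hxy
        exact Subtype.ext this
      · rintro ⟨⟨q, p⟩, hx⟩
        have hx' : f q = 0 ∧ p = 0 := by simpa [LinearMap.mem_ker, Prod.ext_iff] using hx
        obtain ⟨hq, rfl⟩ := hx'
        exact ⟨⟨q, hq⟩, rfl⟩

theorem ModFP.of_ker {k : ℕ} [Module.Finite B P] [Module.Projective B P] (g : N →ₗ[B] P)
    (hg : Function.Surjective g) (h : ModFP B k (LinearMap.ker g)) : ModFP B k N :=
  h.prod.congr (prodEquivOfProjective g hg)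

/-- A cover f of N is also a cover of L. The kernel of g ∘ f is an extension of the projective
module ker g by ker f, so it has the same finiteness as ker f. -/
theorem ModFP.of_quotient {k : ℕ} (g : N →ₗ[B] L) (hg : Function.Surjective g)
    [Module.Finite B (LinearMap.ker g)] [Module.Projective B (LinearMap.ker g)]
    (h : ModFP B k N) : ModFP B k L := by
  cases k with
  | zero =>
    have : Module.Finite B N := h
    exact Module.Finite.of_surjective g hg
  | succ k =>
    obtain ⟨Q, f, h1, h1', h2, h3⟩ := h
    refine ⟨Q, g ∘ₗ f, h1, h1', hg.comp h2, ?_⟩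
    let q : LinearMap.ker (g ∘ₗ f) →ₗ[B] LinearMap.ker g := f.restrict fun x hx => hx
    refine ModFP.of_ker q ?_ (h3.congr ?_)
    · rintro ⟨y, hy⟩
      obtain ⟨x, rfl⟩ := h2 y
      exact ⟨⟨x, hy⟩, rfl⟩
    · refine LinearEquiv.ofBijective (LinearMap.codRestrict _ (LinearMap.codRestrict _
        (LinearMap.ker f).subtype fun x => ?_) fun x => ?_) ⟨?_, ?_⟩
      · simp [LinearMap.mem_ker, LinearMap.mem_ker.1 x.2]
      · exact Subtype.ext x.2
      · intro x y hxy
        exact Subtype.ext (congrArg (fun z => z.1.1) hxy)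
      · rintro ⟨⟨x, hx⟩, hx'⟩
        exact ⟨⟨x, congrArg Subtype.val hx'⟩, rfl⟩

theorem ModFP.of_linearEquiv_ker {k : ℕ} (g : N →ₗ[B] L) (hg : Function.Surjective g)
    [Module.Finite B P] [Module.Projective B P] (e : P ≃ₗ[B] LinearMap.ker g)
    (h : ModFP B k N) : ModFP B k L := by
  have := Module.Finite.equiv e
  have := Module.Projective.of_equiv e
  exact h.of_quotient g hg

/-- Schanuel's lemma: in the pullback X of the two covers f and g, the projections split, so X is
both ker f ⊕ P and ker g ⊕ Q. Hence any finitely generated projective cover can be used to test type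
FP_k. -/
theorem ModFP.ker {k : ℕ} (h : ModFP B (k + 1) L) [Module.Finite B P] [Module.Projective B P]
    (g : P →ₗ[B] L) (hg : Function.Surjective g) : ModFP B k (LinearMap.ker g) := by
  obtain ⟨Q, f, h1, h1', h2, h3⟩ := h
  let X : Submodule B (Q × P) := LinearMap.eqLocus (f ∘ₗ LinearMap.fst B Q P)
    (g ∘ₗ LinearMap.snd B Q P)
  let a : X →ₗ[B] P := LinearMap.snd B Q P ∘ₗ X.subtype
  let b : X →ₗ[B] Q := LinearMap.fst B Q P ∘ₗ X.subtype
  have ha : Function.Surjective a := fun y => by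
    obtain ⟨x, hx⟩ := h2 (g y)
    exact ⟨⟨(x, y), hx⟩, rfl⟩
  have hb : Function.Surjective b := fun x => by
    obtain ⟨y, hy⟩ := hg (f x)
    exact ⟨⟨(x, y), hy.symm⟩, rfl⟩
  have ea : LinearMap.ker f ≃ₗ[B] LinearMap.ker a := by
    refine LinearEquiv.ofBijective (LinearMap.codRestrict _ (LinearMap.codRestrict _
      (LinearMap.inl B Q P ∘ₗ (LinearMap.ker f).subtype) fun x => ?_) fun x => ?_) ⟨?_, ?_⟩
    · change f x.1 = g 0
      rw [map_zero]
      exact x.2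
    · rfl
    · intro x y hxy
      exact Subtype.ext (congrArg (fun z => z.1.1.1) hxy)
    · rintro ⟨⟨⟨x, y⟩, hx⟩, hx'⟩
      obtain rfl : y = 0 := hx'
      have hx : f x = g 0 := hx
      exact ⟨⟨x, by rw [LinearMap.mem_ker, hx, map_zero]⟩, rfl⟩
  have eb : LinearMap.ker g ≃ₗ[B] LinearMap.ker b := by
    refine LinearEquiv.ofBijective (LinearMap.codRestrict _ (LinearMap.codRestrict _
      (LinearMap.inr B Q P ∘ₗ (LinearMap.ker g).subtype) fun x => ?_) fun x => ?_) ⟨?_, ?_⟩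
    · change f 0 = g x.1
      rw [map_zero]
      exact x.2.symm
    · rfl
    · intro x y hxy
      exact Subtype.ext (congrArg (fun z => z.1.1.2) hxy)
    · rintro ⟨⟨⟨x, y⟩, hx⟩, hx'⟩
      obtain rfl : x = 0 := hx'
      have hx : f 0 = g y := hx
      exact ⟨⟨y, by rw [LinearMap.mem_ker, ← hx, map_zero]⟩, rfl⟩
  have hX : ModFP B k X := ModFP.of_ker a ha (h3.congr ea)
  obtain ⟨E⟩ : Nonempty ((LinearMap.ker b × Q) ≃ₗ[B] X) := ⟨prodEquivOfProjective b hb⟩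
  refine ModFP.congr (L := LinearMap.ker b) eb.symm ?_
  refine ModFP.of_linearEquiv_ker (P := Q) (N := X) (LinearMap.fst B _ _ ∘ₗ E.symm.toLinearMap)
    (Prod.fst_surjective.comp E.symm.surjective) ?_ hX
  refine LinearEquiv.ofBijective (LinearMap.codRestrict _ (E.toLinearMap ∘ₗ LinearMap.inr B _ Q)
    fun x => ?_) ⟨?_, ?_⟩
  · simp
  · intro x y hxy
    have h0 : E (0, x) = E (0, y) := congrArg Subtype.val hxy
    exact congrArg Prod.snd (E.injective h0)
  · rintro ⟨x, hx⟩
    refine ⟨(E.symm x).2, Subtype.ext ?_⟩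
    change E (0, (E.symm x).2) = x
    rw [← E.apply_symm_apply x]
    congr 1
    have : (E.symm x).1 = 0 := hx
    rw [E.apply_symm_apply]
    exact Prod.ext this.symm rfl

theorem modFP_of_projRes {k : ℕ} (C : ProjRes B L)
    (h : ∀ i ≤ k, Module.Finite B (C.X i)) : ModFP B k L := by
  induction k generalizing L with
  | zero =>
    have := h 0 le_rfl
    exact Module.Finite.of_surjective C.ε C.surj
  | succ k ih =>
    exact ⟨C.X 0, C.ε, h 0 (Nat.zero_le _), C.proj 0, C.surj,
      ih C.tail fun i hi => h (i + 1) (by omega)⟩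

theorem projective_of_extZero (h : ∀ (M : Type u) [AddCommGroup M] [Module B M],
    ExtZero B L M 1) : Module.Projective B L := by
  let π : (L →₀ B) →ₗ[B] L := Finsupp.linearCombination B id
  have hπ : Function.Surjective π := Finsupp.linearCombination_id_surjective B L
  obtain ⟨s, hs⟩ := lift_of_extZero (L := L) (M := LinearMap.ker π) (I := L →₀ B) (M' := L)
    (f := (LinearMap.ker π).subtype) (g := π) (Submodule.injective_subtype (LinearMap.ker π)) hπ
    (LinearMap.exact_subtype_ker_map π) (h _) (LinearMap.id : L →ₗ[B] L)
  exact Module.Projective.of_split s π hs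

/-- Each syzygy lowers the bound N by one. At N = 0 the remaining module has vanishing Ext¹, hence
is projective and ends the resolution. -/
theorem exists_finite_projRes (N : ℕ) (h : ∀ k, ModFP B k L)
    (hN : ∀ (M : Type u) [AddCommGroup M] [Module B M], ∀ i, N < i → ExtZero B L M i) :
    ∃ C : ProjRes B L, (∀ i, Module.Finite B (C.X i)) ∧ ∀ i, N < i → Subsingleton (C.X i) := by
  induction N generalizing L with
  | zero =>
    have : Module.Projective B L := projective_of_extZero fun M => hN M 1 Nat.zero_lt_one
    have : Module.Finite B L := h 0
    refine ⟨ProjRes.ofProjective, fun i => ?_, fun i hi => ?_⟩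
    · cases i with
      | zero => exact this
      | succ i => exact inferInstanceAs (Module.Finite B PUnit.{u + 1})
    · cases i with
      | zero => omega
      | succ i => exact inferInstanceAs (Subsingleton PUnit.{u + 1})
  | succ N ih =>
    obtain ⟨P, f, h1, h1', h2, -⟩ := h 1
    obtain ⟨C, hC, hC'⟩ := ih (L := LinearMap.ker f) (fun k => (h (k + 1)).ker f h2)
      fun M _ _ i hi => by
        obtain ⟨i, rfl⟩ : ∃ j, i = j + 1 := ⟨i - 1, by omega⟩
        exact extZero_sub (Submodule.injective_subtype _) h2 (LinearMap.exact_subtype_ker_map f)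
          (extZero_of_projective i) (hN M (i + 1 + 1) (by omega))
    refine ⟨ProjRes.cons P f h2 C, fun i => ?_, fun i hi => ?_⟩
    · cases i with
      | zero => exact h1
      | succ i => exact hC i
    · cases i with
      | zero => omega
      | succ i => exact hC' i (by omega)

end ModFP

/-! ### Twisted Laurent polynomials and the cokernels of t + t⁻¹ - S -/

section TwistedLaurent

set_option linter.unusedSectionVars false

/-- `A` is a ring of twisted Laurent polynomials over `B`: it contains a unit `t` normalising `B`
whose powers form a basis of `A` as a left `B`-module. -/
structure TwistedLaurent (A B : Type u) [Ring A] [Ring B] [Module B A] where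
  t : Aˣ
  σ : RingAut B
  comm : ∀ b : B, (t : A) * (b • (1 : A)) = σ b • (t : A)
  basis : Module.Basis ℤ B A
  basis_apply : ∀ j, basis j = ((t ^ j : Aˣ) : A)

/-- For all matrices `S` over `B`, the operator `u + u⁻¹ - S` is bijective on column vectors
over `M`. -/
def LaurentBij {A : Type*} (B : Type*) [Ring A] [Ring B] [Module B A] (u : Aˣ)
    (M : Type*) [AddCommGroup M] [Module A M] : Prop :=
  ∀ (m : ℕ) (S : Fin m → Fin m → B), Function.Bijective fun (h : Fin m → M) (i : Fin m) =>
    (u : A) • h i + ((u⁻¹ : Aˣ) : A) • h i - ∑ k, (S i k • (1 : A)) • h k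

variable {A B : Type u} [Ring A] [Ring B] [Module B A] [IsScalarTower B A A]

namespace TwistedLaurent

variable (T : TwistedLaurent A B)

theorem t_mul_smul (b : B) (a : A) : (T.t : A) * (b • a) = T.σ b • ((T.t : A) * a) := by
  rw [← one_mul a, ← smul_mul_assoc, ← mul_assoc, T.comm, one_mul, smul_mul_assoc]

theorem t_inv_mul_smul (b : B) (a : A) :
    ((T.t⁻¹ : Aˣ) : A) * (b • a) = (T.σ⁻¹) b • (((T.t⁻¹ : Aˣ) : A) * a) := by
  rw [Units.inv_mul_eq_iff_eq_mul, t_mul_smul, Units.mul_inv_cancel_left]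
  congr 1
  exact (T.σ.apply_symm_apply b).symm

theorem zpow_mul_smul (j : ℤ) (b : B) (a : A) :
    ((T.t ^ j : Aˣ) : A) * (b • a) = (T.σ ^ j) b • (((T.t ^ j : Aˣ) : A) * a) := by
  induction j generalizing b a with
  | zero => simp
  | succ n ih =>
    rw [zpow_add_one, zpow_add_one, Units.val_mul, mul_assoc, t_mul_smul, ih, mul_assoc]
    rfl
  | pred n ih =>
    rw [zpow_sub_one, zpow_sub_one, Units.val_mul, mul_assoc, t_inv_mul_smul, ih, mul_assoc]
    rfl

theorem coord_basis (i j : ℤ) : T.basis.coord j ((T.t ^ i : Aˣ) : A) = if i = j then 1 else 0 := by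
  rw [← T.basis_apply, Module.Basis.coord_apply, Module.Basis.repr_self, Finsupp.single_apply]

theorem coord_mul_t (j : ℤ) (a : A) :
    T.basis.coord j (a * (T.t : A)) = T.basis.coord (j - 1) a := by
  have : T.basis.coord j ∘ₗ LinearMap.mulRight B (T.t : A) = T.basis.coord (j - 1) := by
    refine T.basis.ext fun i => ?_
    rw [LinearMap.comp_apply, LinearMap.mulRight_apply, T.basis_apply, ← Units.val_mul,
      ← zpow_add_one, coord_basis, coord_basis]
    exact if_congr (by omega) rfl rfl
  exact LinearMap.congr_fun this a

theorem coord_mul_t_inv (j : ℤ) (a : A) :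
    T.basis.coord j (a * ((T.t⁻¹ : Aˣ) : A)) = T.basis.coord (j + 1) a := by
  have : T.basis.coord j ∘ₗ LinearMap.mulRight B ((T.t⁻¹ : Aˣ) : A) =
      T.basis.coord (j + 1) := by
    refine T.basis.ext fun i => ?_
    rw [LinearMap.comp_apply, LinearMap.mulRight_apply, T.basis_apply, ← Units.val_mul,
      ← zpow_sub_one, coord_basis, coord_basis]
    exact if_congr (by omega) rfl rfl
  exact LinearMap.congr_fun this a

theorem coord_mul_smul_one (j : ℤ) (a : A) (b : B) :
    T.basis.coord j (a * (b • (1 : A))) = T.basis.coord j a * (T.σ ^ j) b := by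
  have : T.basis.coord j ∘ₗ LinearMap.mulRight B (b • (1 : A)) =
      LinearMap.mulRight B ((T.σ ^ j) b) ∘ₗ T.basis.coord j := by
    refine T.basis.ext fun i => ?_
    rw [LinearMap.comp_apply, LinearMap.mulRight_apply, LinearMap.comp_apply,
      LinearMap.mulRight_apply, T.basis_apply, zpow_mul_smul, mul_one, map_smul, coord_basis]
    split_ifs with h
    · subst h; simp
    · simp
  exact LinearMap.congr_fun this a

section QMod

variable {m : ℕ} (S : Fin m → Fin m → B)

/-- The rows of the matrix `t + t⁻¹ - S`. -/
def qRow (i : Fin m) : Fin m → A :=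
  Pi.single i ((T.t : A) + ((T.t⁻¹ : Aˣ) : A)) - fun k => S i k • (1 : A)

/-- Right multiplication of row vectors by `t + t⁻¹ - S`. -/
def qMap : (Fin m → A) →ₗ[A] (Fin m → A) := Fintype.linearCombination A (T.qRow S)

/-- The cokernel of `t + t⁻¹ - S`. -/
abbrev QMod : Type u := (Fin m → A) ⧸ LinearMap.range (T.qMap S)

theorem linearCombination_qRow {M : Type*} [AddCommGroup M] [Module A M] (h : Fin m → M)
    (i : Fin m) : Fintype.linearCombination A h (T.qRow S i) =
      (T.t : A) • h i + ((T.t⁻¹ : Aˣ) : A) • h i - ∑ k, (S i k • (1 : A)) • h k := by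
  rw [qRow, map_sub, Fintype.linearCombination_apply_single, add_smul,
    Fintype.linearCombination_apply]

theorem qMap_single (i : Fin m) (a : A) : T.qMap S (Pi.single i a) = a • T.qRow S i := by
  rw [qMap, Fintype.linearCombination_apply_single]

theorem qMap_apply (x : Fin m → A) (k : Fin m) : T.qMap S x k =
    x k * (T.t : A) + x k * ((T.t⁻¹ : Aˣ) : A) - ∑ i, x i * (S i k • (1 : A)) := by
  rw [qMap, Fintype.linearCombination_apply, Finset.sum_apply]
  simp only [qRow, Pi.smul_apply, Pi.sub_apply, smul_eq_mul, mul_sub, Finset.sum_sub_distrib]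
  congr 1
  rw [Finset.sum_eq_single k]
  · simp [mul_add]
  · intro b _ hb
    simp [Pi.single_eq_of_ne hb.symm]
  · simp

theorem coord_qMap (x : Fin m → A) (k : Fin m) (j : ℤ) : T.basis.coord j (T.qMap S x k) =
    T.basis.coord (j - 1) (x k) + T.basis.coord (j + 1) (x k) -
      ∑ i, T.basis.coord j (x i) * (T.σ ^ j) (S i k) := by
  rw [qMap_apply, map_sub, map_add, coord_mul_t, coord_mul_t_inv, map_sum]
  simp only [coord_mul_smul_one]

/-- Let p and q be the highest and lowest levels of a non-zero x. Multiplication by t and t⁻¹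
produces non-zero entries in levels p + 1 and q - 1, which nothing can cancel. If the image lies in
levels 0 and 1, then p ≤ 0 and q ≥ 1, contradicting q ≤ p. Allowing two levels serves both
`qMap_injective` and `qParam_injective`. -/
theorem eq_zero_of_coord_qMap (x : Fin m → A)
    (hx : ∀ k j, j ≠ 0 → j ≠ 1 → T.basis.coord j (T.qMap S x k) = 0) : x = 0 := by
  classical
  by_contra hne
  let s : Finset ℤ := Finset.univ.biUnion fun k : Fin m => (T.basis.repr (x k)).support
  have hs : ∀ j, j ∈ s ↔ ∃ k, T.basis.coord j (x k) ≠ 0 := by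
    intro j
    simp [s]
  have hs' : ∀ j, j ∉ s → ∀ k, T.basis.coord j (x k) = 0 := by
    intro j hj k
    by_contra h
    exact hj ((hs j).2 ⟨k, h⟩)
  have hsne : s.Nonempty := by
    by_contra h
    rw [Finset.not_nonempty_iff_eq_empty] at h
    refine hne (funext fun k => ?_)
    refine T.basis.ext_elem fun j => ?_
    have := hs' j (by simp [h]) k
    simpa using this
  obtain ⟨k, hk⟩ := (hs _).1 (s.max'_mem hsne)
  obtain ⟨l, hl⟩ := (hs _).1 (s.min'_mem hsne)
  have hpq := s.min'_le _ (s.max'_mem hsne)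
  set p := s.max' hsne with hp
  set q := s.min' hsne with hq
  have hp' : ∀ j, p < j → j ∉ s := fun j hj hjs => absurd (s.le_max' j hjs) (by omega)
  have hq' : ∀ j, j < q → j ∉ s := fun j hj hjs => absurd (s.min'_le j hjs) (by omega)
  have h1 : T.basis.coord (p + 1) (T.qMap S x k) = T.basis.coord p (x k) := by
    rw [coord_qMap, hs' (p + 1 + 1) (hp' _ (by omega)), Finset.sum_eq_zero, add_sub_cancel_right]
    · simp
    · intro i _
      rw [hs' (p + 1) (hp' _ (by omega)), zero_mul]
  have h2 : T.basis.coord (q - 1) (T.qMap S x l) = T.basis.coord q (x l) := by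
    rw [coord_qMap, hs' (q - 1 - 1) (hq' _ (by omega)), Finset.sum_eq_zero, sub_add_cancel]
    · simp
    · intro i _
      rw [hs' (q - 1) (hq' _ (by omega)), zero_mul]
  have h3 : p + 1 = 0 ∨ p + 1 = 1 := by
    by_contra! h
    exact hk (h1 ▸ hx k (p + 1) h.1 h.2)
  have h4 : q - 1 = 0 ∨ q - 1 = 1 := by
    by_contra! h
    exact hl (h2 ▸ hx l (q - 1) h.1 h.2)
  omega

theorem qMap_injective : Function.Injective (T.qMap S) := by
  rw [injective_iff_map_eq_zero]
  intro x hx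
  exact T.eq_zero_of_coord_qMap S x fun k j _ _ => by rw [hx]; simp

/-- The injective map `qMap` is a free resolution of length one. Applying Hom into M turns it into
the operator t + t⁻¹ - S on column vectors, whose kernel and cokernel are Hom and Ext¹. -/
theorem extZero_QMod {M : Type u} [AddCommGroup M] [Module A M] (hM : LaurentBij B T.t M)
    (i : ℕ) : ExtZero A (T.QMod S) M i := by
  have hex : Function.Exact (T.qMap S) (LinearMap.range (T.qMap S)).mkQ :=
    LinearMap.exact_map_mkQ_range _
  have hsur := Submodule.mkQ_surjective (LinearMap.range (T.qMap S))
  have hinj := T.qMap_injective S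
  match i with
  | 0 =>
    rw [extZero_zero_iff]
    intro f
    set h : Fin m → M := fun k => f (Submodule.Quotient.mk (Pi.single k 1)) with hh
    have hf : f ∘ₗ (LinearMap.range (T.qMap S)).mkQ = Fintype.linearCombination A h := by
      refine LinearMap.pi_ext' fun k => LinearMap.ext_ring ?_
      simp [hh]
    have h0 : h = 0 := by
      refine (hM m S).1 (funext fun i => ?_)
      beta_reduce
      rw [← linearCombination_qRow, ← linearCombination_qRow, ← hf]
      have : (LinearMap.range (T.qMap S)).mkQ (T.qRow S i) = 0 := by
        rw [← LinearMap.mem_ker, Submodule.ker_mkQ]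
        exact ⟨Pi.single i 1, by rw [qMap_single, one_smul]⟩
      rw [LinearMap.comp_apply, this, map_zero, Fintype.linearCombination_apply]
      simp
    ext x
    have := LinearMap.congr_fun hf (Pi.single x 1)
    rw [h0] at this
    simpa [Fintype.linearCombination_apply] using this
  | 1 =>
    refine extZero_one_of_extend hinj hsur hex (extZero_of_projective 0) fun k => ?_
    obtain ⟨h, hh⟩ := (hM m S).2 fun i => k (Pi.single i 1)
    refine ⟨Fintype.linearCombination A h, LinearMap.pi_ext' fun i => LinearMap.ext_ring ?_⟩
    rw [LinearMap.comp_apply, LinearMap.comp_apply, LinearMap.coe_single, qMap_single, one_smul,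
      linearCombination_qRow]
    exact congrFun hh i
  | i + 2 =>
    exact extZero_quotient hinj hsur hex (extZero_of_projective i) (extZero_of_projective (i + 1))

/-- The classes of the vectors `tʲ eₖ`. -/
def qGen (j : ℤ) (k : Fin m) : T.QMod S :=
  Submodule.Quotient.mk (Pi.single k ((T.t ^ j : Aˣ) : A))

/-- This is tʲ times a defining relation; moving the entries of S past tʲ twists them by σʲ. The
recursion determines all levels from two consecutive ones. -/
theorem qGen_rec (j : ℤ) (k : Fin m) :
    T.qGen S (j + 1) k + T.qGen S (j - 1) k = ∑ i, (T.σ ^ j) (S k i) • T.qGen S j i := by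
  have h : (Submodule.Quotient.mk (T.qMap S (Pi.single k ((T.t ^ j : Aˣ) : A))) : T.QMod S) = 0 :=
    (Submodule.Quotient.mk_eq_zero _).2 ⟨_, rfl⟩
  rw [qMap_single, qRow, smul_sub, Submodule.Quotient.mk_sub, sub_eq_zero] at h
  have h1 : ((T.t ^ j : Aˣ) : A) • (Pi.single k ((T.t : A) + ((T.t⁻¹ : Aˣ) : A)) : Fin m → A) =
      Pi.single k ((T.t ^ (j + 1) : Aˣ) : A) + Pi.single k ((T.t ^ (j - 1) : Aˣ) : A) := by
    rw [← Pi.single_add, ← Pi.single_smul, zpow_add_one, zpow_sub_one, smul_eq_mul, mul_add,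
      Units.val_mul, Units.val_mul]
  have h2 : (((T.t ^ j : Aˣ) : A) • fun i => S k i • (1 : A) : Fin m → A) =
      ∑ i, (T.σ ^ j) (S k i) • (Pi.single i ((T.t ^ j : Aˣ) : A) : Fin m → A) := by
    funext i
    rw [Finset.sum_apply, Finset.sum_eq_single i]
    · simp [zpow_mul_smul]
    · intro l _ hl
      simp [Pi.single_eq_of_ne hl.symm]
    · simp
  rw [h1, h2] at h
  have h3 : (Submodule.Quotient.mk (∑ i, (T.σ ^ j) (S k i) •
      (Pi.single i ((T.t ^ j : Aˣ) : A) : Fin m → A)) : T.QMod S) =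
      ∑ i, (T.σ ^ j) (S k i) • T.qGen S j i :=
    map_sum ((LinearMap.range (T.qMap S)).mkQ.restrictScalars B) _ _ |>.trans
      (Finset.sum_congr rfl fun i _ => rfl)
  rw [h3] at h
  exact h

/-- The `B`-linear parametrisation of `QMod` by the classes of `eₖ` and `t eₖ`. -/
def qParam : ((Fin m → B) × (Fin m → B)) →ₗ[B] T.QMod S :=
  (Fintype.linearCombination B (T.qGen S 0)).coprod (Fintype.linearCombination B (T.qGen S 1))

theorem qGen_mem_range (j : ℤ) (k : Fin m) : T.qGen S j k ∈ LinearMap.range (T.qParam S) := by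
  -- The recursion has order two, so the induction carries two neighbouring levels.
  have h : ∀ j : ℤ, (∀ k, T.qGen S j k ∈ LinearMap.range (T.qParam S)) ∧
      ∀ k, T.qGen S (j + 1) k ∈ LinearMap.range (T.qParam S) := by
    intro j
    induction j with
    | zero =>
      constructor
      · intro k
        exact ⟨(Pi.single k 1, 0), by simp [qParam]⟩
      · intro k
        exact ⟨(0, Pi.single k 1), by simp [qParam]⟩
    | succ n ih =>
      refine ⟨ih.2, fun k => ?_⟩
      have := T.qGen_rec S (n + 1) k
      rw [add_sub_cancel_right, ← eq_sub_iff_add_eq] at this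
      rw [this]
      exact Submodule.sub_mem _ (Submodule.sum_mem _ fun i _ => Submodule.smul_mem _ _ (ih.2 i))
        (ih.1 k)
    | pred n ih =>
      refine ⟨fun k => ?_, fun k => by rw [sub_add_cancel]; exact ih.1 k⟩
      have := T.qGen_rec S (-n) k
      rw [← eq_sub_iff_add_eq'] at this
      rw [this]
      exact Submodule.sub_mem _ (Submodule.sum_mem _ fun i _ => Submodule.smul_mem _ _ (ih.1 i))
        (ih.2 k)
  exact (h j).1 k

theorem qParam_surjective : Function.Surjective (T.qParam S) := by
  rw [← LinearMap.range_eq_top, eq_top_iff]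
  rintro x -
  obtain ⟨x, rfl⟩ := Submodule.mkQ_surjective _ x
  have hk : ∀ (k : Fin m) (a : A), (LinearMap.range (T.qMap S)).mkQ (Pi.single k a) ∈
      LinearMap.range (T.qParam S) := by
    intro k
    let w : A →ₗ[B] T.QMod S := (LinearMap.range (T.qMap S)).mkQ.restrictScalars B ∘ₗ
      LinearMap.single B (fun _ : Fin m => A) k
    have hw : (LinearMap.range (T.qParam S)).comap w = ⊤ := by
      rw [eq_top_iff, ← T.basis.span_eq, Submodule.span_le]
      rintro _ ⟨j, rfl⟩
      rw [T.basis_apply]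
      exact T.qGen_mem_range S j k
    intro a
    have : a ∈ (LinearMap.range (T.qParam S)).comap w := hw ▸ Submodule.mem_top
    exact this
  rw [← Finset.univ_sum_single x, map_sum]
  exact Submodule.sum_mem _ fun k _ => hk k _

theorem qParam_injective : Function.Injective (T.qParam S) := by
  rw [injective_iff_map_eq_zero]
  rintro ⟨x, y⟩ hxy
  have h1 : T.qParam S (x, y) = Submodule.Quotient.mk
      (fun k => x k • (1 : A) + y k • (T.t : A)) := by
    have e : ∀ (z : Fin m → B) (j : ℤ), Fintype.linearCombination B (T.qGen S j) z =
        Submodule.Quotient.mk (fun k => z k • ((T.t ^ j : Aˣ) : A)) := by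
      intro z j
      have : (fun k => z k • ((T.t ^ j : Aˣ) : A)) =
          ∑ k, z k • (Pi.single k ((T.t ^ j : Aˣ) : A) : Fin m → A) := by
        funext i
        rw [Finset.sum_apply, Finset.sum_eq_single i]
        · simp
        · intro l _ hl
          simp [Pi.single_eq_of_ne hl.symm]
        · simp
      rw [this, Fintype.linearCombination_apply]
      exact (map_sum ((LinearMap.range (T.qMap S)).mkQ.restrictScalars B) _ _ |>.trans
        (Finset.sum_congr rfl fun i _ => rfl)).symm
    rw [qParam, LinearMap.coprod_apply, e x 0, e y 1, ← Submodule.Quotient.mk_add, zpow_zero,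
      zpow_one, Units.val_one]
    rfl
  rw [h1, Submodule.Quotient.mk_eq_zero] at hxy
  obtain ⟨z, hz⟩ := hxy
  have hc : ∀ k j, T.basis.coord j (T.qMap S z k) =
      x k * (if 0 = j then 1 else 0) + y k * (if 1 = j then 1 else 0) := by
    intro k j
    rw [hz, map_add, map_smul, map_smul]
    have e0 := T.coord_basis 0 j
    have e1 := T.coord_basis 1 j
    rw [zpow_zero, Units.val_one] at e0
    rw [zpow_one] at e1
    rw [e0, e1, smul_eq_mul, smul_eq_mul]
  -- A relation between the proposed basis elements is an image under `qMap` supported in levels 0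
  -- and 1 only.
  have hz0 : z = 0 := T.eq_zero_of_coord_qMap S z fun k j h0 h1 => by
    rw [hc, if_neg h0.symm, if_neg h1.symm, mul_zero, mul_zero, add_zero]
  subst hz0
  refine Prod.ext (funext fun k => ?_) (funext fun k => ?_)
  · simpa using (hc k 0).symm
  · simpa using (hc k 1).symm

instance : Module.Finite B (T.QMod S) :=
  Module.Finite.of_surjective _ (T.qParam_surjective S)

instance : Module.Projective B (T.QMod S) :=
  Module.Projective.of_equiv
    (LinearEquiv.ofBijective _ ⟨T.qParam_injective S, T.qParam_surjective S⟩)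

end QMod

/-- For B-generators l of L, each (t + t⁻¹) lᵢ is a B-combination of l. The coefficients form S, and
the relations of `QMod` then hold in L. -/
theorem exists_cover (L : Type*) [AddCommGroup L] [Module A L] [Module B L] [IsScalarTower B A L]
    [Module.Finite B L] : ∃ (m : ℕ) (S : Fin m → Fin m → B) (π : T.QMod S →ₗ[A] L),
      Function.Surjective π := by
  obtain ⟨m, l, hl⟩ := Module.Finite.exists_fin (R := B) (M := L)
  have hS : ∀ i, ∃ c : Fin m → B, ∑ k, c k • l k =
      (T.t : A) • l i + ((T.t⁻¹ : Aˣ) : A) • l i := fun i =>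
    (Submodule.mem_span_range_iff_exists_fun B).1 (hl ▸ Submodule.mem_top)
  choose S hS using hS
  refine ⟨m, S, (LinearMap.range (T.qMap S)).liftQ (Fintype.linearCombination A l) ?_, ?_⟩
  · rintro _ ⟨x, rfl⟩
    rw [LinearMap.mem_ker, ← LinearMap.comp_apply]
    have : Fintype.linearCombination A l ∘ₗ T.qMap S = 0 := by
      refine LinearMap.pi_ext' fun i => LinearMap.ext_ring ?_
      rw [LinearMap.comp_apply, LinearMap.comp_apply, LinearMap.coe_single, qMap_single, one_smul,
        linearCombination_qRow, ← hS]
      simp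
    rw [this, LinearMap.zero_apply]
  · intro y
    obtain ⟨c, rfl⟩ := (Submodule.mem_span_range_iff_exists_fun B).1
      (hl ▸ Submodule.mem_top : y ∈ Submodule.span B (Set.range l))
    refine ⟨Submodule.Quotient.mk fun k => c k • (1 : A), ?_⟩
    simp [Fintype.linearCombination_apply]

/-- The two `B`-module structures on the kernel of an `A`-linear map agree. -/
def kerRestrictScalars {F L : Type*} [AddCommGroup L] [Module A L] [Module B L]
    [IsScalarTower B A L] [AddCommGroup F] [Module A F] [Module B F] [IsScalarTower B A F]
    (π : F →ₗ[A] L) : LinearMap.ker (π.restrictScalars B) ≃ₗ[B] LinearMap.ker π where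
  toFun x := ⟨x.1, x.2⟩
  invFun x := ⟨x.1, x.2⟩
  map_add' _ _ := rfl
  map_smul' _ _ := rfl

/-- Dimension shifting along the cover by `QMod`. That cover is Ext-acyclic over A and finitely
generated projective over B, so its kernel loses exactly one degree of finiteness over B. -/
theorem extZero_of_modFP {k : ℕ} : ∀ {L : Type u} [AddCommGroup L] [Module A L] [Module B L]
    [IsScalarTower B A L], ModFP B k L → ∀ {M : Type u} [AddCommGroup M] [Module A M],
      LaurentBij B T.t M → ∀ i ≤ k, ExtZero A L M i := by
  induction k with
  | zero =>
    intro L _ _ _ _ hL M _ _ hM i hi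
    obtain rfl : i = 0 := by omega
    have := hL.finite
    obtain ⟨m, S, π, hπ⟩ := T.exists_cover L
    rw [extZero_zero_iff]
    intro f
    have := extZero_zero_iff.1 (T.extZero_QMod S hM 0) (f ∘ₗ π)
    ext x
    obtain ⟨y, rfl⟩ := hπ x
    exact LinearMap.congr_fun this y
  | succ k ih =>
    intro L _ _ _ _ hL M _ _ hM i hi
    have := hL.finite
    obtain ⟨m, S, π, hπ⟩ := T.exists_cover L
    cases i with
    | zero =>
      rw [extZero_zero_iff]
      intro f
      have := extZero_zero_iff.1 (T.extZero_QMod S hM 0) (f ∘ₗ π)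
      ext x
      obtain ⟨y, rfl⟩ := hπ x
      exact LinearMap.congr_fun this y
    | succ i =>
      have h1 : ModFP B k (LinearMap.ker π) :=
        (hL.ker (π.restrictScalars B) hπ).congr (kerRestrictScalars π)
      exact extZero_quotient (Submodule.injective_subtype _) hπ (LinearMap.exact_subtype_ker_map π)
        (ih h1 hM i (by omega)) (T.extZero_QMod S hM (i + 1))

end TwistedLaurent

end TwistedLaurent

/-! ### Coinduced modules, Novikov submodules and the finiteness criterion -/

section Novikov

set_option linter.unusedSectionVars false

variable {A B : Type u} [Ring A] [Ring B] [Module B A] [IsScalarTower B A A]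

variable (A B) in
/-- The coinduced module `Hom_B(A, N)`, on which `A` acts through right multiplication on `A`. -/
def Coind (N : Type u) [AddCommGroup N] [Module B N] : Type u := A →ₗ[B] N

namespace Coind

variable {N N' : Type u} [AddCommGroup N] [Module B N] [AddCommGroup N'] [Module B N']

instance : AddCommGroup (Coind A B N) := inferInstanceAs (AddCommGroup (A →ₗ[B] N))

instance : FunLike (Coind A B N) A N := inferInstanceAs (FunLike (A →ₗ[B] N) A N)

instance : LinearMapClass (Coind A B N) B A N :=
  inferInstanceAs (LinearMapClass (A →ₗ[B] N) B A N)

instance : Module A (Coind A B N) where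
  smul a h := LinearMap.comp (M₂ := A) h (LinearMap.mulRight B a)
  one_smul h := LinearMap.ext fun x => congrArg h (mul_one x)
  mul_smul a b h := LinearMap.ext fun x => congrArg h (mul_assoc x a b).symm
  smul_zero _ := rfl
  smul_add _ _ _ := rfl
  add_smul a b h := LinearMap.ext fun x =>
    (congrArg h (mul_add x a b)).trans (map_add h _ _)
  zero_smul h := LinearMap.ext fun x => (congrArg h (mul_zero x)).trans (map_zero h)

theorem smul_apply (a : A) (h : Coind A B N) (x : A) : (a • h) x = h (x * a) := rfl

theorem add_apply (h k : Coind A B N) (x : A) : (h + k) x = h x + k x := rfl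

theorem sub_apply (h k : Coind A B N) (x : A) : (h - k) x = h x - k x := rfl

theorem neg_apply (h : Coind A B N) (x : A) : (-h) x = -h x := rfl

theorem ext {h k : Coind A B N} (e : ∀ x, h x = k x) : h = k := LinearMap.ext e

/-- Evaluation at a point. -/
def eval (x : A) : Coind A B N →+ N where
  toFun h := h x
  map_zero' := rfl
  map_add' _ _ := rfl

/-- Functoriality of the coinduced module. -/
def map (g : N →ₗ[B] N') : Coind A B N →ₗ[A] Coind A B N' where
  toFun h := LinearMap.comp (M₂ := N) g h
  map_add' h k := LinearMap.ext fun x => map_add g (h x) (k x)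
  map_smul' _ _ := rfl

theorem map_apply (g : N →ₗ[B] N') (h : Coind A B N) (x : A) : map g h x = g (h x) := rfl

/-- The adjoint of a `B`-linear map. -/
def lift {L : Type*} [AddCommGroup L] [Module A L] [Module B L] [IsScalarTower B A L]
    (f : L →ₗ[B] N) : L →ₗ[A] Coind A B N where
  toFun l := f ∘ₗ (LinearMap.toSpanSingleton A L l).restrictScalars B
  map_add' l l' := LinearMap.ext fun x => by
    change f (x • (l + l')) = f (x • l) + f (x • l')
    rw [smul_add, map_add]
  map_smul' a l := LinearMap.ext fun x => by
    change f (x • a • l) = f ((x * a) • l)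
    rw [mul_smul]

theorem lift_apply {L : Type*} [AddCommGroup L] [Module A L] [Module B L] [IsScalarTower B A L]
    (f : L →ₗ[B] N) (l : L) (x : A) : (lift f l : Coind A B N) x = f (x • l) := rfl

end Coind

namespace TwistedLaurent

variable (T : TwistedLaurent A B) {N N' : Type u} [AddCommGroup N] [Module B N]
  [AddCommGroup N'] [Module B N']

theorem coind_ext {h k : Coind A B N} (e : ∀ j : ℤ, h ((T.t ^ j : Aˣ) : A) =
    k ((T.t ^ j : Aˣ) : A)) : h = k :=
  T.basis.ext fun j => by rw [T.basis_apply]; exact e j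

/-- The element of the coinduced module with prescribed values at the powers of `t`. -/
def coindMk (v : ℤ → N) : Coind A B N := T.basis.constr ℕ v

theorem coindMk_apply (v : ℤ → N) (j : ℤ) : T.coindMk v ((T.t ^ j : Aˣ) : A) = v j := by
  rw [← T.basis_apply]
  exact T.basis.constr_basis ℕ v j

theorem smul_zpow_apply (b : B) (i : ℤ) (h : Coind A B N) (j : ℤ) :
    ((b • ((T.t ^ i : Aˣ) : A)) • h) ((T.t ^ j : Aˣ) : A) =
      (T.σ ^ j) b • h ((T.t ^ (j + i) : Aˣ) : A) := by
  rw [Coind.smul_apply, zpow_mul_smul, map_smul, ← Units.val_mul, zpow_add]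

theorem smul_one_apply (b : B) (h : Coind A B N) (j : ℤ) :
    ((b • (1 : A)) • h) ((T.t ^ j : Aˣ) : A) = (T.σ ^ j) b • h ((T.t ^ j : Aˣ) : A) := by
  have := T.smul_zpow_apply b 0 h j
  rwa [zpow_zero, Units.val_one, add_zero] at this

/-- The Novikov submodule of the coinduced module: the elements with `h(tʲ) = 0` for all large
`s * j`. -/
def Nov (s : ℤˣ) (N : Type u) [AddCommGroup N] [Module B N] : Submodule A (Coind A B N) where
  carrier := {h | ∃ c : ℤ, ∀ j : ℤ, c < s * j → h ((T.t ^ j : Aˣ) : A) = 0}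
  zero_mem' := ⟨0, fun _ _ => rfl⟩
  add_mem' := by
    rintro h k ⟨c, hc⟩ ⟨c', hc'⟩
    refine ⟨max c c', fun j hj => ?_⟩
    rw [Coind.add_apply, hc j (lt_of_le_of_lt (le_max_left _ _) hj),
      hc' j (lt_of_le_of_lt (le_max_right _ _) hj), add_zero]
  smul_mem' := by
    intro a
    have ha : a ∈ Submodule.span B (Set.range T.basis) := T.basis.mem_span a
    induction ha using Submodule.span_induction with
    | mem a ha =>
      obtain ⟨i, rfl⟩ := ha
      rintro h ⟨c, hc⟩
      refine ⟨c - s * i, fun j hj => ?_⟩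
      have := T.smul_zpow_apply 1 i h j
      rw [one_smul] at this
      rw [T.basis_apply, this, hc _ (by rw [mul_add]; omega), smul_zero]
    | zero =>
      rintro h -
      rw [zero_smul]
      exact ⟨0, fun _ _ => rfl⟩
    | add a b _ _ iha ihb =>
      intro h hh
      obtain ⟨c, hc⟩ := iha hh
      obtain ⟨c', hc'⟩ := ihb hh
      refine ⟨max c c', fun j hj => ?_⟩
      rw [add_smul, Coind.add_apply, hc j (lt_of_le_of_lt (le_max_left _ _) hj),
        hc' j (lt_of_le_of_lt (le_max_right _ _) hj), add_zero]
    | smul b a _ ih =>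
      intro h hh
      obtain ⟨c, hc⟩ := ih hh
      refine ⟨c, fun j hj => ?_⟩
      rw [← smul_one_mul b a, mul_smul, smul_one_apply, hc j hj, smul_zero]

theorem map_mem_nov {s : ℤˣ} (g : N →ₗ[B] N') {h : Coind A B N} (hh : h ∈ T.Nov s N) :
    Coind.map g h ∈ T.Nov s N' := by
  obtain ⟨c, hc⟩ := hh
  exact ⟨c, fun j hj => by rw [Coind.map_apply, hc j hj, map_zero]⟩

/-- The vectors over the coinduced module that vanish in levels above `c`. -/
def Fil (s : ℤˣ) (m : ℕ) (c : ℤ) : AddSubgroup (Fin m → Coind A B N) where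
  carrier := {h | ∀ k (j : ℤ), c < s * j → h k ((T.t ^ j : Aˣ) : A) = 0}
  zero_mem' := fun _ _ _ => rfl
  add_mem' := by
    intro h h' hh hh' k j hj
    rw [Pi.add_apply, Coind.add_apply, hh k j hj, hh' k j hj, add_zero]
  neg_mem' := by
    intro h hh k j hj
    rw [Pi.neg_apply, Coind.neg_apply, hh k j hj, neg_zero]

theorem fil_mono {s : ℤˣ} {m : ℕ} {c c' : ℤ} (hc : c ≤ c') :
    T.Fil (N := N) s m c ≤ T.Fil s m c' := fun _ hh k j hj => hh k j (by omega)

theorem eq_zero_of_mem_fil {s : ℤˣ} {m : ℕ} {c : ℤ} {h : Fin m → Coind A B N}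
    (hh : ∀ n : ℕ, h ∈ T.Fil s m (c - n)) : h = 0 := by
  refine funext fun k => T.coind_ext fun j => ?_
  exact hh ((c - s * j + 1).toNat) k j (by omega)

variable {s : ℤˣ} {m : ℕ}
  (θ : (Fin m → Coind A B N) →+ (Fin m → Coind A B N))

theorem eq_zero_of_sub_eq_zero
    (hθ : ∀ c, ∀ h ∈ T.Fil s m c, θ h ∈ T.Fil s m (c - 1)) {c : ℤ} {h : Fin m → Coind A B N} (hh : h ∈ T.Fil s m c)
    (h0 : h - θ h = 0) : h = 0 := by
  refine T.eq_zero_of_mem_fil (s := s) (c := c) fun n => ?_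
  induction n with
  | zero => simpa using hh
  | succ n ih =>
    rw [sub_eq_zero.1 h0]
    have := hθ _ _ ih
    rwa [Nat.cast_succ, ← sub_sub]

theorem exists_sub_eq
    (hθ : ∀ c, ∀ h ∈ T.Fil s m c, θ h ∈ T.Fil s m (c - 1)) {c : ℤ} {h : Fin m → Coind A B N} (hh : h ∈ T.Fil s m c) :
    ∃ f ∈ T.Fil s m c, f - θ f = h := by
  -- The partial sums of the geometric series h + θh + θ²h + ⋯.
  let f : ℕ → (Fin m → Coind A B N) := fun n => Nat.rec 0 (fun _ x => h + θ x) n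
  have hf : ∀ n, f (n + 1) = h + θ (f n) := fun n => rfl
  have h1 : ∀ n : ℕ, f (n + 1) - f n ∈ T.Fil s m (c - n) := by
    intro n
    induction n with
    | zero =>
      have : f (0 + 1) - f 0 = h := by
        change h + θ 0 - 0 = h
        rw [map_zero, add_zero, sub_zero]
      rw [this]
      simpa using hh
    | succ n ih =>
      have : f (n + 1 + 1) - f (n + 1) = θ (f (n + 1) - f n) := by
        rw [hf (n + 1), map_sub, hf n]
        abel
      rw [this, Nat.cast_succ, ← sub_sub]
      exact hθ _ _ ih
  have h2 : ∀ n p : ℕ, f (n + p) - f n ∈ T.Fil s m (c - n) := by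
    intro n p
    induction p with
    | zero => rw [add_zero, sub_self]; exact zero_mem _
    | succ p ih =>
      have := add_mem (T.fil_mono (by omega) (h1 (n + p))) ih
      rwa [← add_assoc, show f (n + p + 1) - f n = f (n + p + 1) - f (n + p) + (f (n + p) - f n)
        by abel]
  -- The limit, taken level by level: by `h2`, the sequence is constant at level j from index n on
  -- once s * j > c - n.
  let g : Fin m → Coind A B N := fun k => T.coindMk fun j =>
    f ((c - s * j + 1).toNat) k ((T.t ^ j : Aˣ) : A)
  have h3 : ∀ n : ℕ, g - f n ∈ T.Fil s m (c - n) := by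
    intro n k j hj
    rw [Pi.sub_apply, Coind.sub_apply, coindMk_apply]
    obtain ⟨p, hp⟩ : ∃ p, n = (c - s * j + 1).toNat + p := ⟨n - (c - s * j + 1).toNat, by omega⟩
    rw [← neg_eq_zero, neg_sub]
    have := h2 ((c - s * j + 1).toNat) p k j (by omega)
    rwa [← hp] at this
  refine ⟨g, ?_, ?_⟩
  · have := h3 0
    change g - 0 ∈ _ at this
    simpa using this
  · rw [← sub_eq_zero]
    refine T.eq_zero_of_mem_fil (s := s) (c := c) fun n => ?_
    have e : g - θ g - h = (g - f n) - θ (g - f n) + (f n - f (n + 1)) := by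
      rw [hf, map_sub]
      abel
    rw [e]
    refine add_mem (sub_mem (h3 n) (T.fil_mono (by omega) (hθ _ _ (h3 n)))) ?_
    rw [← neg_sub (f (n + 1))]
    exact neg_mem (h1 n)

/-- The operator `u S - u²`. -/
def theta {A : Type*} [Ring A] (u : A) {m : ℕ} (S : Fin m → Fin m → A) (M : Type*)
    [AddCommGroup M] [Module A M] : (Fin m → M) →+ (Fin m → M) where
  toFun h i := ∑ k, (u * S i k) • h k - (u * u) • h i
  map_zero' := by
    funext i
    simp
  map_add' h h' := by
    funext i
    simp only [Pi.add_apply, smul_add, Finset.sum_add_distrib]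
    abel

theorem theta_mem_fil (u : A) (b : B) (q : ℤ) (hu : u = b • ((T.t ^ q : Aˣ) : A))
    (hq : 0 < s * q) (S : Fin m → Fin m → B) (c : ℤ) (h : Fin m → Coind A B N)
    (hh : h ∈ T.Fil s m c) :
    theta u (fun i k => S i k • (1 : A)) (Coind A B N) h ∈ T.Fil s m (c - 1) := by
  intro i j hj
  have h1 : ∀ (k : Coind A B N) (j : ℤ), (u • k) ((T.t ^ j : Aˣ) : A) =
      (T.σ ^ j) b • k ((T.t ^ (j + q) : Aˣ) : A) := by
    intro k j
    rw [hu, smul_zpow_apply]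
  change (∑ k, (u * (S i k • (1 : A))) • h k - (u * u) • h i) ((T.t ^ j : Aˣ) : A) = 0
  rw [Coind.sub_apply]
  have h2 : (∑ k, (u * (S i k • (1 : A))) • h k) ((T.t ^ j : Aˣ) : A) = 0 := by
    refine (map_sum (Coind.eval (B := B) (N := N) ((T.t ^ j : Aˣ) : A)) _ _).trans
      (Finset.sum_eq_zero fun k _ => ?_)
    change ((u * (S i k • (1 : A))) • h k) ((T.t ^ j : Aˣ) : A) = 0
    rw [mul_smul, h1, smul_one_apply, hh k _ (by rw [mul_add]; omega), smul_zero, smul_zero]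
  rw [h2, mul_smul, h1, h1, hh i _ (by rw [mul_add, mul_add]; omega), smul_zero, smul_zero,
    sub_zero]

theorem laurentBij_inv {u : Aˣ} {M : Type*} [AddCommGroup M] [Module A M]
    (h : LaurentBij B u M) : LaurentBij B u⁻¹ M := by
  intro m S
  have := h m S
  have e : (fun (h : Fin m → M) (i : Fin m) => ((u⁻¹ : Aˣ) : A) • h i +
      (((u⁻¹)⁻¹ : Aˣ) : A) • h i - ∑ k, (S i k • (1 : A)) • h k) =
      fun h i => (u : A) • h i + ((u⁻¹ : Aˣ) : A) • h i - ∑ k, (S i k • (1 : A)) • h k := by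
    funext h i
    rw [inv_inv, add_comm ((u : A) • h i)]
  rwa [e]

/-- Here u + u⁻¹ - S = u⁻¹(1 - θ) with θ = uS - u². As s * q > 0, the operator θ lowers the level
filtration, so 1 - θ is inverted by its geometric series on vectors whose levels are bounded above.
-/
theorem laurentBij_nov_of_pos (u : Aˣ) (b : B) (q : ℤ) (hu : (u : A) = b • ((T.t ^ q : Aˣ) : A))
    (s : ℤˣ) (hq : 0 < s * q) : LaurentBij B u (T.Nov s N) := by
  intro m S
  have key : ∀ (M : Type u) [AddCommGroup M] [Module A M] (h : Fin m → M) i,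
      (u : A) • h i + ((u⁻¹ : Aˣ) : A) • h i - ∑ k, (S i k • (1 : A)) • h k =
      ((u⁻¹ : Aˣ) : A) • (h - theta (u : A) (fun i k => S i k • (1 : A)) M h) i := by
    intro M _ _ h i
    change _ = ((u⁻¹ : Aˣ) : A) • (h i -
      (∑ k, ((u : A) * (S i k • (1 : A))) • h k - ((u : A) * u) • h i))
    rw [smul_sub, smul_sub, Finset.smul_sum]
    simp only [smul_smul, Units.inv_mul_cancel_left]
    abel
  have hbd : ∀ h : Fin m → T.Nov s N, ∃ c, (fun k => (h k).1) ∈ T.Fil s m c := by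
    intro h
    choose c hc using fun k => (h k).2
    obtain ⟨C, hC⟩ := Finite.exists_le c
    exact ⟨C, fun k j hj => hc k j (lt_of_le_of_lt (hC k) hj)⟩
  have hth : ∀ h : Fin m → T.Nov s N, (fun k => (theta (u : A) (fun i k => S i k • (1 : A))
      (T.Nov s N) h k).1) = theta (u : A) (fun i k => S i k • (1 : A)) (Coind A B N)
        (fun k => (h k).1) := by
    intro h
    funext i
    change (T.Nov s N).subtype (∑ k, ((u : A) * (S i k • (1 : A))) • h k - ((u : A) * u) • h i) = _
    rw [map_sub, map_sum]
    rfl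
  constructor
  · intro h h' hhh
    rw [← sub_eq_zero]
    set d := h - h' with hd
    have h0 : d - theta (u : A) (fun i k => S i k • (1 : A)) (T.Nov s N) d = 0 := by
      funext i
      have e := congrFun hhh i
      simp only [key] at e
      have e' : (h - theta (u : A) (fun i k => S i k • (1 : A)) (T.Nov s N) h) i =
          (h' - theta (u : A) (fun i k => S i k • (1 : A)) (T.Nov s N) h') i := by
        have := congrArg (fun x => (u : A) • x) e
        simpa only [smul_smul, Units.mul_inv, one_smul] using this
      rw [hd, map_sub]
      simp only [Pi.sub_apply, Pi.zero_apply] at e' ⊢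
      rw [sub_sub_sub_comm, e', sub_self]
    obtain ⟨c, hc⟩ := hbd d
    have := T.eq_zero_of_sub_eq_zero _ (T.theta_mem_fil u b q hu hq S) hc (by
      rw [← hth]
      funext i
      exact congrArg Subtype.val (congrFun h0 i))
    funext i
    exact Subtype.ext (congrFun this i)
  · intro h
    obtain ⟨c, hc⟩ := hbd fun i => (u : A) • h i
    obtain ⟨f, hf, hf'⟩ := T.exists_sub_eq _ (T.theta_mem_fil u b q hu hq S) hc
    let g : Fin m → T.Nov s N := fun k => ⟨f k, c, fun j hj => hf k j hj⟩
    refine ⟨g, funext fun i => ?_⟩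
    beta_reduce
    rw [key]
    have : (g - theta (u : A) (fun i k => S i k • (1 : A)) (T.Nov s N) g) i = (u : A) • h i := by
      refine Subtype.ext ?_
      rw [← congrFun hf' i]
      change (g i).1 - (theta (u : A) (fun i k => S i k • (1 : A)) (T.Nov s N) g i).1 = _
      rw [congrFun (hth g) i]
      rfl
    rw [this, smul_smul, Units.inv_mul, one_smul]

/-- The operator is symmetric in u and u⁻¹, so the geometric series is expanded in whichever of the
two has the right sign. Both Novikov directions are thus covered. -/
theorem laurentBij_nov (u : Aˣ) (b b' : B) (q : ℤ) (hq : q ≠ 0)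
    (hu : (u : A) = b • ((T.t ^ q : Aˣ) : A))
    (hu' : ((u⁻¹ : Aˣ) : A) = b' • ((T.t ^ (-q) : Aˣ) : A)) (s : ℤˣ) :
    LaurentBij B u (T.Nov s N) := by
  have hs : (s : ℤ) * q ≠ 0 := mul_ne_zero s.ne_zero hq
  rcases lt_or_gt_of_ne hs with h | h
  · have := laurentBij_inv (T.laurentBij_nov_of_pos (N := N) u⁻¹ b' (-q) hu' s (by
      rw [mul_neg]; omega))
    rwa [inv_inv] at this
  · exact T.laurentBij_nov_of_pos u b q hu s h

theorem laurentBij_nov_t (s : ℤˣ) : LaurentBij B T.t (T.Nov s N) :=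
  T.laurentBij_nov T.t 1 1 1 one_ne_zero (by simp) (by simp) s

/-- Truncation at level 0 writes every element of the coinduced module as such a sum. Truncation is
not A-linear, so projectivity of P is needed to choose the summands linearly. -/
theorem exists_nov_decomposition {P : Type*} [AddCommGroup P] [Module A P] [Module.Projective A P]
    (f : P →ₗ[A] Coind A B N) : ∃ (f₁ : P →ₗ[A] T.Nov 1 N) (f₂ : P →ₗ[A] T.Nov (-1) N),
      ∀ x, f x = (f₁ x).1 + (f₂ x).1 := by
  let π : (T.Nov 1 N × T.Nov (-1) N) →ₗ[A] Coind A B N :=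
    (T.Nov 1 N).subtype.coprod (T.Nov (-1) N).subtype
  have hπ : Function.Surjective π := by
    intro h
    refine ⟨(⟨T.coindMk fun j => if j ≤ 0 then h ((T.t ^ j : Aˣ) : A) else 0, 0, fun j hj => ?_⟩,
      ⟨T.coindMk fun j => if j ≤ 0 then 0 else h ((T.t ^ j : Aˣ) : A), 0, fun j hj => ?_⟩), ?_⟩
    · rw [coindMk_apply, if_neg]
      simpa using hj
    · rw [coindMk_apply, if_pos]
      simp at hj
      omega
    · refine T.coind_ext fun j => ?_
      rw [LinearMap.coprod_apply, Submodule.subtype_apply, Submodule.subtype_apply,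
        Coind.add_apply, coindMk_apply, coindMk_apply]
      split_ifs <;> simp
  obtain ⟨g, hg⟩ := Module.projective_lifting_property π f hπ
  exact ⟨LinearMap.fst A _ _ ∘ₗ g, LinearMap.snd A _ _ ∘ₗ g, fun x =>
    (LinearMap.congr_fun hg x).symm⟩

theorem finite_range_of_mem_nov {h : Coind A B N} (h₁ : h ∈ T.Nov 1 N) (h₂ : h ∈ T.Nov (-1) N) :
    (Set.range fun j : ℤ => h ((T.t ^ j : Aˣ) : A)).Finite := by
  obtain ⟨c, hc⟩ := h₁
  obtain ⟨c', hc'⟩ := h₂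
  refine Set.Finite.subset (((Set.finite_Icc (-c') c).image
    fun j : ℤ => h ((T.t ^ j : Aˣ) : A)).union (Set.finite_singleton 0)) ?_
  rintro _ ⟨j, rfl⟩
  by_cases hj : c < j
  · exact Or.inr (hc j (by simpa using hj))
  · by_cases hj' : c' < -j
    · exact Or.inr (hc' j (by simpa using hj'))
    · exact Or.inl ⟨j, ⟨by omega, by omega⟩, rfl⟩

/-- Split the orbit map P → L → Hom_B(A, L) into Novikov parts f₁ and f₂. On ker π they are
negatives of each other, hence of finite support, so they take finitely many values on finitely many
generators. Modulo the B-span L₀ of these values both parts descend to L and vanish by hypothesis.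
Then π p = f₁(p)(1) + f₂(p)(1) lies in L₀. -/
theorem finite_of_hom_nov_eq_zero {L : Type u} [AddCommGroup L] [Module A L] [Module B L]
    [IsScalarTower B A L] (hL : ModFP A 1 L)
    (hv : ∀ (s : ℤˣ) (N : Type u) [AddCommGroup N] [Module B N] (f : L →ₗ[A] T.Nov s N), f = 0) :
    Module.Finite B L := by
  obtain ⟨P, π, -, hP, hπ, hker⟩ := hL
  obtain ⟨f₁, f₂, hf⟩ := T.exists_nov_decomposition
    ((Coind.lift (LinearMap.id : L →ₗ[B] L) : L →ₗ[A] Coind A B L) ∘ₗ π)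
  have hker' : Module.Finite A (LinearMap.ker π) := hker.finite
  obtain ⟨n, g, hg⟩ := Submodule.fg_iff_exists_fin_generating_family.1
    (Submodule.fg_top _ |>.1 hker'.1)
  have hneg : ∀ i, (f₂ (g i)).1 = -(f₁ (g i)).1 := by
    intro i
    have h1 : g i ∈ LinearMap.ker π := hg ▸ Submodule.subset_span ⟨i, rfl⟩
    have h2 := hf (g i)
    rw [LinearMap.comp_apply, LinearMap.mem_ker.1 h1, map_zero] at h2
    exact (neg_eq_of_add_eq_zero_right h2.symm).symm
  let s : Set L := ⋃ i, Set.range fun j : ℤ => (f₁ (g i)).1 ((T.t ^ j : Aˣ) : A)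
  have hs : s.Finite := Set.finite_iUnion fun i =>
    T.finite_range_of_mem_nov (f₁ (g i)).2 (by
      have := neg_mem (f₂ (g i)).2
      rwa [hneg, neg_neg] at this)
  let L₀ : Submodule B L := Submodule.span B s
  have hmem : ∀ i (j : ℤ), (f₁ (g i)).1 ((T.t ^ j : Aˣ) : A) ∈ L₀ := fun i j =>
    Submodule.subset_span (Set.mem_iUnion.2 ⟨i, j, rfl⟩)
  have main : ∀ (s : ℤˣ) (f : P →ₗ[A] T.Nov s L),
      (∀ i (j : ℤ), (f (g i)).1 ((T.t ^ j : Aˣ) : A) ∈ L₀) →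
      ∀ p (j : ℤ), (f p).1 ((T.t ^ j : Aˣ) : A) ∈ L₀ := by
    intro s f hfm p j
    -- The hypothesis is applied with coefficients in L/L₀, which is why it is required for every N.
    let q : T.Nov s L →ₗ[A] T.Nov s (L ⧸ L₀) :=
      (Coind.map L₀.mkQ).restrict fun x hx => T.map_mem_nov _ hx
    have hle : LinearMap.ker π ≤ LinearMap.ker (q ∘ₗ f) := by
      rw [← hg, Submodule.span_le]
      rintro _ ⟨i, rfl⟩
      refine Subtype.ext (T.coind_ext fun j => ?_)
      exact (Submodule.Quotient.mk_eq_zero L₀).2 (hfm i j)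
    have h0 : q ∘ₗ f = 0 := by
      obtain ⟨k, hk⟩ := exists_factor (f := q ∘ₗ f) hπ (LinearMap.exact_subtype_ker_map π) (by
        ext x
        exact congrArg Subtype.val (hle x.2))
      rw [hk, hv s _ k, LinearMap.zero_comp]
    have := congrArg (fun x : T.Nov s (L ⧸ L₀) => x.1 ((T.t ^ j : Aˣ) : A))
      (LinearMap.congr_fun h0 p)
    exact (Submodule.Quotient.mk_eq_zero L₀).1 this
  have htop : L₀ = ⊤ := by
    rw [eq_top_iff]
    rintro x -
    obtain ⟨p, rfl⟩ := hπ x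
    have h1 := main 1 f₁ hmem p 0
    have h2 := main (-1) f₂ (fun i j => by
      rw [hneg]
      exact neg_mem (hmem i j)) p 0
    have h3 := congrArg (fun h : Coind A B L => h 1) (hf p)
    rw [zpow_zero, Units.val_one] at h1 h2
    have h4 : π p = (f₁ p).1 1 + (f₂ p).1 1 := by
      have : (Coind.lift (LinearMap.id : L →ₗ[B] L) (π p) : Coind A B L) 1 = π p := by
        rw [Coind.lift_apply, one_smul]
        rfl
      exact this.symm.trans h3
    rw [h4]
    exact add_mem h1 h2
  exact ⟨htop ▸ Submodule.fg_span hs⟩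

/-- A converse to `extZero_of_modFP`. Finite generation over B yields a cover by some `QMod`, and
its kernel inherits both hypotheses. -/
theorem modFP_of_extZero_nov {k : ℕ} : ∀ {L : Type u} [AddCommGroup L] [Module A L] [Module B L]
    [IsScalarTower B A L], (∀ j, ModFP A j L) →
    (∀ (s : ℤˣ) (N : Type u) [AddCommGroup N] [Module B N] (i : ℕ),
      ExtZero A L (T.Nov s N) i) → ModFP B k L := by
  induction k with
  | zero =>
    intro L _ _ _ _ hL hv
    exact T.finite_of_hom_nov_eq_zero (hL 1) fun s N _ _ => extZero_zero_iff.1 (hv s N 0)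
  | succ k ih =>
    intro L _ _ _ _ hL hv
    have := T.finite_of_hom_nov_eq_zero (hL 1) fun s N _ _ => extZero_zero_iff.1 (hv s N 0)
    obtain ⟨m, S, π, hπ⟩ := T.exists_cover L
    refine ⟨ModuleCat.of B (T.QMod S), π.restrictScalars B,
      inferInstanceAs (Module.Finite B (T.QMod S)),
      inferInstanceAs (Module.Projective B (T.QMod S)), hπ, ?_⟩
    refine ModFP.congr (L := LinearMap.ker π) (kerRestrictScalars π).symm (ih ?_ ?_)
    · intro j
      let p := (LinearMap.range (T.qMap S)).mkQ
      have hp : Function.Surjective p := Submodule.mkQ_surjective _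
      have h1 := (hL (j + 1)).ker (π ∘ₗ p) (hπ.comp hp)
      let p' : LinearMap.ker (π ∘ₗ p) →ₗ[A] LinearMap.ker π := p.restrict fun x hx => hx
      -- Over A, the kernel of π is the kernel of the free cover Aᵐ → L modulo the free module
      -- embedded by `qMap`.
      refine ModFP.of_linearEquiv_ker (P := Fin m → A) (N := LinearMap.ker (π ∘ₗ p)) p' ?_ ?_ h1
      · rintro ⟨y, hy⟩
        obtain ⟨x, rfl⟩ := hp y
        exact ⟨⟨x, hy⟩, rfl⟩
      · have hpq : ∀ x, p (T.qMap S x) = 0 := fun x =>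
          (Submodule.Quotient.mk_eq_zero _).2 ⟨x, rfl⟩
        refine LinearEquiv.ofBijective (LinearMap.codRestrict _ (LinearMap.codRestrict _
          (T.qMap S) fun x => ?_) fun x => ?_) ⟨?_, ?_⟩
        · rw [LinearMap.mem_ker, LinearMap.comp_apply, hpq, map_zero]
        · exact Subtype.ext (hpq x)
        · intro x y hxy
          exact T.qMap_injective S (congrArg (fun z => z.1.1) hxy)
        · rintro ⟨⟨x, hx⟩, hx'⟩
          obtain ⟨y, rfl⟩ := (Submodule.Quotient.mk_eq_zero _).1 (congrArg Subtype.val hx')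
          exact ⟨y, rfl⟩
    · intro s N _ _ i
      exact extZero_sub (Submodule.injective_subtype _) hπ (LinearMap.exact_subtype_ker_map π)
        (T.extZero_QMod S (T.laurentBij_nov_t s) i) (hv s N (i + 1))

end TwistedLaurent

end Novikov

/-! ### Dual complexes, character modules and duality -/

section Duality

variable {A : Type u} [Ring A] (τ : A ≃+* Aᵐᵒᵖ)

/-- The dual `Hom_A(P, A)`, made into a left module by the anti-automorphism `τ`. -/
def DualMod (_ : A ≃+* Aᵐᵒᵖ) (P : Type u) [AddCommGroup P] [Module A P] : Type u := P →ₗ[A] A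

namespace DualMod

variable {τ} {P Q : Type u} [AddCommGroup P] [Module A P] [AddCommGroup Q] [Module A Q]

instance : AddCommGroup (DualMod τ P) := inferInstanceAs (AddCommGroup (P →ₗ[A] A))

instance : FunLike (DualMod τ P) P A := inferInstanceAs (FunLike (P →ₗ[A] A) P A)

instance : LinearMapClass (DualMod τ P) A P A :=
  inferInstanceAs (LinearMapClass (P →ₗ[A] A) A P A)

instance : Module A (DualMod τ P) where
  smul a f := LinearMap.comp (M₂ := A) (LinearMap.mulRight A (τ a).unop) f
  one_smul f := LinearMap.ext fun x => by
    change f x * (τ 1).unop = f x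
    rw [map_one, MulOpposite.unop_one, mul_one]
  mul_smul a b f := LinearMap.ext fun x => by
    change f x * (τ (a * b)).unop = f x * (τ b).unop * (τ a).unop
    rw [map_mul, MulOpposite.unop_mul, mul_assoc]
  smul_zero a := LinearMap.ext fun x => zero_mul _
  smul_add a f g := LinearMap.ext fun x => add_mul _ _ _
  add_smul a b f := LinearMap.ext fun x => by
    change f x * (τ (a + b)).unop = f x * (τ a).unop + f x * (τ b).unop
    rw [map_add, MulOpposite.unop_add, mul_add]
  zero_smul f := LinearMap.ext fun x => by
    change f x * (τ 0).unop = 0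
    rw [map_zero, MulOpposite.unop_zero, mul_zero]

theorem ext {f g : DualMod τ P} (h : ∀ x, f x = g x) : f = g := LinearMap.ext h

/-- The transpose of a linear map. -/
def map (d : P →ₗ[A] Q) : DualMod τ Q →ₗ[A] DualMod τ P where
  toFun f := LinearMap.comp (M₂ := Q) f d
  map_add' _ _ := rfl
  map_smul' _ _ := rfl

variable (τ) in
/-- The dual of a free module of finite rank. -/
def piEquiv (n : ℕ) : (ULift.{u} (Fin n) → A) ≃ₗ[A] DualMod τ (ULift.{u} (Fin n) → A) where
  toFun v := Fintype.linearCombination A fun i => (τ (v i)).unop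
  invFun f i := τ.symm (MulOpposite.op (f (Pi.single i 1)))
  map_add' v w := by
    refine LinearMap.pi_ext' fun i => LinearMap.ext_ring ?_
    change Fintype.linearCombination A (fun i => (τ (v i + w i)).unop) (Pi.single i 1) =
      Fintype.linearCombination A (fun i => (τ (v i)).unop) (Pi.single i 1) +
      Fintype.linearCombination A (fun i => (τ (w i)).unop) (Pi.single i 1)
    simp
  map_smul' a v := by
    refine LinearMap.pi_ext' fun i => LinearMap.ext_ring ?_
    change Fintype.linearCombination A (fun i => (τ (a * v i)).unop) (Pi.single i 1) =
      Fintype.linearCombination A (fun i => (τ (v i)).unop) (Pi.single i 1) * (τ a).unop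
    simp
  left_inv v := by
    funext i
    rw [RingEquiv.symm_apply_eq]
    refine MulOpposite.unop_injective ?_
    rw [MulOpposite.unop_op]
    refine (Fintype.linearCombination_apply_single A _ i 1).trans (one_smul _ _)
  right_inv f := by
    refine LinearMap.pi_ext' fun i => LinearMap.ext_ring ?_
    refine (Fintype.linearCombination_apply_single A _ i 1).trans ?_
    simp
    rfl

instance [Module.Finite A P] [Module.Projective A P] : Module.Projective A (DualMod τ P) := by
  obtain ⟨n, π, hπ⟩ := Module.Finite.exists_fin' A P
  obtain ⟨s, hs⟩ := Module.projective_lifting_property π LinearMap.id hπ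
  let e : (ULift.{u} (Fin n) → A) ≃ₗ[A] (Fin n → A) :=
    LinearEquiv.funCongrLeft A A Equiv.ulift.symm
  have hp : Module.Projective A (DualMod τ (ULift.{u} (Fin n) → A)) :=
    Module.Projective.of_equiv (piEquiv τ n)
  refine Module.Projective.of_split (map (τ := τ) (π ∘ₗ e.toLinearMap))
    (map (e.symm.toLinearMap ∘ₗ s)) (LinearMap.ext fun f => ext fun x => ?_)
  change f (π (e (e.symm (s x)))) = f x
  rw [e.apply_symm_apply]
  exact congrArg f (LinearMap.congr_fun hs x)

end DualMod

/-- The character module of `M`, made into a left module by the anti-automorphism `τ`. -/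
def CharMod (_ : A ≃+* Aᵐᵒᵖ) (M : Type u) [AddCommGroup M] [Module A M] : Type u :=
  CharacterModule M

namespace CharMod

variable {τ} {M : Type u} [AddCommGroup M] [Module A M]

instance : AddCommGroup (CharMod τ M) := inferInstanceAs (AddCommGroup (M →+ AddCircle (1 : ℚ)))

instance : FunLike (CharMod τ M) M (AddCircle (1 : ℚ)) :=
  inferInstanceAs (FunLike (M →+ AddCircle (1 : ℚ)) M (AddCircle (1 : ℚ)))

instance : AddMonoidHomClass (CharMod τ M) M (AddCircle (1 : ℚ)) :=
  inferInstanceAs (AddMonoidHomClass (M →+ AddCircle (1 : ℚ)) M (AddCircle (1 : ℚ)))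

instance : Module A (CharMod τ M) where
  smul a χ := AddMonoidHom.comp (N := M) χ (DistribSMul.toAddMonoidHom M (τ a).unop)
  one_smul χ := AddMonoidHom.ext fun x => by
    change χ ((τ 1).unop • x) = χ x
    rw [map_one, MulOpposite.unop_one, one_smul]
  mul_smul a b χ := AddMonoidHom.ext fun x => by
    change χ ((τ (a * b)).unop • x) = χ ((τ b).unop • (τ a).unop • x)
    rw [map_mul, MulOpposite.unop_mul, mul_smul]
  smul_zero _ := rfl
  smul_add _ _ _ := rfl
  add_smul a b χ := AddMonoidHom.ext fun x => by
    change χ ((τ (a + b)).unop • x) = χ ((τ a).unop • x) + χ ((τ b).unop • x)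
    rw [map_add, MulOpposite.unop_add, add_smul, map_add]
  zero_smul χ := AddMonoidHom.ext fun x => by
    change χ ((τ 0).unop • x) = 0
    rw [map_zero, MulOpposite.unop_zero, zero_smul, map_zero]

theorem ext {χ χ' : CharMod τ M} (h : ∀ x, χ x = χ' x) : χ = χ' := AddMonoidHom.ext h

/-- Evaluation at an element. -/
def eval (x : M) : CharMod τ M →+ AddCircle (1 : ℚ) where
  toFun χ := χ x
  map_zero' := rfl
  map_add' _ _ := rfl

end CharMod

section Pairing

variable {P P' P'' M : Type u} [AddCommGroup P] [Module A P] [AddCommGroup P'] [Module A P']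
  [AddCommGroup P''] [Module A P''] [AddCommGroup M] [Module A M]

/-- The map `p ↦ f(p) m`. -/
def rankOne (f : P →ₗ[A] A) : M →+ (P →ₗ[A] M) where
  toFun m := (LinearMap.toSpanSingleton A M m) ∘ₗ f
  map_zero' := by ext; simp
  map_add' m m' := by ext; simp

theorem rankOne_apply (f : P →ₗ[A] A) (m : M) (p : P) : rankOne f m p = f p • m := rfl

/-- A character of `Hom_A(P, M)` induces a linear map from the dual of `P` to the character module
of `M`. -/
def pairing (χ : (P →ₗ[A] M) →+ AddCircle (1 : ℚ)) : DualMod τ P →ₗ[A] CharMod τ M where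
  toFun f := χ.comp (rankOne f)
  map_add' f g := AddMonoidHom.ext fun m => by
    change χ (rankOne (f + g : P →ₗ[A] A) m) = χ (rankOne f m) + χ (rankOne g m)
    rw [← map_add]
    congr 1
    ext p
    exact add_smul (f p) (g p) m
  map_smul' a f := AddMonoidHom.ext fun m => by
    change χ (rankOne (a • f : DualMod τ P) m) = χ (rankOne f ((τ a).unop • m))
    congr 1
    ext p
    exact mul_smul (f p) (τ a).unop m

theorem pairing_apply (χ : (P →ₗ[A] M) →+ AddCircle (1 : ℚ)) (f : DualMod τ P) (m : M) :
    pairing τ χ f m = χ (rankOne f m) := rfl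

theorem exists_dualBasis (P : Type u) [AddCommGroup P] [Module A P] [Module.Finite A P]
    [Module.Projective A P] : ∃ (n : ℕ) (p : Fin n → P) (q : Fin n → (P →ₗ[A] A)),
      ∀ x, ∑ i, q i x • p i = x := by
  obtain ⟨n, π, hπ⟩ := Module.Finite.exists_fin' A P
  obtain ⟨s, hs⟩ := Module.projective_lifting_property π LinearMap.id hπ
  refine ⟨n, fun i => π (Pi.single i 1), fun i => LinearMap.proj i ∘ₗ s, fun x => ?_⟩
  have h1 := LinearMap.congr_fun hs x
  rw [LinearMap.comp_apply, LinearMap.id_apply, ← Finset.univ_sum_single (s x), map_sum] at h1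
  refine Eq.trans (Finset.sum_congr rfl fun i _ => ?_) h1
  rw [← map_smul, ← Pi.single_smul, smul_eq_mul, mul_one]
  rfl

/-- For such P, Hom_A(P, M) is the tensor product of the dual of P with M, so its characters are the
linear maps from the dual to the character module. A dual basis gives the character h ↦ ∑
ψ(qᵢ)(h(pᵢ)). -/
theorem pairing_surjective [Module.Finite A P] [Module.Projective A P]
    (ψ : DualMod τ P →ₗ[A] CharMod τ M) : ∃ χ : (P →ₗ[A] M) →+ AddCircle (1 : ℚ),
      pairing τ χ = ψ := by
  obtain ⟨n, p, q, hpq⟩ := exists_dualBasis (A := A) P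
  let q' : Fin n → DualMod τ P := q
  let χ : (P →ₗ[A] M) →+ AddCircle (1 : ℚ) :=
    ∑ i, (AddMonoidHom.comp (ψ (q i) : M →+ AddCircle (1 : ℚ)) (LinearMap.evalAddMonoidHom (p i)))
  have hχ : ∀ h, χ h = ∑ i, (ψ (q i) : CharMod τ M) (h (p i)) := fun h => by
    rw [AddMonoidHom.finsetSum_apply]
    rfl
  refine ⟨χ, LinearMap.ext fun f => CharMod.ext fun m => ?_⟩
  rw [pairing_apply, hχ]
  have h1 : f = ∑ i, τ.symm (MulOpposite.op (f (p i))) • q' i := by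
    refine DualMod.ext fun x => ?_
    have h2 : (∑ i, τ.symm (MulOpposite.op (f (p i))) • q' i) x =
        ∑ i, q i x * f (p i) := by
      refine (map_sum (LinearMap.evalAddMonoidHom (M₂ := A) x : (P →ₗ[A] A) →+ A) _ _).trans
        (Finset.sum_congr rfl fun i _ => ?_)
      change q i x * (τ (τ.symm (MulOpposite.op (f (p i))))).unop = _
      rw [RingEquiv.apply_symm_apply, MulOpposite.unop_op]
    rw [h2]
    conv_lhs => rw [← hpq x, map_sum]
    simp only [map_smul, smul_eq_mul]
  conv_rhs => rw [h1, map_sum]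
  refine Eq.trans ?_ (map_sum (CharMod.eval m) _ _).symm
  refine Finset.sum_congr rfl fun i _ => ?_
  rw [map_smul]
  change _ = (ψ (q i) : CharMod τ M) ((τ (τ.symm (MulOpposite.op (f (p i))))).unop • m)
  rw [RingEquiv.apply_symm_apply, MulOpposite.unop_op]
  rfl

theorem apply_eq_sum_pairing [Module.Finite A P] [Module.Projective A P] :
    ∃ (n : ℕ) (p : Fin n → P) (q : Fin n → (P →ₗ[A] A)), ∀ (h : P →ₗ[A] M),
      h = ∑ i, rankOne (q i) (h (p i)) := by
  obtain ⟨n, p, q, hpq⟩ := exists_dualBasis (A := A) P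
  refine ⟨n, p, q, fun h => LinearMap.ext fun x => ?_⟩
  conv_lhs => rw [← hpq x, map_sum]
  rw [LinearMap.sum_apply]
  simp only [map_smul, rankOne_apply]

/-- If h were not a coboundary, a character χ of Hom_A(P, M) would kill the coboundaries but not h.
The pairing of χ vanishes on the image of the transpose of d, hence factors through the transpose of
d'. So χ(h) = χ'(h ∘ d') = 0 for some χ', a contradiction. -/
theorem exact_of_dual_exact [Module.Finite A P] [Module.Projective A P] [Module.Finite A P'']
    [Module.Projective A P''] (d' : P'' →ₗ[A] P) (d : P →ₗ[A] P')
    (hd : ∀ ψ : DualMod τ P →ₗ[A] CharMod τ M, ψ ∘ₗ DualMod.map d = 0 →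
      ∃ ψ' : DualMod τ P'' →ₗ[A] CharMod τ M, ψ = ψ' ∘ₗ DualMod.map d')
    (h : P →ₗ[A] M) (hh : h ∘ₗ d' = 0) : ∃ g : P' →ₗ[A] M, h = g ∘ₗ d := by
  by_contra hne
  let V : AddSubgroup (P →ₗ[A] M) :=
    { carrier := {h | ∃ g : P' →ₗ[A] M, h = g ∘ₗ d}
      zero_mem' := ⟨0, by rw [LinearMap.zero_comp]⟩
      add_mem' := by
        rintro _ _ ⟨g, rfl⟩ ⟨g', rfl⟩
        exact ⟨g + g', by rw [LinearMap.add_comp]⟩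
      neg_mem' := by
        rintro _ ⟨g, rfl⟩
        exact ⟨-g, by rw [LinearMap.neg_comp]⟩ }
  have hV : (QuotientAddGroup.mk' V) h ≠ 0 := fun h0 =>
    hne ((QuotientAddGroup.eq_zero_iff (N := V) h).1 h0)
  obtain ⟨c, hc⟩ := CharacterModule.exists_character_apply_ne_zero_of_ne_zero hV
  let χ : (P →ₗ[A] M) →+ AddCircle (1 : ℚ) := AddMonoidHom.comp c (QuotientAddGroup.mk' V)
  have hχ : ∀ g : P' →ₗ[A] M, χ (g ∘ₗ d) = 0 := fun g => by
    change c (QuotientAddGroup.mk' V (g ∘ₗ d)) = 0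
    have h0 : QuotientAddGroup.mk' V (g ∘ₗ d) = 0 :=
      (QuotientAddGroup.eq_zero_iff (N := V) (g ∘ₗ d)).2 ⟨g, rfl⟩
    rw [h0]
    exact map_zero c
  obtain ⟨ψ', hψ'⟩ := hd (pairing τ χ) (LinearMap.ext fun g => CharMod.ext fun m =>
    hχ (rankOne g m))
  obtain ⟨χ', rfl⟩ := pairing_surjective τ ψ'
  obtain ⟨n, p, q, hpq⟩ := apply_eq_sum_pairing (A := A) (P := P) (M := M)
  refine hc ?_
  change χ h = 0
  have e1 : χ h = ∑ i, χ (rankOne (q i) (h (p i))) := by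
    conv_lhs => rw [hpq h, map_sum]
  have e2 : ∀ i, χ (rankOne (q i) (h (p i))) = χ' (rankOne (q i) (h (p i)) ∘ₗ d') := fun i =>
    congrArg (fun z : CharMod τ M => z (h (p i))) (LinearMap.congr_fun hψ' (q i))
  rw [e1, Finset.sum_congr rfl fun i _ => e2 i, ← map_sum]
  have e3 : ∑ i, rankOne (q i) (h (p i)) ∘ₗ d' = h ∘ₗ d' := by
    conv_rhs => rw [hpq h]
    ext x
    simp
  rw [e3, hh, map_zero]

end Pairing

section DualityTheorem

variable {L : Type u} [AddCommGroup L] [Module A L] (C : ProjRes A L)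

/-- The term before `Xᵢ` in the deleted resolution. -/
def ProjRes.Xp : ℕ → ModuleCat.{u} A
  | 0 => ModuleCat.of A PUnit.{u + 1}
  | i + 1 => C.X i

/-- The differential out of `Xᵢ` in the deleted resolution. -/
def ProjRes.dp : ∀ i, C.X i →ₗ[A] C.Xp i
  | 0 => 0
  | i + 1 => C.d i

theorem ProjRes.isCobdry_iff {M : Type*} [AddCommGroup M] [Module A M] (i : ℕ)
    (f : C.X i →ₗ[A] M) : C.IsCobdry i f ↔ ∃ h : C.Xp i →ₗ[A] M, f = h ∘ₗ C.dp i := by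
  cases i with
  | zero =>
    constructor
    · intro h
      exact ⟨0, by rw [LinearMap.zero_comp]; exact h⟩
    · rintro ⟨h, rfl⟩
      exact LinearMap.comp_zero h
  | succ i => exact Iff.rfl

theorem ProjRes.dp_comp_d (i : ℕ) : C.dp i ∘ₗ C.d i = 0 := by
  cases i with
  | zero => exact LinearMap.zero_comp _
  | succ i => exact C.d_comp_d i

/-- The cochains modulo the coboundaries in the dual complex. -/
abbrev DualCoker (j : ℕ) : Type u :=
  DualMod τ (C.X j) ⧸ LinearMap.range (DualMod.map (τ := τ) (C.dp j))

/-- The codifferential of the dual complex, from the cochains modulo coboundaries. -/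
def dualCokerMap (j : ℕ) :
    DualCoker τ C j →ₗ[A] LinearMap.range (DualMod.map (τ := τ) (C.d j)) :=
  (LinearMap.range (DualMod.map (τ := τ) (C.dp j))).liftQ
    (DualMod.map (τ := τ) (C.d j)).rangeRestrict (by
      rintro _ ⟨f, rfl⟩
      refine Subtype.ext (DualMod.ext fun x => ?_)
      change f ((C.dp j ∘ₗ C.d j) x) = 0
      rw [C.dp_comp_d, LinearMap.zero_apply, map_zero])

theorem dualCokerMap_mk (j : ℕ) (f : DualMod τ (C.X j)) :
    ((dualCokerMap τ C j (Submodule.Quotient.mk f)) : DualMod τ (C.X (j + 1))) =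
      DualMod.map (C.d j) f := rfl

theorem dualCokerMap_surjective (j : ℕ) : Function.Surjective (dualCokerMap τ C j) := by
  rintro ⟨_, f, rfl⟩
  exact ⟨Submodule.Quotient.mk f, rfl⟩

theorem subsingleton_ker_dualCokerMap {j : ℕ} (h : C.HomExact A j) :
    Subsingleton (LinearMap.ker (dualCokerMap τ C j)) := by
  refine subsingleton_of_forall_eq 0 ?_
  rintro ⟨w, hw⟩
  obtain ⟨f, rfl⟩ := Submodule.Quotient.mk_surjective _ w
  refine Subtype.ext ((Submodule.Quotient.mk_eq_zero _).2 ?_)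
  have h1 : DualMod.map (C.d j) f = 0 := by
    rw [← dualCokerMap_mk, LinearMap.mem_ker.1 hw]
    rfl
  obtain ⟨g, hg⟩ := (C.isCobdry_iff j f).1 (h f h1)
  exact ⟨g, hg.symm⟩

/-- The cohomology of the dual complex is computed by any surjection from the cocycles whose kernel
consists of the coboundaries. -/
def kerDualCokerMapEquiv {j : ℕ} {L₀ : Type*} [AddCommGroup L₀] [Module A L₀]
    (c : LinearMap.ker (DualMod.map (τ := τ) (C.d j)) →ₗ[A] L₀) (hc : Function.Surjective c)
    (hc' : ∀ z, c z = 0 ↔ C.IsCobdry j (z.1 : C.X j →ₗ[A] A)) :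
    L₀ ≃ₗ[A] LinearMap.ker (dualCokerMap τ C j) :=
  let p : LinearMap.ker (DualMod.map (τ := τ) (C.d j)) →ₗ[A]
      LinearMap.ker (dualCokerMap τ C j) :=
    ((LinearMap.range (DualMod.map (τ := τ) (C.dp j))).mkQ ∘ₗ Submodule.subtype _).codRestrict _
      (fun z => Subtype.ext z.2)
  have hp : Function.Surjective p := by
    rintro ⟨w, hw⟩
    obtain ⟨f, rfl⟩ := Submodule.Quotient.mk_surjective _ w
    refine ⟨⟨f, ?_⟩, rfl⟩
    rw [LinearMap.mem_ker, ← dualCokerMap_mk, LinearMap.mem_ker.1 hw]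
    rfl
  have hk : LinearMap.ker c = LinearMap.ker p := by
    ext z
    rw [LinearMap.mem_ker, LinearMap.mem_ker]
    refine ((hc' z).trans (C.isCobdry_iff j _)).trans (Iff.trans ?_ ((Submodule.Quotient.mk_eq_zero
      (LinearMap.range (DualMod.map (τ := τ) (C.dp j))) (x := z.1)).symm.trans
        (Subtype.ext_iff (a1 := p z) (a2 := 0)).symm))
    exact ⟨fun ⟨g, hg⟩ => ⟨g, hg.symm⟩, fun ⟨g, hg⟩ => ⟨g, hg.symm⟩⟩
  (c.quotKerEquivOfSurjective hc).symm ≪≫ₗ Submodule.quotEquivOfEq _ _ hk ≪≫ₗ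
    p.quotKerEquivOfSurjective hp

variable {L₀ M : Type u} [AddCommGroup L₀] [Module A L₀] [AddCommGroup M] [Module A M]

/-- Downward induction on j from the end of the complex. The cokernel in degree j is an extension of
the image of the next codifferential by the cohomology in degree j, and that image is a first syzygy
of the next cokernel. The only non-zero cohomology enters at j = d. Going down from there, each step
costs one Ext degree, whence the second alternative. -/
theorem extZero_dualCoker {d k N : ℕ} (hfin : ∀ i, Module.Finite A (C.X i))
    (hN : ∀ i, N < i → Subsingleton (C.X i)) (hex : ∀ j, j ≠ d → C.HomExact A j)
    (c : L₀ ≃ₗ[A] LinearMap.ker (dualCokerMap τ C d))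
    (hL₀ : ∀ e ≤ k, ExtZero A L₀ M e) (j e : ℕ) (h : d < j ∨ e + 1 + d ≤ k + j) :
    ExtZero A (DualCoker τ C j) M (e + 1) := by
  -- The distance m to the vanishing range turns downward into ordinary induction.
  obtain ⟨m, hm⟩ : ∃ m, N + 1 ≤ j + m := ⟨N + 1, by omega⟩
  induction m generalizing j e with
  | zero =>
    have := hN j (by omega)
    have : Subsingleton (DualMod τ (C.X j)) := inferInstanceAs (Subsingleton (C.X j →ₗ[A] A))
    have : Subsingleton (DualCoker τ C j) := Submodule.mkQ_surjective _ |>.subsingleton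
    exact extZero_of_subsingleton _
  | succ m ih =>
    have h1 : ExtZero A (DualCoker τ C (j + 1)) M (e + 2) :=
      ih (j + 1) (e + 1) (by omega) (by omega)
    have h2 : ExtZero A (LinearMap.range (DualMod.map (τ := τ) (C.d j))) M (e + 1) :=
      extZero_sub (L := DualCoker τ C (j + 1)) (F := DualMod τ (C.X (j + 1)))
        (Submodule.injective_subtype _) (Submodule.mkQ_surjective _)
        (LinearMap.exact_subtype_mkQ _) (extZero_of_projective e) h1
    refine extZero_middle (Submodule.injective_subtype _) (dualCokerMap_surjective τ C j)
      (LinearMap.exact_subtype_ker_map _) ?_ h2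
    by_cases hj : j = d
    · subst hj
      exact extZero_of_linearEquiv c (hL₀ _ (by omega))
    · have := subsingleton_ker_dualCokerMap τ C (hex j hj)
      exact extZero_of_subsingleton _

/-- By `exact_of_dual_exact` it suffices to extend linear maps from the dual complex to the
character module. Such a ψ vanishes on the cohomology of the dual complex because Hom from L₀ is
zero. So it lives on the image of the codifferential, from which it extends since Ext¹ of the next
cokernel vanishes. -/
theorem homExact_of_duality {d k N : ℕ} (hfin : ∀ i, Module.Finite A (C.X i))
    (hN : ∀ i, N < i → Subsingleton (C.X i)) (hex : ∀ j, j ≠ d → C.HomExact A j)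
    (c : L₀ ≃ₗ[A] LinearMap.ker (dualCokerMap τ C d))
    (hL₀ : ∀ e ≤ k, ExtZero A L₀ (CharMod τ M) e) (i : ℕ) (hi : d ≤ k + i) : C.HomExact M i := by
  intro f hf
  rw [C.isCobdry_iff]
  refine exact_of_dual_exact τ (C.d i) (C.dp i) (fun ψ hψ => ?_) f hf
  let ψ₁ : DualCoker τ C i →ₗ[A] CharMod τ M := Submodule.liftQ _ ψ (by
    rintro _ ⟨g, rfl⟩
    exact LinearMap.congr_fun hψ g)
  have hW : ExtZero A (LinearMap.ker (dualCokerMap τ C i)) (CharMod τ M) 0 := by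
    by_cases hj : i = d
    · subst hj
      exact extZero_of_linearEquiv c (hL₀ _ (Nat.zero_le _))
    · have := subsingleton_ker_dualCokerMap τ C (hex i hj)
      exact extZero_of_subsingleton _
  obtain ⟨ψ₂, hψ₂⟩ := exists_factor (dualCokerMap_surjective τ C i)
    (LinearMap.exact_subtype_ker_map _)
    (extZero_zero_iff.1 hW (ψ₁ ∘ₗ (LinearMap.ker (dualCokerMap τ C i)).subtype))
  obtain ⟨ψ₃, hψ₃⟩ := extend_of_extZero (L := DualCoker τ C (i + 1))
    (F := DualMod τ (C.X (i + 1))) (L' := LinearMap.range (DualMod.map (τ := τ) (C.d i)))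
    (Submodule.injective_subtype _) (Submodule.mkQ_surjective _) (LinearMap.exact_subtype_mkQ _)
    (extZero_dualCoker τ C hfin hN hex c hL₀ (i + 1) 0 (by omega)) ψ₂
  refine ⟨ψ₃, LinearMap.ext fun g => ?_⟩
  refine (LinearMap.congr_fun hψ₂ (Submodule.Quotient.mk g)).trans ?_
  rw [← hψ₃]
  rfl

end DualityTheorem

/-- The operator on characters is the adjoint of an operator of the same shape on M: τ swaps u and
u⁻¹, and S becomes the transpose of its image under τ. The adjoint of a bijection is bijective. -/
theorem laurentBij_charMod {B : Type*} [Ring B] [Module B A] {u : Aˣ}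
    (hu : τ (u : A) = MulOpposite.op ((u⁻¹ : Aˣ) : A))
    (hB : ∀ b : B, ∃ b' : B, τ (b • (1 : A)) = MulOpposite.op (b' • (1 : A)))
    {M : Type u} [AddCommGroup M] [Module A M] (hM : LaurentBij B u M) :
    LaurentBij B u (CharMod τ M) := by
  classical
  intro m S
  choose β hβ using hB
  have hu' : τ ((u⁻¹ : Aˣ) : A) = MulOpposite.op (u : A) := by
    have h1 : τ ((u⁻¹ : Aˣ) : A) * τ (u : A) = 1 := by rw [← map_mul, Units.inv_mul, map_one]
    rw [hu] at h1
    have h2 := congrArg (· * MulOpposite.op (u : A)) h1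
    simpa [mul_assoc, ← MulOpposite.op_mul] using h2
  set Ψ := fun (h : Fin m → CharMod τ M) (i : Fin m) =>
    (u : A) • h i + ((u⁻¹ : Aˣ) : A) • h i - ∑ k, (S i k • (1 : A)) • h k with hΨ
  set Φ := fun (h : Fin m → M) (i : Fin m) =>
    (u : A) • h i + ((u⁻¹ : Aˣ) : A) • h i - ∑ k, (β (S k i) • (1 : A)) • h k with hΦ
  have hbij : Function.Bijective Φ := hM m fun i k => β (S k i)
  have hadd : ∀ x y, Φ (x + y) = Φ x + Φ y := fun x y => by
    funext i
    simp only [hΦ, Pi.add_apply, smul_add, Finset.sum_add_distrib]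
    abel
  have hap : ∀ χ i (x : M), Ψ χ i x = χ i (((u⁻¹ : Aˣ) : A) • x) + χ i ((u : A) • x) -
      ∑ k, χ k ((β (S i k) • (1 : A)) • x) := fun χ i x => by
    have h1 := map_sum (CharMod.eval x) (fun k => (S i k • (1 : A)) • χ k) Finset.univ
    have h2 : CharMod.eval x (Ψ χ i) = CharMod.eval x ((u : A) • χ i) +
        CharMod.eval x (((u⁻¹ : Aˣ) : A) • χ i) -
        CharMod.eval x (∑ k, (S i k • (1 : A)) • χ k) := by
      rw [← map_add, ← map_sub]
    rw [h1] at h2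
    refine h2.trans ?_
    change χ i ((τ (u : A)).unop • x) + χ i ((τ ((u⁻¹ : Aˣ) : A)).unop • x) -
      ∑ k, χ k ((τ (S i k • (1 : A))).unop • x) = _
    simp only [hu, hu', hβ, MulOpposite.unop_op]
  have hadj : ∀ χ x, ∑ i, Ψ χ i (x i) = ∑ i, χ i (Φ x i) := fun χ x => by
    simp only [hap, hΦ, map_add, map_sub, map_sum, Finset.sum_sub_distrib, Finset.sum_add_distrib]
    rw [Finset.sum_comm, add_comm (∑ i, χ i (((u⁻¹ : Aˣ) : A) • x i))]
  have hsingle : ∀ (χ : Fin m → CharMod τ M) i (x : M),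
      ∑ k, χ k ((Pi.single i x : Fin m → M) k) = χ i x := fun χ i x => by
    rw [Finset.sum_eq_single i]
    · rw [Pi.single_eq_same]
    · intro k _ hk
      rw [Pi.single_eq_of_ne hk, map_zero]
    · simp
  constructor
  · intro χ χ' h
    funext i
    refine CharMod.ext fun x => ?_
    obtain ⟨y, hy⟩ := hbij.2 (Pi.single i x)
    rw [← hsingle χ, ← hsingle χ', ← hy, ← hadj, ← hadj, h]
  · intro η
    let e : (Fin m → M) ≃+ (Fin m → M) :=
      { Equiv.ofBijective Φ hbij with map_add' := hadd }
    have he : ∀ x, Φ (e.symm x) = x := e.apply_symm_apply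
    have he' : ∀ x, e.symm (Φ x) = x := e.symm_apply_apply
    let χ : Fin m → CharMod τ M := fun i =>
      AddMonoidHom.mk' (fun x => ∑ k, η k (e.symm (Pi.single i x) k)) fun x y => by
        simp only [Pi.single_add, map_add, Pi.add_apply, Finset.sum_add_distrib]
    have hχ : ∀ y, ∑ i, χ i (y i) = ∑ k, η k (e.symm y k) := fun y => by
      change ∑ i, ∑ k, η k (e.symm (Pi.single i (y i)) k) = _
      rw [Finset.sum_comm]
      refine Finset.sum_congr rfl fun k _ => ?_
      rw [← map_sum, ← Finset.sum_apply, ← map_sum, Finset.univ_sum_single]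
    refine ⟨χ, funext fun i => CharMod.ext fun x => ?_⟩
    rw [← hsingle (Ψ χ), hadj, hχ, he', hsingle]

end Duality

/-! ### Restriction of scalars -/

section Restriction

variable {A B : Type u} [Ring A] [Ring B] [Module B A] [IsScalarTower B A A]

variable (A B) in
/-- An `A`-module regarded as a module over `B` as well. -/
def Res (_ : Type u) (_ : Type u) (P : Type u) : Type u := P

namespace Res

variable {P Q : Type u} [AddCommGroup P] [Module A P] [AddCommGroup Q] [Module A Q]

instance : AddCommGroup (Res A B P) := inferInstanceAs (AddCommGroup P)

instance : Module A (Res A B P) := inferInstanceAs (Module A P)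

instance : Module B (Res A B P) := Module.compHom P (RingHom.smulOneHom : B →+* A)

theorem smul_def (b : B) (x : Res A B P) : b • x = (b • (1 : A)) • x := rfl

instance : IsScalarTower B A (Res A B P) where
  smul_assoc b a x := by rw [smul_def, smul_smul, smul_one_mul]

variable (B) in
/-- Restriction of scalars for linear maps. -/
def map (f : P →ₗ[A] Q) : Res A B P →ₗ[B] Res A B Q :=
  LinearMap.restrictScalars B (show Res A B P →ₗ[A] Res A B Q from f)

theorem projective [Module.Free B A] [Module.Projective A P] :
    Module.Projective B (Res A B P) := by
  obtain ⟨s, hs⟩ := Module.projective_def'.1 (inferInstance : Module.Projective A P)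
  let s' : Res A B P →ₗ[A] (P →₀ A) := s
  let π' : (P →₀ A) →ₗ[A] Res A B P := Finsupp.linearCombination A id
  exact Module.Projective.of_split (s'.restrictScalars B) (π'.restrictScalars B)
    (LinearMap.ext fun x => LinearMap.congr_fun hs x)

end Res

variable {L : Type u} [AddCommGroup L] [Module A L]

variable (B) in
/-- Restriction of scalars for projective resolutions. -/
def ProjRes.res [Module.Free B A] (C : ProjRes A L) : ProjRes B (Res A B L) where
  X i := ModuleCat.of B (Res A B (C.X i))
  d i := Res.map (P := C.X (i + 1)) (Q := C.X i) B (C.d i)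
  ε := Res.map (P := C.X 0) (Q := L) B C.ε
  proj i := Res.projective (P := C.X i)
  surj := C.surj
  exact_zero := C.exact_zero
  exact_succ := C.exact_succ

theorem ProjRes.res_isCobdry_iff [Module.Free B A] (C : ProjRes A L) {N : Type*} [AddCommGroup N]
    [Module B N] (i : ℕ) (z : Res A B (C.X i) →ₗ[B] N) : (C.res B).IsCobdry i z ↔
      ∃ y : Res A B (C.Xp i) →ₗ[B] N, z = y ∘ₗ Res.map B (C.dp i) := by
  cases i with
  | zero =>
    constructor
    · intro h
      exact ⟨0, by rw [LinearMap.zero_comp]; exact h⟩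
    · rintro ⟨h, rfl⟩
      exact LinearMap.comp_zero h
  | succ i => exact Iff.rfl

instance (C : ProjRes A L) (i : ℕ) : Module.Projective A (C.Xp i) := by
  cases i with
  | zero => exact inferInstanceAs (Module.Projective A PUnit.{u + 1})
  | succ i => exact C.proj i

end Restriction

/-! ### Isomorphisms from additive relations -/

section Rel

theorem exists_addEquiv_of_rel {Z W X Y : Type*} [AddCommGroup Z] [AddCommGroup W]
    [AddCommGroup X] [AddCommGroup Y] (p : Z →+ X) (q : W →+ Y) (hp : Function.Surjective p)
    (hq : Function.Surjective q) (r : AddSubgroup (Z × W)) (h₁ : ∀ z, ∃ w, (z, w) ∈ r)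
    (h₂ : ∀ w, ∃ z, (z, w) ∈ r) (h : ∀ z w, (z, w) ∈ r → (p z = 0 ↔ q w = 0)) :
    ∃ e : X ≃+ Y, ∀ z w, (z, w) ∈ r → e (p z) = q w := by
  have h' : ∀ z w z' w', (z, w) ∈ r → (z', w') ∈ r → (p z = p z' ↔ q w = q w') := by
    intro z w z' w' hz hz'
    have := h (z - z') (w - w') (r.sub_mem hz hz')
    rwa [map_sub, map_sub, sub_eq_zero, sub_eq_zero] at this
  choose a ha using hp
  choose b hb using h₁
  have he : ∀ z w, (z, w) ∈ r → q (b (a (p z))) = q w := fun z w hz =>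
    (h' _ _ _ _ (hb (a (p z))) hz).1 (ha (p z))
  let f : X →+ Y := AddMonoidHom.mk' (fun x => q (b (a x))) fun x y => by
    have := r.add_mem (hb (a x)) (hb (a y))
    rw [← map_add, ← he _ _ this]
    change _ = q (b (a (p (a x + a y))))
    rw [map_add, ha, ha]
  have hf : Function.Bijective f := by
    constructor
    · intro x y hxy
      rw [← ha x, ← ha y]
      exact (h' _ _ _ _ (hb (a x)) (hb (a y))).2 hxy
    · intro y
      obtain ⟨w, rfl⟩ := hq y
      obtain ⟨z, hz⟩ := h₂ w
      exact ⟨p z, he z w hz⟩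
  exact ⟨AddEquiv.ofBijective f hf, he⟩

end Rel

/-! ### The degree shift between cohomology over B and over A -/

section Shift

variable {A B : Type u} [Ring A] [Ring B] [Module B A] [IsScalarTower B A A]
  (T : TwistedLaurent A B)

namespace TwistedLaurent

/-- The embedding of `A` into the coinduced module, `a ↦ (x ↦ coord₀(x a))`. -/
def emb : A →ₗ[A] Coind A B B where
  toFun a := T.basis.coord 0 ∘ₗ LinearMap.mulRight B a
  map_add' a a' := LinearMap.ext fun x => by
    change T.basis.coord 0 (x * (a + a')) = T.basis.coord 0 (x * a) + T.basis.coord 0 (x * a')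
    rw [mul_add, map_add]
  map_smul' c a := LinearMap.ext fun x => by
    change T.basis.coord 0 (x * (c * a)) = T.basis.coord 0 (x * c * a)
    rw [mul_assoc]

theorem emb_apply (a x : A) : T.emb a x = T.basis.coord 0 (x * a) := rfl

theorem emb_zpow (a : A) (j : ℤ) :
    T.emb a ((T.t ^ j : Aˣ) : A) = (T.σ ^ j) (T.basis.coord (-j) a) := by
  have h : ∀ a, T.basis.coord 0 (((T.t ^ j : Aˣ) : A) * a) = (T.σ ^ j) (T.basis.coord (-j) a) := by
    intro a
    obtain ⟨v, rfl⟩ := T.basis.repr.symm.surjective a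
    induction v using Finsupp.induction_linear with
    | single i b =>
      rw [Module.Basis.repr_symm_single, T.basis_apply, zpow_mul_smul, map_smul, map_smul, ← Units.val_mul, ← zpow_add,
        coord_basis, coord_basis, smul_eq_mul, smul_eq_mul, map_mul]
      by_cases hij : i = -j
      · rw [if_pos hij, if_pos (by omega), map_one]
      · rw [if_neg hij, if_neg (by omega), map_zero]
    | add x y hx hy => rw [map_add, mul_add, map_add, hx, hy, map_add, map_add]
    | zero => simp
  exact h a

theorem emb_mem_nov (s : ℤˣ) (a : A) : T.emb a ∈ T.Nov s B := by
  have h : ∃ c : ℤ, ∀ j ∈ (T.basis.repr a).support, |j| ≤ c := by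
    obtain ⟨c, hc⟩ := ((T.basis.repr a).support.image fun j => |j|).bddAbove
    exact ⟨c, fun j hj => hc (Finset.mem_coe.2 (Finset.mem_image_of_mem _ hj))⟩
  obtain ⟨c, hc⟩ := h
  refine ⟨c, fun j hj => ?_⟩
  rw [emb_zpow]
  have : T.basis.coord (-j) a = 0 := by
    by_contra hne
    have h1 := hc (-j) (Finsupp.mem_support_iff.2 hne)
    rw [abs_neg] at h1
    have h2 : (s : ℤ) * j ≤ |j| := by
      rcases Int.units_eq_one_or s with rfl | rfl
      · simpa using le_abs_self j
      · simpa using neg_le_abs j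
    omega
  rw [this, map_zero]

theorem emb_injective : Function.Injective T.emb := by
  rw [injective_iff_map_eq_zero]
  intro a ha
  refine T.basis.ext_elem fun j => ?_
  have h1 := T.emb_zpow a (-j)
  rw [ha, neg_neg] at h1
  have h2 : T.basis.coord j a = 0 := (T.σ ^ (-j)).injective (h1.symm.trans (map_zero _).symm)
  rw [map_zero, Finsupp.zero_apply]
  exact h2

/-- With `emb_mem_nov`, this identifies A with the intersection of the two Novikov submodules. The
coefficients are read off by inverting `emb_zpow`, with only finitely many levels surviving. -/
theorem exists_emb_eq {h : Coind A B B} (h₁ : h ∈ T.Nov 1 B) (h₂ : h ∈ T.Nov (-1) B) :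
    ∃ a, T.emb a = h := by
  obtain ⟨c, hc⟩ := h₁
  obtain ⟨c', hc'⟩ := h₂
  have hfin : (Function.support fun j : ℤ =>
      ((T.σ ^ j) (h ((T.t ^ (-j) : Aˣ) : A)) : B)).Finite := by
    refine (Set.finite_Icc (-c) c').subset fun j hj => ?_
    by_contra hne
    refine hj ?_
    have : h ((T.t ^ (-j) : Aˣ) : A) = 0 := by
      by_cases h1 : c < -j
      · exact hc _ (by simpa using h1)
      · refine hc' _ ?_
        have : ¬ (-c ≤ j ∧ j ≤ c') := hne
        simp only [Units.val_neg, Units.val_one]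
        omega
    change (T.σ ^ j) (h ((T.t ^ (-j) : Aˣ) : A)) = 0
    rw [this, map_zero]
  refine ⟨T.basis.repr.symm (Finsupp.ofSupportFinite _ hfin), T.coind_ext fun j => ?_⟩
  rw [emb_zpow, Module.Basis.coord_apply, LinearEquiv.apply_symm_apply,
    Finsupp.ofSupportFinite_coe, neg_neg, ← RingAut.mul_apply, ← zpow_add, add_neg_cancel,
    zpow_zero]
  rfl

theorem emb_mul_smul_one (a : A) (b : B) :
    T.emb (a * (b • (1 : A))) = Coind.map (LinearMap.mulRight B b) (T.emb a) :=
  Coind.ext fun x => by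
    rw [emb_apply, ← mul_assoc, coord_mul_smul_one, zpow_zero]
    rfl

/-- A linear map into the coinduced module with values in both Novikov submodules factors
through `A`. -/
theorem exists_factor_emb {P : Type*} [AddCommGroup P] [Module A P] (f : P →ₗ[A] Coind A B B)
    (h₁ : ∀ x, f x ∈ T.Nov 1 B) (h₂ : ∀ x, f x ∈ T.Nov (-1) B) :
    ∃ w : P →ₗ[A] A, T.emb ∘ₗ w = f := by
  have h : ∀ x, f x ∈ LinearMap.range T.emb := fun x => T.exists_emb_eq (h₁ x) (h₂ x)
  refine ⟨(LinearEquiv.ofInjective T.emb T.emb_injective).symm.toLinearMap ∘ₗ f.codRestrict _ h,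
    LinearMap.ext fun x => ?_⟩
  exact congrArg Subtype.val ((LinearEquiv.ofInjective T.emb T.emb_injective).apply_symm_apply
    (f.codRestrict _ h x))

/-- The embedding of `A` into a Novikov submodule. -/
def embNov (s : ℤˣ) : A →ₗ[A] T.Nov s B := T.emb.codRestrict _ (T.emb_mem_nov s)

theorem homExact_zero {L : Type u} [AddCommGroup L] [Module A L] (C : ProjRes A L)
    (h : C.HomExact (T.Nov 1 B) 0) : C.HomExact A 0 := by
  intro f hf
  have h1 : T.embNov 1 ∘ₗ f = 0 := h _ (by rw [LinearMap.comp_assoc, hf, LinearMap.comp_zero])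
  refine LinearMap.ext fun x => T.emb_injective ?_
  rw [LinearMap.zero_apply, map_zero]
  exact congrArg Subtype.val (LinearMap.congr_fun h1 x)

end TwistedLaurent

namespace Coind

variable {P : Type u} [AddCommGroup P] [Module A P] {N : Type u} [AddCommGroup N] [Module B N]

/-- A `B`-linear map on an `A`-module induces an `A`-linear map to the coinduced module. -/
def adj (z : Res A B P →ₗ[B] N) : P →ₗ[A] Coind A B N :=
  (lift z : Res A B P →ₗ[A] Coind A B N)

/-- The `B`-linear map given by evaluation at `1`. -/
def adjInv (f : P →ₗ[A] Coind A B N) : Res A B P →ₗ[B] N where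
  toFun x := f x 1
  map_add' x y := congrArg (fun h : Coind A B N => h 1) (map_add f (x : P) (y : P))
  map_smul' b x := by
    rw [Res.smul_def]
    refine (congrArg (fun h : Coind A B N => h 1) (map_smul f (b • (1 : A)) x)).trans ?_
    rw [smul_apply, one_mul, map_smul]
    rfl

theorem adj_adjInv (f : P →ₗ[A] Coind A B N) : adj (adjInv f) = f :=
  LinearMap.ext fun x => Coind.ext fun a => by
    change f (a • x) 1 = f x a
    rw [map_smul, smul_apply, one_mul]

end Coind

/-- The cocycles of the complex `Hom_A(C, M)`. -/
def ProjRes.cocycles {A : Type u} [Ring A] {L : Type u} [AddCommGroup L] [Module A L]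
    (C : ProjRes A L) (M : Type*) [AddCommGroup M] [Module A M] (i : ℕ) :
    AddSubgroup (C.X i →ₗ[A] M) where
  carrier := {f | f ∘ₗ C.d i = 0}
  zero_mem' := LinearMap.zero_comp _
  add_mem' := fun {f g} hf hg => by
    change (f + g) ∘ₗ C.d i = 0
    rw [LinearMap.add_comp, hf, hg, add_zero]
  neg_mem' := fun {f} hf => by
    change (-f) ∘ₗ C.d i = 0
    rw [LinearMap.neg_comp, hf, neg_zero]

/-- Functoriality of the cocycles in the coefficients. -/
def ProjRes.cocyclesMap {A : Type u} [Ring A] {L : Type u} [AddCommGroup L] [Module A L]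
    (C : ProjRes A L) {M M' : Type*} [AddCommGroup M] [Module A M] [AddCommGroup M'] [Module A M']
    (g : M →ₗ[A] M') (i : ℕ) (f : C.cocycles M i) : C.cocycles M' i :=
  ⟨g ∘ₗ f.1, by
    change (g ∘ₗ f.1) ∘ₗ C.d i = 0
    rw [LinearMap.comp_assoc, f.2, LinearMap.comp_zero]⟩

namespace TwistedLaurent

variable {L : Type u} [AddCommGroup L] [Module A L] (C : ProjRes A L) [Module.Free B A]

/-- The correspondence between cocycles over `B` in degree `i` and cocycles over `A` in degree
`i + 1`. -/
def shiftRel (i : ℕ) : AddSubgroup ((C.res B).cocycles B i × C.cocycles A (i + 1)) where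
  carrier := {x | ∃ (f₁ : C.X i →ₗ[A] T.Nov 1 B) (f₂ : C.X i →ₗ[A] T.Nov (-1) B),
    (∀ y, Coind.adj (P := C.X i) x.1.1 y = (f₁ y).1 + (f₂ y).1) ∧
      ∀ y, T.emb (x.2.1 y) = (f₁ (C.d i y)).1}
  zero_mem' := ⟨0, 0, fun y => by simp; rfl, fun y => map_zero T.emb⟩
  add_mem' := by
    rintro x x' ⟨f₁, f₂, h, h'⟩ ⟨g₁, g₂, k, k'⟩
    refine ⟨f₁ + g₁, f₂ + g₂, fun y => ?_, fun y => ?_⟩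
    · have : Coind.adj (P := C.X i) (x + x').1.1 y =
          Coind.adj (P := C.X i) x.1.1 y + Coind.adj (P := C.X i) x'.1.1 y := rfl
      rw [this, h, k]
      simp only [LinearMap.add_apply, Submodule.coe_add]
      abel
    · have : (x + x').2.1 y = x.2.1 y + x'.2.1 y := rfl
      rw [this, map_add, h', k']
      rfl
  neg_mem' := by
    rintro x ⟨f₁, f₂, h, h'⟩
    refine ⟨-f₁, -f₂, fun y => ?_, fun y => ?_⟩
    · have : Coind.adj (P := C.X i) (-x).1.1 y = -Coind.adj (P := C.X i) x.1.1 y := rfl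
      rw [this, h]
      simp only [LinearMap.neg_apply, Submodule.coe_neg]
      abel
    · have : (-x).2.1 y = -x.2.1 y := rfl
      rw [this, map_neg, h']
      rfl

/-- The connecting homomorphism on cocycles. The Novikov parts of the adjoint of z have opposite
coboundaries, which therefore lie in both submodules, that is, in A. -/
theorem exists_shiftRel_left (i : ℕ) (z : (C.res B).cocycles B i) :
    ∃ w, (z, w) ∈ T.shiftRel C i := by
  obtain ⟨f₁, f₂, hf⟩ := T.exists_nov_decomposition (Coind.adj (P := C.X i) z.1)
  have hd : ∀ y, (f₁ (C.d i y)).1 = -(f₂ (C.d i y)).1 := fun y => by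
    rw [← add_eq_zero_iff_eq_neg, ← hf]
    refine Coind.ext fun a => ?_
    exact (congrArg z.1 (map_smul (C.d i) a y).symm).trans
      (LinearMap.congr_fun z.2 (a • y : C.X (i + 1)))
  obtain ⟨w, hw⟩ := T.exists_factor_emb ((T.Nov 1 B).subtype ∘ₗ f₁ ∘ₗ C.d i)
    (fun y => (f₁ (C.d i y)).2) (fun y => by
      change (f₁ (C.d i y)).1 ∈ _
      rw [hd]
      exact neg_mem (f₂ (C.d i y)).2)
  refine ⟨⟨w, LinearMap.ext fun y => T.emb_injective ?_⟩, f₁, f₂, hf,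
    fun y => LinearMap.congr_fun hw y⟩
  refine (LinearMap.congr_fun hw (C.d (i + 1) y)).trans ?_
  have : C.d i (C.d (i + 1) y) = 0 := LinearMap.congr_fun (C.d_comp_d i) y
  rw [LinearMap.comp_apply, LinearMap.comp_apply, this, LinearMap.zero_apply, map_zero, map_zero,
    map_zero]

/-- Surjectivity of the connecting map: w has a primitive in each Novikov submodule, and the
difference of the two is a cocycle in the coinduced module. -/
theorem exists_shiftRel_right {i : ℕ} (hv : ∀ s : ℤˣ, C.HomExact (T.Nov s B) (i + 1))
    (w : C.cocycles A (i + 1)) : ∃ z, (z, w) ∈ T.shiftRel C i := by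
  have h : ∀ s : ℤˣ, ∃ f : C.X i →ₗ[A] T.Nov s B, ∀ y, T.emb (w.1 y) = (f (C.d i y)).1 := by
    intro s
    obtain ⟨f, hf⟩ := hv s (T.embNov s ∘ₗ w.1) (by
      rw [LinearMap.comp_assoc, w.2, LinearMap.comp_zero])
    exact ⟨f, fun y => congrArg Subtype.val (LinearMap.congr_fun hf y)⟩
  obtain ⟨f₁, h₁⟩ := h 1
  obtain ⟨f₂, h₂⟩ := h (-1)
  let f : C.X i →ₗ[A] Coind A B B := (T.Nov 1 B).subtype ∘ₗ f₁ - (T.Nov (-1) B).subtype ∘ₗ f₂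
  refine ⟨⟨Coind.adjInv (P := C.X i) f, LinearMap.ext fun y => ?_⟩, f₁, -f₂, fun y => ?_, h₁⟩
  · exact congrArg (fun h : Coind A B B => h 1) (sub_eq_zero.2 ((h₁ y).symm.trans (h₂ y)))
  · exact (LinearMap.congr_fun (Coind.adj_adjInv f) y).trans (sub_eq_add_neg (f₁ y).1 (f₂ y).1)

/-- Forwards, decomposing a primitive of z into Novikov parts and subtracting it from f₁ leaves an
A-valued primitive of w. Backwards, a primitive of w corrects f₁ and f₂ to Novikov cocycles. These
bound by `hv`, and evaluating the sum of their primitives at 1 gives a primitive of z. -/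
theorem isCobdry_iff_of_shiftRel {i : ℕ} (hv : ∀ s : ℤˣ, C.HomExact (T.Nov s B) i)
    (z : (C.res B).cocycles B i) (w : C.cocycles A (i + 1)) (h : (z, w) ∈ T.shiftRel C i) :
    (C.res B).IsCobdry i z.1 ↔ C.IsCobdry (i + 1) w.1 := by
  obtain ⟨f₁, f₂, hf, hw⟩ := h
  have hz : ∀ y, (f₁ (C.d i y)).1 + (f₂ (C.d i y)).1 = 0 := fun y => by
    rw [← hf]
    refine Coind.ext fun a => ?_
    exact (congrArg z.1 (map_smul (C.d i) a y).symm).trans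
      (LinearMap.congr_fun z.2 (a • y : C.X (i + 1)))
  constructor
  · intro h0
    obtain ⟨y, hy⟩ := (C.res_isCobdry_iff i _).1 h0
    obtain ⟨y₁, y₂, hy'⟩ := T.exists_nov_decomposition (Coind.adj (P := C.Xp i) y)
    have hadj : ∀ x, (f₁ x).1 + (f₂ x).1 = (y₁ (C.dp i x)).1 + (y₂ (C.dp i x)).1 := fun x => by
      rw [← hf, ← hy']
      refine Coind.ext fun a => ?_
      exact (LinearMap.congr_fun hy (a • x : C.X i)).trans
        (congrArg y (map_smul (C.dp i) a x))
    obtain ⟨v, hv'⟩ := T.exists_factor_emb ((T.Nov 1 B).subtype ∘ₗ (f₁ - y₁ ∘ₗ C.dp i))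
      (fun x => ((f₁ - y₁ ∘ₗ C.dp i) x).2) (fun x => by
        have : ((f₁ - y₁ ∘ₗ C.dp i) x).1 = ((y₂ ∘ₗ C.dp i - f₂) x).1 := by
          change (f₁ x).1 - (y₁ (C.dp i x)).1 = (y₂ (C.dp i x)).1 - (f₂ x).1
          rw [sub_eq_sub_iff_add_eq_add, hadj, add_comm]
        change ((f₁ - y₁ ∘ₗ C.dp i) x).1 ∈ _
        rw [this]
        exact ((y₂ ∘ₗ C.dp i - f₂) x).2)
    refine ⟨v, LinearMap.ext fun x => T.emb_injective ?_⟩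
    rw [hw]
    refine Eq.trans ?_ (LinearMap.congr_fun hv' (C.d i x)).symm
    change _ = (f₁ (C.d i x)).1 - (y₁ ((C.dp i ∘ₗ C.d i) x)).1
    rw [C.dp_comp_d, LinearMap.zero_apply, map_zero, Submodule.coe_zero, sub_zero]
  · rintro ⟨v, hv'⟩
    obtain ⟨a₁, ha₁⟩ := (C.isCobdry_iff i _).1 (hv 1 (f₁ - T.embNov 1 ∘ₗ v)
      (LinearMap.ext fun y => Subtype.ext (by
        change (f₁ (C.d i y)).1 - T.emb ((v ∘ₗ C.d i) y) = 0
        rw [← hv', hw, sub_self])))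
    obtain ⟨a₂, ha₂⟩ := (C.isCobdry_iff i _).1 (hv (-1) (f₂ + T.embNov (-1) ∘ₗ v)
      (LinearMap.ext fun y => Subtype.ext (by
        change (f₂ (C.d i y)).1 + T.emb ((v ∘ₗ C.d i) y) = 0
        rw [← hv', hw, add_comm, hz])))
    refine (C.res_isCobdry_iff i z.1).2 ⟨Coind.adjInv ((T.Nov 1 B).subtype ∘ₗ a₁ + (T.Nov (-1) B).subtype ∘ₗ a₂),
      LinearMap.ext fun x => ?_⟩
    have h1 : (f₁ x).1 - T.emb (v x) = (a₁ (C.dp i x)).1 :=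
      congrArg Subtype.val (LinearMap.congr_fun ha₁ x)
    have h2 : (f₂ x).1 + T.emb (v x) = (a₂ (C.dp i x)).1 :=
      congrArg Subtype.val (LinearMap.congr_fun ha₂ x)
    have h3 : Coind.adj (P := C.X i) z.1 x = (a₁ (C.dp i x)).1 + (a₂ (C.dp i x)).1 := by
      refine (hf x).trans ?_
      rw [← h1, ← h2]
      abel
    have h4 := congrArg (fun h : Coind A B B => h 1) h3
    refine Eq.trans ?_ h4
    exact congrArg z.1 (one_smul A (show C.X i from x)).symm

theorem shiftRel_mul {i : ℕ} {z : (C.res B).cocycles B i} {w : C.cocycles A (i + 1)}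
    (h : (z, w) ∈ T.shiftRel C i) (b : B) :
    ((C.res B).cocyclesMap (LinearMap.mulRight B b) i z,
      C.cocyclesMap (LinearMap.mulRight A (b • (1 : A))) (i + 1) w) ∈ T.shiftRel C i := by
  obtain ⟨f₁, f₂, hf, hw⟩ := h
  let μ : Coind A B B →ₗ[A] Coind A B B := Coind.map (LinearMap.mulRight B b)
  have hμ : ∀ s : ℤˣ, ∀ h ∈ T.Nov s B, μ h ∈ T.Nov s B := fun s h hh => T.map_mem_nov _ hh
  refine ⟨(μ.restrict (hμ 1)) ∘ₗ f₁, (μ.restrict (hμ (-1))) ∘ₗ f₂, fun y => ?_, fun y => ?_⟩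
  · have : Coind.adj (P := C.X i) ((C.res B).cocyclesMap (LinearMap.mulRight B b) i z).1 y =
        μ (Coind.adj (P := C.X i) z.1 y) := rfl
    rw [this, hf, map_add]
    rfl
  · refine (T.emb_mul_smul_one (w.1 y) b).trans ?_
    rw [hw]
    rfl

/-- X and Y stand for any models of the two cohomology groups. The maps α and β are what right
multiplication by b induces on them, so one statement yields both linearity over R and equivariance
under K. -/
theorem exists_shift (hv : ∀ (s : ℤˣ) i, C.HomExact (T.Nov s B) i) (i : ℕ) {X Y : Type*}
    [AddCommGroup X] [AddCommGroup Y] (p : (C.res B).cocycles B i →+ X)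
    (q : C.cocycles A (i + 1) →+ Y) (hp : Function.Surjective p) (hq : Function.Surjective q)
    (hp' : ∀ z, p z = 0 ↔ (C.res B).IsCobdry i z.1)
    (hq' : ∀ w, q w = 0 ↔ C.IsCobdry (i + 1) w.1) :
    ∃ e : X ≃+ Y, ∀ (b : B) (α : X → X) (β : Y → Y),
      (∀ z, p ((C.res B).cocyclesMap (LinearMap.mulRight B b) i z) = α (p z)) →
      (∀ w, q (C.cocyclesMap (LinearMap.mulRight A (b • (1 : A))) (i + 1) w) = β (q w)) →
      ∀ x, e (α x) = β (e x) := by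
  obtain ⟨e, he⟩ := exists_addEquiv_of_rel p q hp hq (T.shiftRel C i) (T.exists_shiftRel_left C i)
    (T.exists_shiftRel_right C fun s => hv s (i + 1)) fun z w h => by
      rw [hp', hq']
      exact T.isCobdry_iff_of_shiftRel C (fun s => hv s i) z w h
  refine ⟨e, fun b α β hα hβ x => ?_⟩
  obtain ⟨z, rfl⟩ := hp x
  obtain ⟨w, hw⟩ := T.exists_shiftRel_left C i z
  rw [← hα, he _ _ (T.shiftRel_mul C hw b), he _ _ hw, hβ]

end TwistedLaurent

end Shift

/-! ### Passage between representations and modules over the group ring -/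

section RepInterface

variable {R G : Type u} [CommRing R] [Group G]

/-- A projective resolution of a module, from a projective resolution in the category of modules. -/
def ProjRes.ofResolution {A : Type u} [Ring A] {Z : ModuleCat.{u} A} (P : ProjectiveResolution Z) :
    ProjRes A Z where
  X i := P.complex.X i
  d i := (P.complex.d (i + 1) i).hom
  ε := (P.π.f 0 ≫ (HomologicalComplex.singleObjXSelf (ComplexShape.down ℕ) 0 Z).hom).hom
  proj i := (IsProjective.iff_projective _).2 (P.projective i)
  surj := (ModuleCat.epi_iff_surjective _).1 inferInstance
  exact_zero := by
    have h := (ShortComplex.ShortExact.moduleCat_exact_iff_function_exact _).1 P.exact₀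
    have hi : Function.Injective
        (HomologicalComplex.singleObjXSelf (ComplexShape.down ℕ) 0 Z).hom.hom :=
      (ModuleCat.mono_iff_injective _).1 inferInstance
    intro x
    refine Iff.trans ?_ (h x)
    exact map_eq_zero_iff _ hi
  exact_succ i := (ShortComplex.ShortExact.moduleCat_exact_iff_function_exact _).1
    (P.exact_succ i)

/-- The chain complex underlying a `ProjRes`. -/
def ProjRes.complex {A : Type u} [Ring A] {L : Type u} [AddCommGroup L] [Module A L]
    (C : ProjRes A L) : ChainComplex (ModuleCat.{u} A) ℕ :=
  ChainComplex.of C.X (fun i => ModuleCat.ofHom (C.d i)) fun i => by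
    ext x
    exact LinearMap.congr_fun (C.d_comp_d i) x

theorem ProjRes.complex_d {A : Type u} [Ring A] {L : Type u} [AddCommGroup L] [Module A L]
    (C : ProjRes A L) (i : ℕ) : C.complex.d (i + 1) i = ModuleCat.ofHom (C.d i) :=
  ChainComplex.of_d C.X (fun i => ModuleCat.ofHom (C.d i)) i

/-- The projective resolution in the category of modules attached to a `ProjRes`. -/
def ProjRes.toResolution {A : Type u} [Ring A] {Z : ModuleCat.{u} A} (C : ProjRes A Z) :
    ProjectiveResolution Z where
  complex := C.complex
  projective i := (IsProjective.iff_projective (C.X i)).1 (C.proj i)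
  π := (ChainComplex.toSingle₀Equiv _ _).symm ⟨ModuleCat.ofHom C.ε, by
    rw [C.complex_d]
    ext x
    exact LinearMap.congr_fun C.ε_comp_d x⟩
  quasiIso := ⟨fun n => by
    cases n with
    | zero =>
      rw [ChainComplex.quasiIsoAt₀_iff, ShortComplex.quasiIso_iff_of_zeros']
      · refine (ShortComplex.exact_and_epi_g_iff_of_iso (S₁ := _)
          (S₂ := ShortComplex.mk (ModuleCat.ofHom (C.d 0)) (ModuleCat.ofHom C.ε) (by
            ext x
            exact LinearMap.congr_fun C.ε_comp_d x)) ?_).2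
          ⟨(ShortComplex.ShortExact.moduleCat_exact_iff_function_exact _).2 C.exact_zero,
            (ModuleCat.epi_iff_surjective _).2 C.surj⟩
        exact ShortComplex.isoMk (Iso.refl _) (Iso.refl _) (Iso.refl _)
          ((Category.id_comp _).trans ((C.complex_d 0).symm.trans (Category.comp_id _).symm))
          ((Category.id_comp _).trans (Category.comp_id _).symm)
      all_goals rfl
    | succ n =>
      rw [quasiIsoAt_iff_exactAt']
      · rw [HomologicalComplex.exactAt_iff' _ (n + 1 + 1) (n + 1) n (by simp) (by simp)]
        refine (ShortComplex.exact_iff_of_iso (S₁ := _)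
          (S₂ := ShortComplex.mk (ModuleCat.ofHom (C.d (n + 1))) (ModuleCat.ofHom (C.d n)) (by
            ext x
            exact LinearMap.congr_fun (C.d_comp_d n) x)) ?_).2
          ((ShortComplex.ShortExact.moduleCat_exact_iff_function_exact _).2 (C.exact_succ n))
        exact ShortComplex.isoMk (Iso.refl _) (Iso.refl _) (Iso.refl _)
          ((Category.id_comp _).trans ((C.complex_d _).symm.trans (Category.comp_id _).symm))
          ((Category.id_comp _).trans ((C.complex_d _).symm.trans (Category.comp_id _).symm))
      · apply ChainComplex.exactAt_succ_single_obj⟩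

/-- Transport of a projective resolution along an isomorphism. -/
def resolutionOfIso {C : Type*} [Category C] [Abelian C] {Z Z' : C} (P : ProjectiveResolution Z)
    (e : Z ≅ Z') : ProjectiveResolution Z' where
  complex := P.complex
  π := P.π ≫ (ChainComplex.single₀ C).map e.hom

instance : (Rep.toModuleMonoidAlgebra (k := R) (G := G)).Additive where
  map_add := rfl

instance : (Rep.ofModuleMonoidAlgebra (k := R) (G := G)).Additive :=
  @Equivalence.inverse_additive _ _ _ _ _ _ (Rep.equivalenceModuleMonoidAlgebra (k := R) (G := G))
    (inferInstanceAs (Rep.toModuleMonoidAlgebra (k := R) (G := G)).Additive)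

/-- The trivial module of the group ring. -/
abbrev TrivMod (R G : Type u) [CommRing R] [Group G] : Type u :=
  (Representation.trivial R G R).asModule

/-- The resolution by modules over the group ring attached to a resolution by representations. -/
def ProjRes.ofRep (P : ProjectiveResolution (Rep.trivial R G R)) :
    ProjRes (MonoidAlgebra R G) (TrivMod R G) :=
  ProjRes.ofResolution (Rep.toModuleMonoidAlgebra.mapProjectiveResolution P)

theorem modFP_of_isFPn {k : ℕ} {l : ℤ} (hl : l = k) (h : IsFPn R G l) :
    ModFP (MonoidAlgebra R G) k (TrivMod R G) := by
  obtain ⟨P, hP⟩ := h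
  exact modFP_of_projRes (ProjRes.ofRep P) fun i hi => hP i (by omega)

theorem exists_projRes_of_isFP (h : IsFP R G) :
    ∃ C : ProjRes (MonoidAlgebra R G) (TrivMod R G),
      (∀ i, Module.Finite (MonoidAlgebra R G) (C.X i)) ∧
      ∃ N : ℕ, ∀ i, N < i → Subsingleton (C.X i) := by
  obtain ⟨P, hP, N, hN⟩ := h
  exact ⟨ProjRes.ofRep P, hP, N, hN⟩

theorem isFP_of_projRes (C : ProjRes (MonoidAlgebra R G) (TrivMod R G))
    (hC : ∀ i, Module.Finite (MonoidAlgebra R G) (C.X i)) (N : ℕ)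
    (hN : ∀ i, N < i → Subsingleton (C.X i)) : IsFP R G := by
  let C' : ProjRes (MonoidAlgebra R G)
    (Rep.toModuleMonoidAlgebra.obj (Rep.trivial R G R)) := C
  refine ⟨resolutionOfIso (Rep.ofModuleMonoidAlgebra.mapProjectiveResolution C'.toResolution)
    (Rep.unitIso (Rep.trivial R G R)).symm, fun i => ?_, N, fun i hi => hN i hi⟩
  have := hC i
  exact Module.Finite.equiv (Rep.counitIso (C.X i)).symm.toLinearEquiv

end RepInterface

/-! ### Comparison of projective resolutions -/

section Comparison

namespace ProjRes

variable {A : Type u} [Ring A] {L : Type u} [AddCommGroup L] [Module A L]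

theorem exists_lift {P Q Q' : Type*} [AddCommGroup P] [Module A P] [Module.Projective A P]
    [AddCommGroup Q] [Module A Q] [AddCommGroup Q'] [Module A Q'] (g : Q →ₗ[A] Q')
    (f : P →ₗ[A] Q') (h : ∀ x, f x ∈ LinearMap.range g) : ∃ k : P →ₗ[A] Q, g ∘ₗ k = f := by
  obtain ⟨k, hk⟩ := Module.projective_lifting_property g.rangeRestrict (f.codRestrict _ h)
    g.surjective_rangeRestrict
  exact ⟨k, LinearMap.ext fun x => congrArg Subtype.val (LinearMap.congr_fun hk x)⟩

theorem exists_chainMap (C C' : ProjRes A L) : ∃ θ : ∀ i, C.X i →ₗ[A] C'.X i,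
    C'.ε ∘ₗ θ 0 = C.ε ∧ ∀ i, C'.d i ∘ₗ θ (i + 1) = θ i ∘ₗ C.d i := by
  -- The subtype records the condition under which the next lift exists, so that the recursion can
  -- continue.
  let S : ℕ → Type u := fun i =>
    {a : C.X i →ₗ[A] C'.X i // ∀ x, a (C.d i x) ∈ LinearMap.range (C'.d i)}
  have step : ∀ i (a : S i), ∃ b : S (i + 1), C'.d i ∘ₗ b.1 = a.1 ∘ₗ C.d i := fun i a => by
    obtain ⟨b, hb⟩ := exists_lift (C'.d i) (a.1 ∘ₗ C.d i) a.2
    refine ⟨⟨b, fun x => (C'.exact_succ i _).1 ?_⟩, hb⟩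
    refine (LinearMap.congr_fun hb (C.d (i + 1) x)).trans ?_
    rw [LinearMap.comp_apply, ← LinearMap.comp_apply (C.d i), C.d_comp_d, LinearMap.zero_apply,
      map_zero]
  obtain ⟨a₀, ha₀⟩ := exists_lift C'.ε C.ε fun x => C'.surj (C.ε x)
  choose next hnext using step
  let θ : ∀ i, S i := fun i => Nat.rec ⟨a₀, fun x => (C'.exact_zero _).1
    ((LinearMap.congr_fun ha₀ (C.d 0 x)).trans (LinearMap.congr_fun C.ε_comp_d x))⟩ next i
  exact ⟨fun i => (θ i).1, ha₀, fun i => hnext i (θ i)⟩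

theorem exists_homotopy (C C' : ProjRes A L) (μ : ∀ i, C.X i →ₗ[A] C'.X i)
    (h₀ : C'.ε ∘ₗ μ 0 = 0) (h : ∀ i, C'.d i ∘ₗ μ (i + 1) = μ i ∘ₗ C.d i) :
    ∃ s : ∀ i, C.X i →ₗ[A] C'.X (i + 1), μ 0 = C'.d 0 ∘ₗ s 0 ∧
      ∀ i, μ (i + 1) = C'.d (i + 1) ∘ₗ s (i + 1) + s i ∘ₗ C.d i := by
  let S : ℕ → Type u := fun i =>
    {s : C.X i →ₗ[A] C'.X (i + 1) // C'.d i ∘ₗ (μ (i + 1) - s ∘ₗ C.d i) = 0}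
  have step : ∀ i (a : S i), ∃ b : S (i + 1),
      C'.d (i + 1) ∘ₗ b.1 = μ (i + 1) - a.1 ∘ₗ C.d i := fun i a => by
    obtain ⟨b, hb⟩ := exists_lift (C'.d (i + 1)) (μ (i + 1) - a.1 ∘ₗ C.d i) fun x =>
      (C'.exact_succ i _).1 (LinearMap.congr_fun a.2 x)
    refine ⟨⟨b, ?_⟩, hb⟩
    rw [LinearMap.comp_sub, ← LinearMap.comp_assoc, hb, LinearMap.sub_comp, h, LinearMap.comp_assoc,
      C.d_comp_d, LinearMap.comp_zero, sub_zero, sub_self]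
  obtain ⟨a₀, ha₀⟩ := exists_lift (C'.d 0) (μ 0) fun x =>
    (C'.exact_zero _).1 (LinearMap.congr_fun h₀ x)
  choose next hnext using step
  let s : ∀ i, S i := fun i => Nat.rec ⟨a₀, by
    rw [LinearMap.comp_sub, ← LinearMap.comp_assoc, ha₀, h, sub_self]⟩ next i
  refine ⟨fun i => (s i).1, ha₀.symm, fun i => ?_⟩
  rw [← sub_eq_iff_eq_add]
  exact (hnext i (s i)).symm

variable {M : Type*} [AddCommGroup M] [Module A M]

theorem isCobdry_comp (C C' : ProjRes A L) (θ : ∀ i, C.X i →ₗ[A] C'.X i)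
    (h : ∀ i, C'.d i ∘ₗ θ (i + 1) = θ i ∘ₗ C.d i) (i : ℕ) (f : C'.X i →ₗ[A] M)
    (hf : C'.IsCobdry i f) : C.IsCobdry i (f ∘ₗ θ i) := by
  cases i with
  | zero =>
    have : f = 0 := hf
    rw [this]
    exact LinearMap.zero_comp _
  | succ i =>
    obtain ⟨g, rfl⟩ := hf
    exact ⟨g ∘ₗ θ i, by rw [LinearMap.comp_assoc, h, LinearMap.comp_assoc]⟩

/-- A chain endomorphism lifting the identity is homotopic to the identity, and on a cocycle the
homotopy contributes only a coboundary. -/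
theorem isCobdry_comp_sub (C : ProjRes A L) (θ : ∀ i, C.X i →ₗ[A] C.X i)
    (h₀ : C.ε ∘ₗ θ 0 = C.ε) (h : ∀ i, C.d i ∘ₗ θ (i + 1) = θ i ∘ₗ C.d i) (i : ℕ)
    (f : C.X i →ₗ[A] M) (hf : f ∘ₗ C.d i = 0) : C.IsCobdry i (f ∘ₗ θ i - f) := by
  obtain ⟨s, hs₀, hs⟩ := exists_homotopy C C (fun i => θ i - LinearMap.id)
    (by rw [LinearMap.comp_sub, h₀, LinearMap.comp_id, sub_self])
    (fun i => by rw [LinearMap.comp_sub, LinearMap.sub_comp, h]; rfl)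
  have e : f ∘ₗ θ i - f = f ∘ₗ (θ i - LinearMap.id) := by
    rw [LinearMap.comp_sub, LinearMap.comp_id]
  rw [e]
  cases i with
  | zero =>
    change f ∘ₗ (θ 0 - LinearMap.id) = 0
    rw [hs₀, ← LinearMap.comp_assoc, hf, LinearMap.zero_comp]
  | succ i =>
    refine ⟨f ∘ₗ s i, ?_⟩
    rw [hs i, LinearMap.comp_add, ← LinearMap.comp_assoc, hf, LinearMap.zero_comp, zero_add,
      LinearMap.comp_assoc]

theorem IsCobdry.add (C : ProjRes A L) {i : ℕ} {f g : C.X i →ₗ[A] M} (hf : C.IsCobdry i f)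
    (hg : C.IsCobdry i g) : C.IsCobdry i (f + g) := by
  rw [isCobdry_iff] at *
  obtain ⟨a, rfl⟩ := hf
  obtain ⟨b, rfl⟩ := hg
  exact ⟨a + b, (LinearMap.add_comp _ _ _).symm⟩

theorem IsCobdry.neg (C : ProjRes A L) {i : ℕ} {f : C.X i →ₗ[A] M} (hf : C.IsCobdry i f) :
    C.IsCobdry i (-f) := by
  rw [isCobdry_iff] at *
  obtain ⟨a, rfl⟩ := hf
  exact ⟨-a, (LinearMap.neg_comp _ _).symm⟩

/-- Restriction of cocycles along a chain map. -/
def cocyclesComp {C C' : ProjRes A L} (θ : ∀ i, C.X i →ₗ[A] C'.X i)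
    (h : ∀ i, C'.d i ∘ₗ θ (i + 1) = θ i ∘ₗ C.d i) (M : Type*) [AddCommGroup M] [Module A M]
    (i : ℕ) : C'.cocycles M i →+ C.cocycles M i where
  toFun f := ⟨f.1 ∘ₗ θ i, by
    change (f.1 ∘ₗ θ i) ∘ₗ C.d i = 0
    rw [LinearMap.comp_assoc, ← h, ← LinearMap.comp_assoc, f.2, LinearMap.zero_comp]⟩
  map_zero' := Subtype.ext (LinearMap.zero_comp _)
  map_add' _ _ := Subtype.ext (LinearMap.add_comp _ _ _)

end ProjRes

end Comparison

/-! ### Classes of inhomogeneous cocycles -/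

section CocycleClass

theorem homologyπ_eq_zero_iff {k : Type u} [CommRing k] (K : CochainComplex (ModuleCat.{u} k) ℕ)
    (i : ℕ) (z : K.cycles i) : (K.homologyπ i).hom z = 0 ↔
      ∃ y, (K.iCycles i).hom z = (K.d ((ComplexShape.up ℕ).prev i) i).hom y := by
  have hex := ShortComplex.exact_of_g_is_cokernel
    (ShortComplex.mk (K.toCycles ((ComplexShape.up ℕ).prev i) i) (K.homologyπ i) (by simp))
    (K.homologyIsCokernel _ i rfl)
  rw [ShortComplex.ShortExact.moduleCat_exact_iff_function_exact] at hex
  have hinj : Function.Injective (K.iCycles i).hom := (ModuleCat.mono_iff_injective _).1 inferInstance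
  have hd : ∀ y, (K.iCycles i).hom ((K.toCycles ((ComplexShape.up ℕ).prev i) i).hom y) =
      (K.d ((ComplexShape.up ℕ).prev i) i).hom y := fun y => by
    rw [← ModuleCat.comp_apply, K.toCycles_i]
  refine (hex z).trans ⟨?_, ?_⟩
  · rintro ⟨y, rfl⟩
    exact ⟨y, hd y⟩
  · rintro ⟨y, hy⟩
    exact ⟨y, hinj ((hd y).trans hy.symm)⟩

theorem homologyπ_surjective {k : Type u} [CommRing k] (K : CochainComplex (ModuleCat.{u} k) ℕ)
    (i : ℕ) : Function.Surjective (K.homologyπ i).hom :=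
  (ModuleCat.epi_iff_surjective _).1 inferInstance

variable {R G : Type u} [CommRing R] [Group G] (M : Rep.{u} R G)

open groupCohomology

theorem iCocycles_injective (i : ℕ) : Function.Injective (iCocycles M i).hom :=
  (ModuleCat.mono_iff_injective _).1 inferInstance

/-- The cohomology class of an inhomogeneous cocycle. -/
def cochainClass (i : ℕ) :
    LinearMap.ker (inhomogeneousCochains.d M i).hom →ₗ[R] groupCohomology M i :=
  (π M i).hom ∘ₗ
    { toFun := fun f => cocyclesMk f.1 f.2
      map_add' := fun f g => iCocycles_injective M i (by
        rw [map_add]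
        erw [iCocycles_mk, iCocycles_mk, iCocycles_mk]
        rfl)
      map_smul' := fun r f => iCocycles_injective M i (by
        rw [map_smul]
        erw [iCocycles_mk, iCocycles_mk]
        rfl) }

theorem cochainClass_surjective (i : ℕ) : Function.Surjective (cochainClass M i) := by
  intro x
  obtain ⟨z, rfl⟩ := homologyπ_surjective (inhomogeneousCochains M) i x
  have hz : (inhomogeneousCochains.d M i).hom ((iCocycles M i).hom z) = 0 := by
    rw [← inhomogeneousCochains.d_def, ← ModuleCat.comp_apply]
    erw [HomologicalComplex.iCycles_d]
    rfl
  refine ⟨⟨(iCocycles M i).hom z, hz⟩, congrArg (π M i).hom (iCocycles_injective M i ?_)⟩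
  exact iCocycles_mk _ hz

theorem cochainClass_eq_zero_iff_zero (f : LinearMap.ker (inhomogeneousCochains.d M 0).hom) :
    cochainClass M 0 f = 0 ↔ f.1 = 0 := by
  refine (homologyπ_eq_zero_iff (inhomogeneousCochains M) 0 _).trans ?_
  have h : (iCocycles M 0).hom (cocyclesMk f.1 f.2) = f.1 := iCocycles_mk _ f.2
  have hd : (inhomogeneousCochains M).d ((ComplexShape.up ℕ).prev 0) 0 = 0 :=
    HomologicalComplex.shape _ _ _ (by simp)
  constructor
  · rintro ⟨y, hy⟩
    refine h.symm.trans (hy.trans ?_)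
    rw [hd]
    rfl
  · intro h0
    refine ⟨0, h.trans (h0.trans (map_zero _).symm)⟩

theorem cochainClass_eq_zero_iff_succ (i : ℕ)
    (f : LinearMap.ker (inhomogeneousCochains.d M (i + 1)).hom) :
    cochainClass M (i + 1) f = 0 ↔ ∃ y, f.1 = (inhomogeneousCochains.d M i).hom y := by
  refine (homologyπ_eq_zero_iff (inhomogeneousCochains M) (i + 1) _).trans ?_
  have h : (iCocycles M (i + 1)).hom (cocyclesMk f.1 f.2) = f.1 := iCocycles_mk _ f.2
  have hp : (ComplexShape.up ℕ).prev (i + 1) = i := by simp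
  rw [hp]
  constructor
  · rintro ⟨y, hy⟩
    refine ⟨y, h.symm.trans (hy.trans ?_)⟩
    rw [inhomogeneousCochains.d_def]
  · rintro ⟨y, hy⟩
    refine ⟨y, h.trans (hy.trans ?_)⟩
    rw [inhomogeneousCochains.d_def]

theorem cochainClass_map {M M' : Rep.{u} R G} (g : M ⟶ M') (i : ℕ)
    (f : LinearMap.ker (inhomogeneousCochains.d M i).hom)
    (f' : LinearMap.ker (inhomogeneousCochains.d M' i).hom) (h : ∀ x, f'.1 x = g.hom (f.1 x)) :
    cochainClass M' i f' = ((groupCohomology.functor R G i).map g).hom (cochainClass M i f) := by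
  have h1 : (π M' i).hom ((cocyclesMap (MonoidHom.id G) g i).hom (cocyclesMk f.1 f.2)) =
      ((groupCohomology.functor R G i).map g).hom (cochainClass M i f) :=
    (congrArg (fun α => α.hom (cocyclesMk f.1 f.2)) (π_map (MonoidHom.id G) g i)).symm
  rw [← h1]
  refine congrArg (π M' i).hom (iCocycles_injective M' i ?_)
  have h2 : (iCocycles M' i).hom ((cocyclesMap (MonoidHom.id G) g i).hom (cocyclesMk f.1 f.2)) =
      ((cochainsMap (MonoidHom.id G) g).f i).hom ((iCocycles M i).hom (cocyclesMk f.1 f.2)) :=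
    congrArg (fun α => α.hom (cocyclesMk f.1 f.2))
      (HomologicalComplex.cyclesMap_i (cochainsMap (MonoidHom.id G) g) i)
  have h3 : (iCocycles M i).hom (cocyclesMk f.1 f.2) = f.1 := iCocycles_mk _ f.2
  have h4 : (iCocycles M' i).hom (cocyclesMk f'.1 f'.2) = f'.1 := iCocycles_mk _ f'.2
  refine h4.trans (Eq.trans ?_ h2.symm)
  rw [h3]
  exact funext h

end CocycleClass

/-! ### Group cohomology from an arbitrary projective resolution -/

section Bar

variable {R G : Type u} [CommRing R] [Group G]

variable (R G) in
/-- The bar resolution as a resolution by modules over the group ring. -/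
def barRes : ProjRes (MonoidAlgebra R G) (TrivMod R G) := ProjRes.ofRep (Rep.barResolution R G)

variable (M : Rep.{u} R G)

/-- The inhomogeneous cochain attached to a cochain on the bar resolution. -/
def barEval (i : ℕ) (f : (barRes R G).X i →ₗ[MonoidAlgebra R G] M.ρ.asModule)
    (g : Fin i → G) : M := f (Finsupp.single g (MonoidAlgebra.single 1 1) : (Fin i → G) →₀ MonoidAlgebra R G)

theorem exists_hom_eq {V W : Rep.{u} R G} (f : V.ρ.asModule →ₗ[MonoidAlgebra R G] W.ρ.asModule) :
    ∃ F : V ⟶ W, (Rep.toModuleMonoidAlgebra.map F).hom = f := by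
  obtain ⟨F, hF⟩ := Rep.toModuleMonoidAlgebra.map_surjective
    (ModuleCat.ofHom f : Rep.toModuleMonoidAlgebra.obj V ⟶ Rep.toModuleMonoidAlgebra.obj W)
  exact ⟨F, by rw [hF]; rfl⟩

theorem barEval_injective (i : ℕ) : Function.Injective (barEval M i) := by
  intro f f' h
  obtain ⟨F, rfl⟩ := exists_hom_eq (V := Rep.free R G (Fin i → G)) f
  obtain ⟨F', rfl⟩ := exists_hom_eq (V := Rep.free R G (Fin i → G)) f'
  rw [Rep.free_ext R G M F F' fun x => congrFun h x]

theorem barEval_surjective (i : ℕ) : Function.Surjective (barEval M i) := by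
  intro c
  refine ⟨(Rep.toModuleMonoidAlgebra.map (Rep.freeLift R G M c)).hom, ?_⟩
  exact (Rep.freeLiftLEquiv R G (Fin i → G) M).apply_symm_apply c

/-- `inhomogeneousCochains.d_eq` presents the inhomogeneous differential as precomposition with the
bar differential, transported through `Rep.freeLiftLEquiv`. -/
theorem barEval_d (i : ℕ) (f : (barRes R G).X i →ₗ[MonoidAlgebra R G] M.ρ.asModule) :
    barEval M (i + 1) (f ∘ₗ (barRes R G).d i) =
      (inhomogeneousCochains.d M i).hom (barEval M i f) := by
  obtain ⟨F, rfl⟩ := exists_hom_eq (V := Rep.free R G (Fin i → G)) f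
  have h1 : barEval M i (Rep.toModuleMonoidAlgebra.map F).hom =
    Rep.freeLiftLEquiv R G (Fin i → G) M F := rfl
  have h2 : (Rep.freeLiftLEquiv R G (Fin i → G) M).symm
      (Rep.freeLiftLEquiv R G (Fin i → G) M F) = F := LinearEquiv.symm_apply_apply _ _
  rw [h1, inhomogeneousCochains.d_eq]
  change _ = Rep.freeLiftLEquiv R G (Fin (i + 1) → G) M
    ((((Rep.barComplex R G).linearYonedaObj R M).d i (i + 1)).hom
      ((Rep.freeLiftLEquiv R G (Fin i → G) M).symm (Rep.freeLiftLEquiv R G (Fin i → G) M F)))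
  rw [h2]
  rfl

/-- The cohomology class of a cocycle on the bar resolution. -/
def barClass (i : ℕ) :
    (barRes R G).cocycles M.ρ.asModule i →+ groupCohomology M i :=
  (cochainClass M i).toAddMonoidHom.comp
    { toFun := fun f => ⟨barEval M i f.1, by
        rw [LinearMap.mem_ker, ← barEval_d, f.2]
        rfl⟩
      map_zero' := rfl
      map_add' := fun _ _ => rfl }

theorem barClass_surjective (i : ℕ) : Function.Surjective (barClass M i) := by
  intro x
  obtain ⟨c, rfl⟩ := cochainClass_surjective M i x
  obtain ⟨f, hf⟩ := barEval_surjective M i c.1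
  refine ⟨⟨f, barEval_injective M (i + 1) ?_⟩, congrArg (cochainClass M i) (Subtype.ext hf)⟩
  rw [barEval_d, hf]
  exact c.2

theorem barClass_eq_zero_iff (i : ℕ) (f : (barRes R G).cocycles M.ρ.asModule i) :
    barClass M i f = 0 ↔ (barRes R G).IsCobdry i f.1 := by
  cases i with
  | zero =>
    refine (cochainClass_eq_zero_iff_zero M _).trans ⟨fun h => ?_, fun h => ?_⟩
    · exact barEval_injective M 0 h
    · have : f.1 = 0 := h
      change barEval M 0 f.1 = 0
      rw [this]
      rfl
  | succ i =>
    refine (cochainClass_eq_zero_iff_succ M i _).trans ⟨fun ⟨y, hy⟩ => ?_, fun ⟨y, hy⟩ => ?_⟩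
    · obtain ⟨g, rfl⟩ := barEval_surjective M i y
      refine ⟨g, barEval_injective M (i + 1) ?_⟩
      rw [barEval_d]
      exact hy
    · refine ⟨barEval M i y, ?_⟩
      rw [← barEval_d, ← hy]
      rfl

/-- Every projective resolution of the trivial module computes group cohomology. -/
theorem exists_cocycleClass (C : ProjRes (MonoidAlgebra R G) (TrivMod R G)) (i : ℕ) :
    ∃ cls : ∀ M : Rep.{u} R G, C.cocycles M.ρ.asModule i →+ groupCohomology M i,
      (∀ M, Function.Surjective (cls M)) ∧ (∀ M z, cls M z = 0 ↔ C.IsCobdry i z.1) ∧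
      (∀ (M M' : Rep.{u} R G) (g : M ⟶ M') z,
        cls M' (C.cocyclesMap (Rep.toModuleMonoidAlgebra.map g).hom i z) =
          ((groupCohomology.functor R G i).map g).hom (cls M z)) ∧
      ∀ (M : Rep.{u} R G) (r : R) (z z' : C.cocycles M.ρ.asModule i),
        (∀ x, z'.1 x = (r • (z.1 x : M) : M)) → cls M z' = r • cls M z := by
  obtain ⟨θ, hθ₀, hθ⟩ := ProjRes.exists_chainMap (barRes R G) C
  obtain ⟨η, hη₀, hη⟩ := ProjRes.exists_chainMap C (barRes R G)
  -- Classes are defined by pulling back along θ from the bar resolution to C. The map η is an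
  -- inverse up to homotopy, which gives surjectivity and the kernel.
  refine ⟨fun M => (barClass M i).comp (ProjRes.cocyclesComp θ hθ M.ρ.asModule i), fun M => ?_,
    fun M z => ?_, fun M M' g z => ?_, fun M r z z' h => ?_⟩
  · intro x
    obtain ⟨f, rfl⟩ := barClass_surjective M i x
    refine ⟨ProjRes.cocyclesComp η hη M.ρ.asModule i f, ?_⟩
    rw [← sub_eq_zero, AddMonoidHom.comp_apply, ← map_sub, barClass_eq_zero_iff]
    refine (barRes R G).isCobdry_comp_sub (fun i => η i ∘ₗ θ i) ?_ (fun i => ?_) i f.1 f.2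
    · rw [← LinearMap.comp_assoc, hη₀, hθ₀]
    · rw [← LinearMap.comp_assoc, hη, LinearMap.comp_assoc, hθ, LinearMap.comp_assoc]
  · refine (barClass_eq_zero_iff M i _).trans ⟨fun h => ?_, fun h => ?_⟩
    · have h1 := ProjRes.isCobdry_comp C (barRes R G) η hη i _ h
      have h2 := C.isCobdry_comp_sub (fun i => θ i ∘ₗ η i)
        (by rw [← LinearMap.comp_assoc, hθ₀, hη₀])
        (fun i => by rw [← LinearMap.comp_assoc, hθ, LinearMap.comp_assoc, hη, LinearMap.comp_assoc])
        i z.1 z.2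
      have h3 := ProjRes.IsCobdry.add C h1 (ProjRes.IsCobdry.neg C h2)
      have h4 : (ProjRes.cocyclesComp θ hθ M.ρ.asModule i z).1 ∘ₗ η i +
          -(z.1 ∘ₗ θ i ∘ₗ η i - z.1) = z.1 := by
        have : (ProjRes.cocyclesComp θ hθ M.ρ.asModule i z).1 ∘ₗ η i = z.1 ∘ₗ θ i ∘ₗ η i := rfl
        rw [this]
        abel
      rwa [h4] at h3
    · exact ProjRes.isCobdry_comp (barRes R G) C θ hθ i _ h
  · exact cochainClass_map g i _ _ fun x => rfl
  · refine (congrArg (cochainClass M i) (Subtype.ext (funext fun x => ?_))).trans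
      (map_smul (cochainClass M i) r _)
    exact h _

end Bar

/-! ### Group rings as twisted Laurent rings, Novikov modules and the antipode -/

section GroupRing

variable {R G : Type u} [CommRing R] [Group G]

instance (K : Subgroup G) : Module (MonoidAlgebra R K) (MonoidAlgebra R G) :=
  Module.compHom _ (MonoidAlgebra.mapDomainRingHom R K.subtype)

theorem subgroupRing_smul_def {K : Subgroup G} (b : MonoidAlgebra R K) (a : MonoidAlgebra R G) :
    b • a = MonoidAlgebra.mapDomainRingHom R K.subtype b * a := rfl

instance (K : Subgroup G) :
    IsScalarTower (MonoidAlgebra R K) (MonoidAlgebra R G) (MonoidAlgebra R G) where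
  smul_assoc _ _ _ := mul_assoc _ _ _

theorem subgroupRing_smul_one {K : Subgroup G} (b : MonoidAlgebra R K) :
    b • (1 : MonoidAlgebra R G) = MonoidAlgebra.mapDomainRingHom R K.subtype b := mul_one _

theorem single_smul_single {K : Subgroup G} (k : K) (g : G) (r s : R) :
    (MonoidAlgebra.single k r : MonoidAlgebra R K) • (MonoidAlgebra.single g s : MonoidAlgebra R G) =
      MonoidAlgebra.single ((k : G) * g) (r * s) := by
  rw [subgroupRing_smul_def, MonoidAlgebra.mapDomainRingHom_apply, MonoidAlgebra.mapDomain_single,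
    MonoidAlgebra.single_mul_single]
  rfl

variable (R) in
/-- A group element as a unit of the group ring. -/
def gUnit : G →* (MonoidAlgebra R G)ˣ :=
  (Units.map (MonoidAlgebra.of R G)).comp toUnits.toMonoidHom

theorem gUnit_val (g : G) : (gUnit R g : MonoidAlgebra R G) = MonoidAlgebra.single g 1 := rfl

theorem gUnit_inv_val (g : G) :
    ((gUnit R g)⁻¹ : (MonoidAlgebra R G)ˣ) = (MonoidAlgebra.single g⁻¹ 1 : MonoidAlgebra R G) := by
  rw [← map_inv, gUnit_val]

/-- The element `t` generates the image of `φ`, which is non-trivial. -/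
structure IsGen (φ : G →* Multiplicative ℤ) (t : G) : Prop where
  ne_one : φ t ≠ 1
  exists_zpow : ∀ g, ∃ j : ℤ, φ g = φ t ^ j

theorem exists_isGen {φ : G →* Multiplicative ℤ} (hφ : φ ≠ 1) : ∃ t, IsGen φ t := by
  obtain ⟨⟨_, t, rfl⟩, ht⟩ := IsCyclic.exists_generator (α := φ.range)
  have h : ∀ g, ∃ j : ℤ, φ g = φ t ^ j := fun g => by
    obtain ⟨j, hj⟩ := Subgroup.mem_zpowers_iff.1 (ht ⟨φ g, g, rfl⟩)
    exact ⟨j, (congrArg Subtype.val hj).symm⟩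
  refine ⟨t, fun h1 => hφ (MonoidHom.ext fun g => ?_), h⟩
  obtain ⟨j, hj⟩ := h g
  rw [hj, h1, one_zpow]
  rfl

variable {φ : G →* Multiplicative ℤ} {t : G}

theorem IsGen.zpow_injective (ht : IsGen φ t) : Function.Injective fun j : ℤ => φ t ^ j := by
  intro i j h
  have h1 : Multiplicative.toAdd (φ t ^ i) = Multiplicative.toAdd (φ t ^ j) := congrArg _ h
  rw [toAdd_zpow, toAdd_zpow, smul_eq_mul, smul_eq_mul] at h1
  exact mul_right_cancel₀ (fun h0 => ht.ne_one (toAdd_eq_zero.1 h0)) h1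

theorem IsGen.exists_eq_mul (ht : IsGen φ t) (g : G) : ∃ (k : φ.ker) (j : ℤ), g = k * t ^ j := by
  obtain ⟨j, hj⟩ := ht.exists_zpow g
  refine ⟨⟨g * (t ^ j)⁻¹, ?_⟩, j, by simp⟩
  rw [MonoidHom.mem_ker, map_mul, map_inv, map_zpow, hj, mul_inv_cancel]

theorem mul_zpow_injective (φ : G →* Multiplicative ℤ) (t : G) (j : ℤ) :
    Function.Injective fun k : φ.ker => (k : G) * t ^ j := fun _ _ h =>
  Subtype.ext (mul_right_cancel h)

variable (R) in
/-- The coefficient of `tʲ`. -/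
def coeffHom (φ : G →* Multiplicative ℤ) (t : G) (j : ℤ) :
    MonoidAlgebra R G →+ MonoidAlgebra R φ.ker :=
  MonoidAlgebra.comapDomainAddMonoidHom _ (mul_zpow_injective φ t j)

theorem coeffHom_smul (ht : IsGen φ t) (i j : ℤ) (b : MonoidAlgebra R φ.ker) :
    coeffHom R φ t j (b • (MonoidAlgebra.single (t ^ i) 1 : MonoidAlgebra R G)) =
      if i = j then b else 0 := by
  induction b using MonoidAlgebra.induction_linear with
  | zero => rw [zero_smul, map_zero, ite_self]
  | add x y hx hy =>
    rw [add_smul, map_add, hx, hy]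
    split_ifs
    · rfl
    · exact add_zero 0
  | single k r =>
    rw [single_smul_single, mul_one]
    split_ifs with hij
    · subst hij
      exact MonoidAlgebra.comapDomain_single_map (fun k : φ.ker => (k : G) * t ^ i)
        (mul_zpow_injective φ t i) k r
    · refine MonoidAlgebra.comapDomain_single_of_not_mem_range ?_ (mul_zpow_injective φ t j)
      rintro ⟨k', hk'⟩
      have h2 : φ ((k' : G) * t ^ j) = φ ((k : G) * t ^ i) := congrArg φ hk'
      rw [map_mul, map_mul, map_zpow, map_zpow, MonoidHom.mem_ker.1 k.2, MonoidHom.mem_ker.1 k'.2,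
        one_mul, one_mul] at h2
      exact hij (ht.zpow_injective h2).symm

/-- The powers of `t` form a basis of the group ring over the group ring of the kernel. -/
def zpowBasis (ht : IsGen φ t) :
    Module.Basis ℤ (MonoidAlgebra R φ.ker) (MonoidAlgebra R G) :=
  Module.Basis.mk (v := fun j : ℤ => (MonoidAlgebra.single (t ^ j) 1 : MonoidAlgebra R G))
    (by
      rw [linearIndependent_iff]
      intro l hl
      ext1 j
      have h := congrArg (coeffHom R φ t j) hl
      rw [Finsupp.linearCombination_apply, Finsupp.sum, map_sum, map_zero] at h
      simp only [coeffHom_smul ht] at h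
      rw [Finset.sum_ite_eq'] at h
      split_ifs at h with hj
      · exact h
      · simpa using hj)
    (by
      rintro a -
      induction a using MonoidAlgebra.induction_linear with
      | zero => exact zero_mem _
      | add x y hx hy => exact add_mem hx hy
      | single g r =>
        obtain ⟨k, j, rfl⟩ := ht.exists_eq_mul g
        have : (MonoidAlgebra.single ((k : G) * t ^ j) r : MonoidAlgebra R G) =
            (MonoidAlgebra.single k r : MonoidAlgebra R φ.ker) •
              (MonoidAlgebra.single (t ^ j) 1 : MonoidAlgebra R G) := by
          rw [single_smul_single, mul_one]
        rw [this]
        exact Submodule.smul_mem _ _ (Submodule.subset_span ⟨j, rfl⟩))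

variable (R) in
/-- The group ring of `G` is a ring of twisted Laurent polynomials over that of the kernel. -/
def groupLaurent (ht : IsGen φ t) : TwistedLaurent (MonoidAlgebra R G) (MonoidAlgebra R φ.ker) where
  t := gUnit R t
  σ := MonoidAlgebra.mapDomainRingEquiv R (MulAut.conjNormal t)
  comm b := by
    have h : (AddMonoidHom.mulLeft (gUnit R t : MonoidAlgebra R G)).comp
        (MonoidAlgebra.mapDomainRingHom R φ.ker.subtype).toAddMonoidHom =
        (AddMonoidHom.mulRight (gUnit R t : MonoidAlgebra R G)).comp
          ((MonoidAlgebra.mapDomainRingHom R φ.ker.subtype).toAddMonoidHom.comp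
          (MonoidAlgebra.mapDomainRingEquiv R (MulAut.conjNormal t)).toRingHom.toAddMonoidHom) := by
      refine MonoidAlgebra.addMonoidHom_ext fun k r => ?_
      change MonoidAlgebra.single t 1 * MonoidAlgebra.mapDomainRingHom R φ.ker.subtype
        (MonoidAlgebra.single k r) = MonoidAlgebra.mapDomainRingHom R φ.ker.subtype
        (MonoidAlgebra.mapDomainRingEquiv R (MulAut.conjNormal t) (MonoidAlgebra.single k r)) *
        MonoidAlgebra.single t 1
      rw [MonoidAlgebra.mapDomainRingEquiv_single, MonoidAlgebra.mapDomainRingHom_apply,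
        MonoidAlgebra.mapDomainRingHom_apply, MonoidAlgebra.mapDomain_single,
        MonoidAlgebra.mapDomain_single, MonoidAlgebra.single_mul_single,
        MonoidAlgebra.single_mul_single, one_mul, mul_one]
      congr 1
      simp
    rw [subgroupRing_smul_one, subgroupRing_smul_def]
    exact DFunLike.congr_fun h b
  basis := zpowBasis ht
  basis_apply j := by
    rw [← map_zpow, gUnit_val]
    exact Module.Basis.mk_apply _ _ j

theorem groupLaurent_t (ht : IsGen φ t) : (groupLaurent R ht).t = gUnit R t := rfl

theorem free_groupRing (hφ : φ ≠ 1) : Module.Free (MonoidAlgebra R φ.ker) (MonoidAlgebra R G) := by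
  obtain ⟨t, ht⟩ := exists_isGen hφ
  exact Module.Free.of_basis (zpowBasis ht)

variable (R) in
/-- The modules on which all operators `g + g⁻¹ - S` with `φ(g) ≠ 1` are bijective. -/
def IsNovikov (φ : G →* Multiplicative ℤ) (M : Type u) [AddCommGroup M]
    [Module (MonoidAlgebra R G) M] : Prop :=
  ∀ g, φ g ≠ 1 → LaurentBij (MonoidAlgebra R φ.ker) (gUnit R g) M

theorem isNovikov_nov (ht : IsGen φ t) (s : ℤˣ) (N : Type u) [AddCommGroup N]
    [Module (MonoidAlgebra R φ.ker) N] : IsNovikov R φ ((groupLaurent R ht).Nov s N) := by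
  intro g hg
  obtain ⟨k, j, rfl⟩ := ht.exists_eq_mul g
  have hj : j ≠ 0 := by
    rintro rfl
    exact hg (by rw [zpow_zero, mul_one]; exact k.2)
  -- This element is the B-coefficient of g⁻¹ = (t⁻ʲ k⁻¹ tʲ) t⁻ʲ.
  have hk : t ^ (-j) * (k : G)⁻¹ * t ^ j ∈ φ.ker := by
    rw [MonoidHom.mem_ker, map_mul, map_mul, map_inv, MonoidHom.mem_ker.1 k.2, inv_one, mul_one,
      ← map_mul, ← zpow_add, neg_add_cancel, zpow_zero, map_one]
  refine (groupLaurent R ht).laurentBij_nov _ (MonoidAlgebra.single k 1)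
    (MonoidAlgebra.single ⟨_, hk⟩ 1) j hj ?_ ?_ s
  · rw [groupLaurent_t, ← map_zpow, gUnit_val, gUnit_val, single_smul_single, mul_one]
  · rw [groupLaurent_t, ← map_zpow, gUnit_inv_val, gUnit_val, single_smul_single, mul_one]
    congr 1
    rw [mul_assoc, ← zpow_add, add_neg_cancel, zpow_zero, mul_one, mul_inv_rev, zpow_neg]

variable (R G) in
/-- Inversion of group elements, as a homomorphism to the opposite ring. -/
def antipodeHom : MonoidAlgebra R G →ₐ[R] (MonoidAlgebra R G)ᵐᵒᵖ :=
  MonoidAlgebra.lift R (MonoidAlgebra R G)ᵐᵒᵖ G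
    { toFun := fun g => MulOpposite.op (MonoidAlgebra.single g⁻¹ 1)
      map_one' := by rw [inv_one]; rfl
      map_mul' := fun g h => by
        rw [← MulOpposite.op_mul, MonoidAlgebra.single_mul_single, mul_inv_rev, mul_one] }

theorem antipodeHom_single (g : G) (r : R) :
    antipodeHom R G (MonoidAlgebra.single g r) = MulOpposite.op (MonoidAlgebra.single g⁻¹ r) := by
  rw [antipodeHom, MonoidAlgebra.lift_single]
  change r • MulOpposite.op (MonoidAlgebra.single g⁻¹ 1 : MonoidAlgebra R G) = _
  rw [← MulOpposite.op_smul, MonoidAlgebra.smul_single', mul_one]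

theorem antipodeHom_antipodeHom (a : MonoidAlgebra R G) :
    (antipodeHom R G (antipodeHom R G a).unop).unop = a := by
  induction a using MonoidAlgebra.induction_linear with
  | zero => simp
  | add x y hx hy => rw [map_add, MulOpposite.unop_add, map_add, MulOpposite.unop_add, hx, hy]
  | single g r =>
    rw [antipodeHom_single, MulOpposite.unop_op, antipodeHom_single, MulOpposite.unop_op, inv_inv]

variable (R G) in
/-- The anti-automorphism of the group ring given by inversion of group elements. -/
def antipode : MonoidAlgebra R G ≃+* (MonoidAlgebra R G)ᵐᵒᵖ :=
  { (antipodeHom R G : MonoidAlgebra R G →+* (MonoidAlgebra R G)ᵐᵒᵖ) with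
    invFun := fun x => (antipodeHom R G x.unop).unop
    left_inv := antipodeHom_antipodeHom
    right_inv := fun x => MulOpposite.unop_injective (antipodeHom_antipodeHom x.unop) }

theorem antipode_single (g : G) (r : R) :
    antipode R G (MonoidAlgebra.single g r) = MulOpposite.op (MonoidAlgebra.single g⁻¹ r) :=
  antipodeHom_single g r

theorem antipode_smul_one {K : Subgroup G} (b : MonoidAlgebra R K) :
    antipode R G (b • (1 : MonoidAlgebra R G)) =
      MulOpposite.op ((antipode R K b).unop • (1 : MonoidAlgebra R G)) := by
  simp only [subgroupRing_smul_one]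
  induction b using MonoidAlgebra.induction_linear with
  | zero => simp
  | add x y hx hy => simp only [map_add, hx, hy, MulOpposite.unop_add, MulOpposite.op_add]
  | single g r =>
    rw [antipode_single, MulOpposite.unop_op, MonoidAlgebra.mapDomainRingHom_apply,
      MonoidAlgebra.mapDomain_single, antipode_single, MonoidAlgebra.mapDomainRingHom_apply,
      MonoidAlgebra.mapDomain_single]
    rfl

theorem IsNovikov.charMod {M : Type u} [AddCommGroup M] [Module (MonoidAlgebra R G) M]
    (hM : IsNovikov R φ M) : IsNovikov R φ (CharMod (antipode R G) M) := fun g hg =>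
  laurentBij_charMod _ (by rw [gUnit_val, antipode_single, gUnit_inv_val])
    (fun b => ⟨_, antipode_smul_one b⟩) (hM g hg)

end GroupRing

/-! ### Injectivity of coinduced modules -/

section Cofree

/-- Coinduction is right adjoint to restriction of scalars, which preserves injections. -/
theorem injective_coind {A B : Type u} [Ring A] [Ring B] [Module B A] [IsScalarTower B A A]
    (J : Type u) [AddCommGroup J] [Module B J] [hJ : Module.Injective B J] :
    Module.Injective A (Coind A B J) where
  out X Y _ _ _ _ f hf g := by
    obtain ⟨h, hh⟩ := hJ.out (X := Res A B X) (Y := Res A B Y) (Res.map B f) hf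
      (Coind.adjInv g)
    refine ⟨Coind.adj h, fun x => ?_⟩
    have h1 : (Coind.adj h : Y →ₗ[A] Coind A B J) ∘ₗ f = Coind.adj (h ∘ₗ Res.map B f) :=
      LinearMap.ext fun x => Coind.ext fun a => congrArg h (map_smul f a x).symm
    have h2 : h ∘ₗ Res.map B f = Coind.adjInv g := LinearMap.ext hh
    rw [h2, Coind.adj_adjInv] at h1
    exact LinearMap.congr_fun h1 x

variable {R G : Type u} [CommRing R] [Group G] (H : Subgroup G)

theorem inv_out_mul_mem (g : G) : ((g : G ⧸ H).out)⁻¹ * g ∈ H :=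
  QuotientGroup.eq.1 (QuotientGroup.out_eq' (g : G ⧸ H))

/-- The component in `H` of an element of `G`, for a fixed set of coset representatives. -/
def cosetPart (g : G) : H := ⟨_, inv_out_mul_mem H g⟩

theorem out_mul_cosetPart (g : G) : (g : G ⧸ H).out * cosetPart H g = g := by
  simp [cosetPart]

theorem cosetPart_mul (g : G) (h : H) : cosetPart H (g * h) = cosetPart H g * h := by
  have : ((g * h : G) : G ⧸ H) = g := QuotientGroup.mk_mul_of_mem g h.2
  refine Subtype.ext ?_
  simp only [cosetPart, Subgroup.coe_mul, this, mul_assoc]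

theorem res_single_smul {M : Type u} [AddCommGroup M] [Module (MonoidAlgebra R G) M] (h : H) (r : R)
    (x : Res (MonoidAlgebra R G) (MonoidAlgebra R H) M) :
    (MonoidAlgebra.single h r : MonoidAlgebra R H) • x =
      (MonoidAlgebra.single (h : G) r : MonoidAlgebra R G) • x := by
  rw [Res.smul_def, MonoidAlgebra.one_def, single_smul_single, mul_one, mul_one]

theorem single_smul_eq_smul {X : Type u} [AddCommGroup X] [Module (MonoidAlgebra R G) X] (g : G)
    (r : R) (x : Res (MonoidAlgebra R G) R X) :
    (MonoidAlgebra.single g r : MonoidAlgebra R G) • x =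
      r • ((MonoidAlgebra.single g 1 : MonoidAlgebra R G) • x) := by
  rw [Res.smul_def, smul_smul, smul_one_mul, MonoidAlgebra.smul_single', mul_one]

/-- Over RH the module is a product, over representatives c of G/H, of modules coinduced from R. It
therefore suffices to extend, for each c separately, the R-linear map x ↦ g(x)(c). -/
theorem injective_res_coind (J : Type u) [AddCommGroup J] [Module R J] [hJ : Module.Injective R J] :
    Module.Injective (MonoidAlgebra R H)
      (Res (MonoidAlgebra R G) (MonoidAlgebra R H) (Coind (MonoidAlgebra R G) R J)) where
  out X Y _ _ _ _ f hf g := by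
    let g₀ : X → Coind (MonoidAlgebra R G) R J := fun x => g x
    have hg₀ : ∀ (h : H) (r : R) (x : X),
        g₀ ((MonoidAlgebra.single h r : MonoidAlgebra R H) • x) =
          (MonoidAlgebra.single (h : G) r : MonoidAlgebra R G) • g₀ x := fun h r x =>
      (map_smul g _ x).trans (res_single_smul H h r (g x))
    let gc : G → (Res (MonoidAlgebra R H) R X →ₗ[R] J) := fun c =>
      { toFun := fun x => g₀ x (MonoidAlgebra.single c 1)
        map_add' := fun x y => congrArg
          (fun k : Coind (MonoidAlgebra R G) R J => k (MonoidAlgebra.single c 1))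
          (map_add g (x : X) (y : X))
        map_smul' := fun r x => by
          have h1 : r • x = ((MonoidAlgebra.single 1 r : MonoidAlgebra R H) • (x : X) : X) := by
            rw [Res.smul_def, MonoidAlgebra.one_def, MonoidAlgebra.smul_single', mul_one]
          refine (congrArg (fun k : Coind (MonoidAlgebra R G) R J => k (MonoidAlgebra.single c 1))
            ((congrArg g₀ h1).trans (hg₀ 1 r x))).trans ?_
          rw [Coind.smul_apply, MonoidAlgebra.single_mul_single, Subgroup.coe_one, mul_one,
            one_mul, RingHom.id_apply]
          exact (congrArg (g₀ x) (by rw [MonoidAlgebra.smul_single', mul_one])).trans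
            (map_smul (g₀ x) r (MonoidAlgebra.single c 1)) }
    have hext : ∀ c, ∃ k : Res (MonoidAlgebra R H) R Y →ₗ[R] J,
        ∀ x : X, k (f x) = g₀ x (MonoidAlgebra.single c 1) := fun c =>
      hJ.out (X := Res (MonoidAlgebra R H) R X) (Y := Res (MonoidAlgebra R H) R Y)
        (Res.map R f) hf (gc c)
    choose k hk using hext
    -- The value at a = c h, with c the chosen representative and h in H, is forced by
    -- H-equivariance to be k_c(h y).
    let F : Y → Coind (MonoidAlgebra R G) R J := fun y =>
      (Finsupp.lift J R G fun a => k (a : G ⧸ H).out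
        ((MonoidAlgebra.single (cosetPart H a) 1 : MonoidAlgebra R H) • y : Y)) ∘ₗ
        (MonoidAlgebra.coeffLinearEquiv R).toLinearMap
    have hF : ∀ y a, F y (MonoidAlgebra.single a 1) = k (a : G ⧸ H).out
        ((MonoidAlgebra.single (cosetPart H a) 1 : MonoidAlgebra R H) • y : Y) := fun y a => by
      change Finsupp.lift J R G _ (Finsupp.single a 1) = _
      simp
    have hext' : ∀ {a b : Coind (MonoidAlgebra R G) R J},
        (∀ c : G, a (MonoidAlgebra.single c 1) = b (MonoidAlgebra.single c 1)) → a = b :=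
      fun {a b} h => MonoidAlgebra.lhom_ext' fun c => LinearMap.ext_ring (h c)
    have hs : ∀ (a : G) (r : R) (m : Coind (MonoidAlgebra R G) R J),
        m (MonoidAlgebra.single a r) = r • m (MonoidAlgebra.single a 1) := fun a r m => by
      rw [← map_smul, MonoidAlgebra.smul_single', mul_one]
    have hadd : ∀ y y', F (y + y') = F y + F y' := fun y y' => hext' fun a => by
      rw [Coind.add_apply, hF, hF, hF, smul_add]
      exact map_add (k _) _ _
    have hsmul : ∀ (b : MonoidAlgebra R H) y,
        F (b • y) = (b • (1 : MonoidAlgebra R G)) • F y := fun b y => by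
      induction b using MonoidAlgebra.induction_linear with
      | zero =>
        rw [zero_smul, zero_smul, zero_smul]
        exact add_eq_left.1 ((hadd 0 0).symm.trans (congrArg F (add_zero 0)))
      | add b b' hb hb' => rw [add_smul, add_smul, add_smul, hadd, hb, hb']
      | single h s =>
        refine hext' fun a => ?_
        have h1 : ((a * h : G) : G ⧸ H) = a := QuotientGroup.mk_mul_of_mem a h.2
        rw [hF, Coind.smul_apply, MonoidAlgebra.one_def, single_smul_single, mul_one, mul_one,
          MonoidAlgebra.single_mul_single, one_mul, hs, hF, h1, cosetPart_mul]
        refine Eq.trans (congrArg (k _) ?_) (map_smul (k _) s _)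
        rw [smul_smul, MonoidAlgebra.single_mul_single, one_mul]
        exact single_smul_eq_smul _ s (show Res (MonoidAlgebra R H) R Y from y)
    refine ⟨{ toFun := F, map_add' := hadd, map_smul' := hsmul }, fun x => hext' fun a => ?_⟩
    refine (hF (f x) a).trans ?_
    rw [← map_smul, hk, hg₀, Coind.smul_apply, MonoidAlgebra.single_mul_single, one_mul,
      out_mul_cosetPart]

end Cofree

/-! ### Invariant elements as maps from the trivial module -/

section InvariantHom

variable {R G : Type u} [CommRing R] [Group G] {W : Type u} [AddCommGroup W]
  [Module (MonoidAlgebra R G) W]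

theorem single_one_smul_single_smul (g : G) (r s : R) (w : W) :
    (MonoidAlgebra.single g r : MonoidAlgebra R G) • (MonoidAlgebra.single 1 s : MonoidAlgebra R G) • w
      = (MonoidAlgebra.single 1 (r * s) : MonoidAlgebra R G) •
        (MonoidAlgebra.single g 1 : MonoidAlgebra R G) • w := by
  rw [smul_smul, smul_smul, MonoidAlgebra.single_mul_single, MonoidAlgebra.single_mul_single,
    mul_one, mul_one, one_mul]

variable (R G) in
/-- The underlying additive group of the trivial module. -/
def trivEquiv : TrivMod R G ≃+ R := (Representation.trivial R G R).asModuleEquiv.toAddEquiv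

theorem trivEquiv_single_smul (g : G) (r : R) (x : TrivMod R G) :
    trivEquiv R G ((MonoidAlgebra.single g r : MonoidAlgebra R G) • x) = r * trivEquiv R G x := by
  rw [Representation.single_smul]
  rfl

/-- The linear map from the trivial module given by an invariant element. -/
def invHom (w : W) (hw : ∀ g : G, (MonoidAlgebra.single g 1 : MonoidAlgebra R G) • w = w) :
    TrivMod R G →ₗ[MonoidAlgebra R G] W where
  toFun x := (MonoidAlgebra.single 1 (trivEquiv R G x) : MonoidAlgebra R G) • w
  map_add' x y := by rw [map_add, MonoidAlgebra.single_add, add_smul]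
  map_smul' a x := by
    rw [RingHom.id_apply]
    induction a using MonoidAlgebra.induction_linear with
    | zero => rw [zero_smul, zero_smul, map_zero, MonoidAlgebra.single_zero, zero_smul]
    | add a b ha hb =>
      rw [add_smul, add_smul, ← ha, ← hb, map_add, MonoidAlgebra.single_add, add_smul]
    | single g s => rw [single_one_smul_single_smul, hw, trivEquiv_single_smul]

variable (R G) in
/-- The generator of the trivial module. -/
def trivOne : TrivMod R G := (trivEquiv R G).symm 1

theorem invHom_one (w : W) (hw : ∀ g : G, (MonoidAlgebra.single g 1 : MonoidAlgebra R G) • w = w) :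
    invHom w hw (trivOne R G) = w := by
  change (MonoidAlgebra.single 1 (trivEquiv R G ((trivEquiv R G).symm 1)) : MonoidAlgebra R G) • w = w
  rw [AddEquiv.apply_symm_apply, ← MonoidAlgebra.one_def, one_smul]

theorem single_smul_trivOne (g : G) :
    (MonoidAlgebra.single g 1 : MonoidAlgebra R G) • trivOne R G = trivOne R G :=
  (trivEquiv R G).injective (by rw [trivEquiv_single_smul, one_mul])

theorem single_smul_apply_one (f : TrivMod R G →ₗ[MonoidAlgebra R G] W) (g : G) :
    (MonoidAlgebra.single g 1 : MonoidAlgebra R G) • f (trivOne R G) = f (trivOne R G) := by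
  rw [← map_smul, single_smul_trivOne]

end InvariantHom

/-! ### Permutation modules and Shapiro's lemma -/

section Permutation

variable {R G : Type u} [CommRing R] [Group G] {ι : Type u} (H : ι → Subgroup G)

variable (R) in
/-- The permutation module on the disjoint union of the coset spaces. -/
abbrev PermMod : Type u := (Representation.ofMulAction R G (Σ i, G ⧸ H i)).asModule

variable (R) in
/-- The basis elements of the permutation module, with coefficients. -/
def permSingle (x : Σ i, G ⧸ H i) (r : R) : PermMod R H :=
  (Representation.ofMulAction R G (Σ i, G ⧸ H i)).asModuleEquiv.symm (MonoidAlgebra.single x r)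

theorem single_smul_permSingle (g : G) (r s : R) (x : Σ i, G ⧸ H i) :
    (MonoidAlgebra.single g r : MonoidAlgebra R G) • permSingle R H x s =
      permSingle R H (g • x) (r * s) := by
  rw [Representation.single_smul, permSingle, permSingle, LinearEquiv.apply_symm_apply,
    Representation.ofMulAction_single]
  exact MonoidAlgebra.smul_single' r (g • x) s

variable {H} in
theorem permMod_induction {p : PermMod R H → Prop} (v : PermMod R H) (h0 : p 0)
    (hadd : ∀ v w, p v → p w → p (v + w)) (hs : ∀ x r, p (permSingle R H x r)) : p v := by
  have key : ∀ w : MonoidAlgebra R (Σ i, G ⧸ H i),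
      p ((Representation.ofMulAction R G (Σ i, G ⧸ H i)).asModuleEquiv.symm w) := fun w => by
    induction w using MonoidAlgebra.induction_linear with
    | zero => rwa [map_zero]
    | add a b ha hb => rw [map_add]; exact hadd _ _ ha hb
    | single x r => exact hs x r
  exact key ((Representation.ofMulAction R G (Σ i, G ⧸ H i)).asModuleEquiv v)

variable {H} {W : Type u} [AddCommGroup W] [Module (MonoidAlgebra R G) W]

theorem permMod_hom_ext {f f' : PermMod R H →ₗ[MonoidAlgebra R G] W}
    (h : ∀ i, f (permSingle R H ⟨i, ((1 : G) : G ⧸ H i)⟩ 1) =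
      f' (permSingle R H ⟨i, ((1 : G) : G ⧸ H i)⟩ 1)) : f = f' := by
  refine LinearMap.ext fun v => ?_
  refine permMod_induction (p := fun v => f v = f' v) v (by rw [map_zero, map_zero]) (fun v w hv hw => ?_) fun x r => ?_
  · rw [map_add, map_add, hv, hw]
  · obtain ⟨i, q⟩ := x
    obtain ⟨g, rfl⟩ := QuotientGroup.mk_surjective q
    have : permSingle R H ⟨i, (g : G ⧸ H i)⟩ r = (MonoidAlgebra.single g r : MonoidAlgebra R G) •
        permSingle R H ⟨i, ((1 : G) : G ⧸ H i)⟩ 1 := by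
      rw [single_smul_permSingle, mul_one]
      congr 1
      change _ = (⟨i, g • ((1 : G) : G ⧸ H i)⟩ : Σ i, G ⧸ H i)
      rw [MulAction.Quotient.smul_coe, smul_eq_mul, mul_one]
    rw [this, map_smul, map_smul, h]

/-- A family of invariant elements determines a linear map on the permutation module. -/
theorem exists_permMod_hom (n : ι → W)
    (hn : ∀ i, ∀ h ∈ H i, (MonoidAlgebra.single h 1 : MonoidAlgebra R G) • n i = n i) :
    ∃ f : PermMod R H →ₗ[MonoidAlgebra R G] W,
      ∀ i, f (permSingle R H ⟨i, ((1 : G) : G ⧸ H i)⟩ 1) = n i := by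
  have hout : ∀ i (g : G), (MonoidAlgebra.single (g : G ⧸ H i).out 1 : MonoidAlgebra R G) • n i =
      (MonoidAlgebra.single g 1 : MonoidAlgebra R G) • n i := fun i g => by
    conv_rhs => rw [← out_mul_cosetPart (H i) g, ← mul_one (1 : R),
      ← MonoidAlgebra.single_mul_single, mul_smul, hn i _ (cosetPart (H i) g).2]
  let b : (Σ i, G ⧸ H i) → R →+ W := fun x =>
    { toFun := fun r => (MonoidAlgebra.single x.2.out r : MonoidAlgebra R G) • n x.1
      map_zero' := by rw [MonoidAlgebra.single_zero, zero_smul]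
      map_add' := fun r s => by rw [MonoidAlgebra.single_add, add_smul] }
  let F : PermMod R H →+ W := ((Finsupp.liftAddHom b).comp
    MonoidAlgebra.coeffAddEquiv.toAddMonoidHom).comp
      (Representation.ofMulAction R G (Σ i, G ⧸ H i)).asModuleEquiv.toAddEquiv.toAddMonoidHom
  have hF : ∀ i (g : G) r, F (permSingle R H ⟨i, (g : G ⧸ H i)⟩ r) =
      (MonoidAlgebra.single g r : MonoidAlgebra R G) • n i := fun i g r => by
    have h1 : F (permSingle R H ⟨i, (g : G ⧸ H i)⟩ r) = b ⟨i, (g : G ⧸ H i)⟩ r :=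
      Finsupp.liftAddHom_apply_single b _ r
    have h2 : ∀ c : G, (MonoidAlgebra.single c r : MonoidAlgebra R G) • n i =
        (MonoidAlgebra.single 1 r : MonoidAlgebra R G) •
          (MonoidAlgebra.single c 1 : MonoidAlgebra R G) • n i := fun c => by
      rw [smul_smul, MonoidAlgebra.single_mul_single, one_mul, mul_one]
    rw [h1, h2, ← hout, ← h2]
    rfl
  refine ⟨{ toFun := F, map_add' := map_add F, map_smul' := fun a v => ?_ }, fun i => ?_⟩
  · rw [RingHom.id_apply]
    refine permMod_induction (p := fun v => F (a • v) = a • F v) v ?_ (fun v w hv hw => ?_) fun x r => ?_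
    · rw [smul_zero, map_zero, smul_zero]
    · rw [smul_add, map_add, hv, hw, map_add, smul_add]
    · induction a using MonoidAlgebra.induction_linear with
      | zero => rw [zero_smul, map_zero, zero_smul]
      | add a a' ha ha' => rw [add_smul, map_add, ha, ha', add_smul]
      | single g s =>
        obtain ⟨i, q⟩ := x
        obtain ⟨c, rfl⟩ := QuotientGroup.mk_surjective q
        rw [single_smul_permSingle]
        refine (hF i (g * c) (s * r)).trans ?_
        rw [hF, smul_smul, MonoidAlgebra.single_mul_single]
  · refine (hF i 1 1).trans ?_
    rw [← MonoidAlgebra.one_def, one_smul]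

theorem single_smul_apply_permSingle (f : PermMod R H →ₗ[MonoidAlgebra R G] W) (i : ι) (h : G)
    (hh : h ∈ H i) : (MonoidAlgebra.single h 1 : MonoidAlgebra R G) •
      f (permSingle R H ⟨i, ((1 : G) : G ⧸ H i)⟩ 1) =
        f (permSingle R H ⟨i, ((1 : G) : G ⧸ H i)⟩ 1) := by
  rw [← map_smul, single_smul_permSingle, mul_one]
  have : h • (⟨i, ((1 : G) : G ⧸ H i)⟩ : Σ i, G ⧸ H i) = ⟨i, ((1 : G) : G ⧸ H i)⟩ := by
    change (⟨i, h • ((1 : G) : G ⧸ H i)⟩ : Σ i, G ⧸ H i) = _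
    rw [MulAction.Quotient.smul_coe, smul_eq_mul, mul_one]
    congr 1
    exact (QuotientGroup.eq.2 (by simpa using hh) : ((1 : G) : G ⧸ H i) = h).symm
  rw [this]

/-- The homomorphism from the trivial module of `H i` attached to a homomorphism on the permutation
module. -/
def toTrivHom (f : PermMod R H →ₗ[MonoidAlgebra R G] W) (i : ι) :
    TrivMod R (H i) →ₗ[MonoidAlgebra R (H i)]
      Res (MonoidAlgebra R G) (MonoidAlgebra R (H i)) W :=
  invHom (W := Res (MonoidAlgebra R G) (MonoidAlgebra R (H i)) W)
    (f (permSingle R H ⟨i, ((1 : G) : G ⧸ H i)⟩ 1)) fun h =>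
      (res_single_smul (H i) h 1 _).trans (single_smul_apply_permSingle f i h h.2)

theorem toTrivHom_one (f : PermMod R H →ₗ[MonoidAlgebra R G] W) (i : ι) :
    toTrivHom f i (trivOne R (H i)) = f (permSingle R H ⟨i, ((1 : G) : G ⧸ H i)⟩ 1) :=
  invHom_one _ _

theorem exists_injective_embedding (M : Type u) [AddCommGroup M] [Module (MonoidAlgebra R G) M] :
    ∃ (J : Type u) (_ : AddCommGroup J) (_ : Module R J) (_ : Module.Injective R J)
      (f : M →ₗ[MonoidAlgebra R G] Coind (MonoidAlgebra R G) R J), Function.Injective f := by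
  obtain ⟨⟨J, _, f, _⟩⟩ := EnoughInjectives.presentation
    (ModuleCat.of R (Res (MonoidAlgebra R G) R M))
  have hf : Function.Injective f.hom := (ModuleCat.mono_iff_injective f).1 inferInstance
  refine ⟨J, inferInstance, inferInstance, Module.injective_module_of_injective_object R J,
    Coind.adj f.hom, fun x y h => hf ?_⟩
  have := congrArg (fun k : Coind (MonoidAlgebra R G) R J => k 1) h
  change f.hom ((1 : MonoidAlgebra R G) • x : M) = f.hom ((1 : MonoidAlgebra R G) • y : M) at this
  rwa [one_smul, one_smul] at this

/-- Shapiro's lemma. In degree zero, maps from the permutation module are families of Hᵢ-invariants.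
Higher degrees follow by embedding M in a module coinduced from an injective R-module, which is
injective over RG and over every RHᵢ. -/
theorem extZero_permMod (e : ℕ) : ∀ {M : Type u} [AddCommGroup M] [Module (MonoidAlgebra R G) M],
    (∀ i, ExtZero (MonoidAlgebra R (H i)) (TrivMod R (H i))
      (Res (MonoidAlgebra R G) (MonoidAlgebra R (H i)) M) e) →
    ExtZero (MonoidAlgebra R G) (PermMod R H) M e := by
  induction e with
  | zero =>
    intro M _ _ h
    rw [extZero_zero_iff]
    refine fun f => permMod_hom_ext fun i => ?_
    rw [← toTrivHom_one f i, extZero_zero_iff.1 (h i) (toTrivHom f i)]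
    rfl
  | succ e ih =>
    intro M _ _ h
    obtain ⟨J, _, _, _, f, hf⟩ := exists_injective_embedding (R := R) (G := G) M
    have hI := injective_coind (A := MonoidAlgebra R G) (B := R) J
    have hI' : ∀ i, Module.Injective (MonoidAlgebra R (H i)) (Res (MonoidAlgebra R G)
      (MonoidAlgebra R (H i)) (Coind (MonoidAlgebra R G) R J)) := fun i =>
        injective_res_coind (H i) J
    let g := (LinearMap.range f).mkQ
    have hg : Function.Surjective g := Submodule.mkQ_surjective _
    have hex : Function.Exact f g := LinearMap.exact_map_mkQ_range f
    cases e with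
    | zero =>
      refine extZero_one_of_lift hf hg hex (extZero_of_injective 0) fun k => ?_
      -- Vanishing of Ext¹ over each Hᵢ lifts invariants along the quotient map g, which is what
      -- lifting a map from the permutation module requires.
      have hl : ∀ i, ∃ n : Coind (MonoidAlgebra R G) R J,
          g n = k (permSingle R H ⟨i, ((1 : G) : G ⧸ H i)⟩ 1) ∧
          ∀ h ∈ H i, (MonoidAlgebra.single h 1 : MonoidAlgebra R G) • n = n := fun i => by
        obtain ⟨k', hk'⟩ := lift_of_extZero
          (f := Res.map (MonoidAlgebra R (H i)) f) (g := Res.map (MonoidAlgebra R (H i)) g)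
          hf hg hex (h i) (toTrivHom k i)
        refine ⟨k' (trivOne R (H i)), ?_, fun h hh => ?_⟩
        · exact (LinearMap.congr_fun hk' (trivOne R (H i))).trans (toTrivHom_one k i)
        · exact (res_single_smul (H i) ⟨h, hh⟩ 1 _).symm.trans
            (single_smul_apply_one k' ⟨h, hh⟩)
      choose n hn hn' using hl
      obtain ⟨k', hk'⟩ := exists_permMod_hom n hn'
      exact ⟨k', permMod_hom_ext fun i => by rw [LinearMap.comp_apply, hk', hn]⟩
    | succ e =>
      refine extZero_right_sub hf hg hex (ih fun i => ?_) (extZero_of_injective _)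
      exact extZero_right_quotient
        (f := Res.map (MonoidAlgebra R (H i)) f) (g := Res.map (MonoidAlgebra R (H i)) g)
        hf hg hex (extZero_of_injective _) (h i)

end Permutation


/-! ### Novikov vanishing for G and for the subgroups -/

section Restrict

variable {R G : Type u} [CommRing R] [Group G]

variable (R) in
/-- The restriction of the trivial module to a subgroup is trivial. -/
def resTrivEquiv (K : Subgroup G) :
    Res (MonoidAlgebra R G) (MonoidAlgebra R K) (TrivMod R G) ≃ₗ[MonoidAlgebra R K] TrivMod R K where
  toFun x := (trivEquiv R K).symm (trivEquiv R G x)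
  invFun y := (trivEquiv R G).symm (trivEquiv R K y)
  left_inv x := (congrArg (trivEquiv R G).symm ((trivEquiv R K).apply_symm_apply _)).trans
    ((trivEquiv R G).symm_apply_apply x)
  right_inv y := (congrArg (trivEquiv R K).symm ((trivEquiv R G).apply_symm_apply _)).trans
    ((trivEquiv R K).symm_apply_apply y)
  map_add' x y := (congrArg (trivEquiv R K).symm (map_add (trivEquiv R G) x y)).trans
    (map_add (trivEquiv R K).symm _ _)
  map_smul' b x := by
    rw [RingHom.id_apply]
    induction b using MonoidAlgebra.induction_linear with
    | zero =>
      rw [zero_smul, zero_smul]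
      exact (congrArg (trivEquiv R K).symm (map_zero (trivEquiv R G))).trans (map_zero _)
    | add b b' hb hb' =>
      rw [add_smul, add_smul, ← hb, ← hb']
      exact (congrArg (trivEquiv R K).symm (map_add (trivEquiv R G) _ _)).trans
        (map_add (trivEquiv R K).symm _ _)
    | single k r =>
      apply (trivEquiv R K).injective
      rw [trivEquiv_single_smul, AddEquiv.apply_symm_apply, AddEquiv.apply_symm_apply,
        res_single_smul]
      exact trivEquiv_single_smul (k : G) r x

/-- Transport of a projective resolution along an isomorphism of the resolved modules. -/
def ProjRes.congr {A : Type u} [Ring A] {L L' : Type u} [AddCommGroup L] [Module A L]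
    [AddCommGroup L'] [Module A L'] (C : ProjRes A L) (e : L ≃ₗ[A] L') : ProjRes A L' where
  X := C.X
  d := C.d
  ε := e.toLinearMap ∘ₗ C.ε
  proj := C.proj
  surj := e.surjective.comp C.surj
  exact_zero := fun x => (map_eq_zero_iff e e.injective).trans (C.exact_zero x)
  exact_succ := C.exact_succ

variable {φ : G →* Multiplicative ℤ} {M : Type u} [AddCommGroup M] [Module (MonoidAlgebra R G) M]

theorem extZero_trivMod (hφ : φ ≠ 1) {k : ℕ}
    (h : ModFP (MonoidAlgebra R φ.ker) k (TrivMod R φ.ker)) (hM : IsNovikov R φ M) (i : ℕ)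
    (hi : i ≤ k) : ExtZero (MonoidAlgebra R G) (TrivMod R G) M i := by
  obtain ⟨t, ht⟩ := exists_isGen hφ
  exact (groupLaurent R ht).extZero_of_modFP
    (L := Res (MonoidAlgebra R G) (MonoidAlgebra R φ.ker) (TrivMod R G))
    (h.congr (resTrivEquiv R φ.ker).symm) (hM t ht.ne_one) i hi

/-- The inclusion of the kernel of a restriction into the kernel. -/
def kerInclusion (φ : G →* Multiplicative ℤ) (H : Subgroup G) :
    (φ.comp H.subtype).ker →* φ.ker where
  toFun k := ⟨k, k.2⟩
  map_one' := rfl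
  map_mul' _ _ := rfl

/-- Matrices over the group ring of the smaller kernel are matrices over that of the larger one.
Here `IsNovikov` must involve every g outside the kernel: φ(H) may be a proper subgroup of φ(G), so
testing on t alone would not restrict. -/
theorem IsNovikov.res (hM : IsNovikov R φ M) (H : Subgroup G) :
    IsNovikov R (φ.comp H.subtype) (Res (MonoidAlgebra R G) (MonoidAlgebra R H) M) := by
  intro h hh m S
  have key := hM h hh m fun i k => MonoidAlgebra.mapDomainRingHom R (kerInclusion φ H) (S i k)
  have hS : ∀ (b : MonoidAlgebra R (φ.comp H.subtype).ker) (x : M),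
      ((b • (1 : MonoidAlgebra R H)) •
        (show Res (MonoidAlgebra R G) (MonoidAlgebra R H) M from x) : M) =
      ((MonoidAlgebra.mapDomainRingHom R (kerInclusion φ H) b) • (1 : MonoidAlgebra R G)) • x := by
    intro b x
    rw [Res.smul_def]
    refine congrArg (· • x) ?_
    rw [subgroupRing_smul_one, subgroupRing_smul_one, subgroupRing_smul_one]
    induction b using MonoidAlgebra.induction_linear with
    | zero => simp
    | add b b' hb hb' => simp only [map_add, hb, hb']
    | single k r =>
      simp only [MonoidAlgebra.mapDomainRingHom_apply, MonoidAlgebra.mapDomain_single]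
      rfl
  have hu : ∀ (g : H) (x : M), ((gUnit R g : MonoidAlgebra R H) •
      (show Res (MonoidAlgebra R G) (MonoidAlgebra R H) M from x) : M) =
        (gUnit R (g : G) : MonoidAlgebra R G) • x := fun g x => res_single_smul H g 1 x
  refine Eq.mp (congrArg (Function.Bijective (α := Fin m → M) (β := Fin m → M))
    (funext fun f => funext fun i => ?_)) key
  symm
  refine congrArg₂ (α := M) (β := M) (· - ·) (congrArg₂ (α := M) (β := M) (· + ·) (hu h (f i)) ?_)
    (Finset.sum_congr rfl fun k _ => hS _ _)
  rw [← map_inv, ← map_inv]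
  exact hu h⁻¹ (f i)

theorem extZero_permMod_of_modFP {ι : Type u} {H : ι → Subgroup G}
    (hφH : ∀ i, φ.comp (H i).subtype ≠ 1) {k : ℕ}
    (h : ∀ i, ModFP (MonoidAlgebra R (φ.comp (H i).subtype).ker) k
      (TrivMod R (φ.comp (H i).subtype).ker)) (hM : IsNovikov R φ M) (e : ℕ) (he : e ≤ k) :
    ExtZero (MonoidAlgebra R G) (PermMod R H) M e :=
  extZero_permMod e fun i => extZero_trivMod (hφH i) (h i) (hM.res (H i)) e he

end Restrict

/-! ### The module associated with a group pair -/

section Delta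

variable {R G : Type u} [CommRing R] [Group G] {ι : Type u} (H : ι → Subgroup G)

theorem augmentation_single {R X : Type*} [CommRing R] (x : X) (r : R) :
    augmentation R X (MonoidAlgebra.single x r) = r := by
  simp [augmentation]

/-- The augmentation of the permutation module. -/
def permAug : PermMod R H →ₗ[MonoidAlgebra R G] TrivMod R G where
  toFun v := (trivEquiv R G).symm (augmentation R (Σ i, G ⧸ H i)
    ((Representation.ofMulAction R G (Σ i, G ⧸ H i)).asModuleEquiv v))
  map_add' v w := by rw [map_add, map_add, map_add]
  map_smul' a v := by
    rw [RingHom.id_apply]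
    induction a using MonoidAlgebra.induction_linear with
    | zero => rw [zero_smul, zero_smul, map_zero, map_zero, map_zero]
    | add a a' h h' => rw [add_smul, add_smul, map_add, map_add, map_add, h, h']
    | single g r =>
      apply (trivEquiv R G).injective
      rw [trivEquiv_single_smul, AddEquiv.apply_symm_apply, AddEquiv.apply_symm_apply]
      refine permMod_induction (p := fun v => augmentation R (Σ i, G ⧸ H i)
        ((Representation.ofMulAction R G (Σ i, G ⧸ H i)).asModuleEquiv
          ((MonoidAlgebra.single g r : MonoidAlgebra R G) • v)) = r * augmentation R (Σ i, G ⧸ H i)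
        ((Representation.ofMulAction R G (Σ i, G ⧸ H i)).asModuleEquiv v)) v ?_
        (fun v w hv hw => ?_) fun x s => ?_
      · rw [smul_zero, map_zero, map_zero, mul_zero]
      · rw [smul_add, map_add, map_add, map_add, map_add, hv, hw, mul_add]
      · rw [single_smul_permSingle, permSingle, permSingle, LinearEquiv.apply_symm_apply,
          LinearEquiv.apply_symm_apply, augmentation_single, augmentation_single]

theorem permAug_surjective [Nonempty ι] : Function.Surjective (permAug (R := R) H) := by
  intro y
  obtain ⟨i⟩ := ‹Nonempty ι›
  refine ⟨permSingle R H ⟨i, (1 : G)⟩ (trivEquiv R G y), (trivEquiv R G).injective ?_⟩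
  change trivEquiv R G ((trivEquiv R G).symm _) = _
  rw [AddEquiv.apply_symm_apply, permSingle, LinearEquiv.apply_symm_apply, augmentation_single]

variable (R) in
/-- The associated module of a group pair as a module over the group ring. -/
abbrev DeltaMod : Type u := (assocModule R H).toRepresentation.asModule

/-- The inclusion of the associated module into the permutation module. -/
def deltaIncl : DeltaMod R H →ₗ[MonoidAlgebra R G] PermMod R H where
  toFun v := (Representation.ofMulAction R G (Σ i, G ⧸ H i)).asModuleEquiv.symm
    ((assocModule R H).toRepresentation.asModuleEquiv v).1
  map_add' v w := rfl
  map_smul' a v := by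
    rw [RingHom.id_apply]
    induction a using MonoidAlgebra.induction_linear with
    | zero => rw [zero_smul, zero_smul]; rfl
    | add a a' h h' => rw [add_smul, add_smul, ← h, ← h']; rfl
    | single g r =>
      rw [Representation.single_smul, Representation.single_smul]
      rfl

theorem deltaIncl_injective : Function.Injective (deltaIncl (R := R) H) := fun _ _ h =>
  Subtype.ext h

theorem exact_deltaIncl_permAug : Function.Exact (deltaIncl (R := R) H) (permAug H) := by
  intro v
  constructor
  · intro h
    exact ⟨⟨v, (trivEquiv R G).symm.injective (h.trans (map_zero _).symm)⟩, rfl⟩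
  · rintro ⟨w, rfl⟩
    exact (congrArg (trivEquiv R G).symm w.2).trans (map_zero _)

/-- From the augmentation sequence, Extᵉ of the kernel vanishes when Extᵉ of the permutation module
and Extᵉ⁺¹ of R do. Hence one more degree of finiteness is needed for the kernel of φ. -/
theorem extZero_delta [Nonempty ι] {φ : G →* Multiplicative ℤ} (hφ : φ ≠ 1)
    (hφH : ∀ i, φ.comp (H i).subtype ≠ 1) {k k' : ℕ}
    (h : ModFP (MonoidAlgebra R φ.ker) (k + 1) (TrivMod R φ.ker)) (hk : k ≤ k')
    (h' : ∀ i, ModFP (MonoidAlgebra R (φ.comp (H i).subtype).ker) k'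
      (TrivMod R (φ.comp (H i).subtype).ker)) {M : Type u} [AddCommGroup M]
    [Module (MonoidAlgebra R G) M] (hM : IsNovikov R φ M) (e : ℕ) (he : e ≤ k) :
    ExtZero (MonoidAlgebra R G) (DeltaMod R H) M e :=
  extZero_sub (deltaIncl_injective H) (permAug_surjective H) (exact_deltaIncl_permAug H)
    (extZero_permMod_of_modFP hφH h' hM e (he.trans hk))
    (extZero_trivMod hφ h hM (e + 1) (Nat.succ_le_succ he))

end Delta


/-! ### Cohomology with coefficients in the group ring -/

section RegularClass

variable {R G : Type u} [CommRing R] [Group G]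

/-- The cocycles with values in the group ring, as cocycles with values in the regular
representation. -/
def toRegularCocycle (C : ProjRes (MonoidAlgebra R G) (TrivMod R G)) (i : ℕ) :
    C.cocycles (MonoidAlgebra R G) i ≃+ C.cocycles (Rep.leftRegular R G).ρ.asModule i where
  toFun := C.cocyclesMap (Representation.ofMulActionSelfAsModuleEquiv (k := R) (G := G)).symm i
  invFun := C.cocyclesMap (M := (Representation.ofMulAction R G G).asModule)
    (Representation.ofMulActionSelfAsModuleEquiv (k := R) (G := G)).toLinearMap i
  left_inv _ := rfl
  right_inv _ := rfl
  map_add' _ _ := rfl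

/-- The classes in `Hⁱ(G; RG)` of the cocycles with values in the group ring. -/
theorem exists_regularClass (C : ProjRes (MonoidAlgebra R G) (TrivMod R G)) (i : ℕ) :
    ∃ c : C.cocycles (MonoidAlgebra R G) i →+ groupCohomology (Rep.leftRegular R G) i,
      Function.Surjective c ∧ (∀ z, c z = 0 ↔ C.IsCobdry i z.1) ∧
      ∀ (g : G) (r : R) z, c (C.cocyclesMap (LinearMap.mulRight (MonoidAlgebra R G)
        (MonoidAlgebra.single g⁻¹ r)) i z) = r • cohomologyRep R G i g (c z) := by
  obtain ⟨cls, h1, h2, h3, h4⟩ := exists_cocycleClass C i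
  refine ⟨(cls (Rep.leftRegular R G)).comp (toRegularCocycle C i).toAddMonoidHom,
    (h1 _).comp (toRegularCocycle C i).surjective, fun z => ?_, fun g r z => ?_⟩
  · refine (h2 _ _).trans ?_
    rw [C.isCobdry_iff, C.isCobdry_iff]
    constructor
    · rintro ⟨y, hy⟩
      refine ⟨(Representation.ofMulActionSelfAsModuleEquiv (k := R) (G := G)).toLinearMap ∘ₗ
        (show C.Xp i →ₗ[MonoidAlgebra R G] (Representation.ofMulAction R G G).asModule from y), ?_⟩
      exact LinearMap.ext fun x => LinearMap.congr_fun hy x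
    · rintro ⟨y, hy⟩
      refine ⟨(Representation.ofMulActionSelfAsModuleEquiv (k := R) (G := G)).symm.toLinearMap ∘ₗ y, ?_⟩
      exact LinearMap.ext fun x => LinearMap.congr_fun hy x
  · refine (h4 (Rep.leftRegular R G) r (C.cocyclesMap (Rep.toModuleMonoidAlgebra.map
      (rightMulInv R G g)).hom i (toRegularCocycle C i z)) _ fun x => ?_).trans
      (congrArg (r • ·) (h3 _ _ (rightMulInv R G g) (toRegularCocycle C i z)))
    change (z.1 x * MonoidAlgebra.single g⁻¹ r : MonoidAlgebra R G) =
      r • (z.1 x * MonoidAlgebra.single g⁻¹ 1 : MonoidAlgebra R G)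
    rw [← mul_smul_comm, MonoidAlgebra.smul_single', mul_one]

theorem homExact_iff_subsingleton (C : ProjRes (MonoidAlgebra R G) (TrivMod R G)) (i : ℕ) :
    C.HomExact (MonoidAlgebra R G) i ↔
      Subsingleton (groupCohomology (Rep.leftRegular R G) i) := by
  obtain ⟨c, h1, h2, -⟩ := exists_regularClass C i
  constructor
  · intro h
    refine subsingleton_of_forall_eq 0 fun x => ?_
    obtain ⟨z, rfl⟩ := h1 x
    exact (h2 z).2 (h z.1 z.2)
  · intro h f hf
    exact (h2 ⟨f, hf⟩).1 (Subsingleton.elim _ _)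

/-- The antipode makes g act on the dual complex by right multiplication by g⁻¹, which is the action
defining `cohomologyRep`. So the duality argument sees the given module structure. -/
theorem nonempty_kerDualCokerMap_equiv (C : ProjRes (MonoidAlgebra R G) (TrivMod R G)) (i : ℕ) :
    Nonempty ((cohomologyRep R G i).asModule ≃ₗ[MonoidAlgebra R G]
      LinearMap.ker (dualCokerMap (antipode R G) C i)) := by
  obtain ⟨c, h1, h2, h3⟩ := exists_regularClass C i
  let toC : LinearMap.ker (DualMod.map (τ := antipode R G) (C.d i)) →+
      C.cocycles (MonoidAlgebra R G) i :=
    { toFun := fun z => ⟨z.1, z.2⟩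
      map_zero' := rfl
      map_add' := fun _ _ => rfl }
  let f : LinearMap.ker (DualMod.map (τ := antipode R G) (C.d i)) →+
      (cohomologyRep R G i).asModule :=
    (cohomologyRep R G i).asModuleEquiv.symm.toAddEquiv.toAddMonoidHom.comp (c.comp toC)
  let c' : LinearMap.ker (DualMod.map (τ := antipode R G) (C.d i)) →ₗ[MonoidAlgebra R G]
      (cohomologyRep R G i).asModule :=
    { toFun := f
      map_add' := map_add f
      map_smul' := fun a z => by
        rw [RingHom.id_apply]
        induction a using MonoidAlgebra.induction_linear with
        | zero => rw [zero_smul, zero_smul, map_zero]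
        | add a b ha hb => rw [add_smul, add_smul, map_add, ha, hb]
        | single g r =>
          rw [Representation.single_smul]
          refine congrArg (cohomologyRep R G i).asModuleEquiv.symm
            (Eq.trans (congrArg c (Subtype.ext (LinearMap.ext fun x => ?_))) (h3 g r (toC z)))
          exact congrArg (fun y : (MonoidAlgebra R G)ᵐᵒᵖ => z.1 x * y.unop) (antipode_single g r) }
  refine ⟨kerDualCokerMapEquiv (antipode R G) C c' (fun x => ?_) fun z => ?_⟩
  · obtain ⟨z, hz⟩ := h1 ((cohomologyRep R G i).asModuleEquiv x)
    exact ⟨⟨z.1, z.2⟩, (congrArg (cohomologyRep R G i).asModuleEquiv.symm hz).trans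
      (LinearEquiv.symm_apply_apply _ x)⟩
  · exact ((cohomologyRep R G i).asModuleEquiv.symm.map_eq_zero_iff (x := c (toC z))).trans
      (h2 (toC z))

/-- Equivalent representations give isomorphic modules over the group ring. -/
def asModuleCongr {V W : Type*} [AddCommMonoid V] [Module R V] [AddCommMonoid W] [Module R W]
    {ρ : Representation R G V} {σ : Representation R G W} (e : ρ.Equiv σ) :
    ρ.asModule ≃ₗ[MonoidAlgebra R G] σ.asModule :=
  let f : ρ.asModule ≃+ σ.asModule :=
    (ρ.asModuleEquiv.toAddEquiv.trans e.toLinearEquiv.toAddEquiv).trans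
      σ.asModuleEquiv.symm.toAddEquiv
  { f with
    map_smul' := fun a v => by
      rw [RingHom.id_apply]
      induction a using MonoidAlgebra.induction_linear with
      | zero => rw [zero_smul, zero_smul]; exact map_zero f
      | add a b ha hb => rw [add_smul, add_smul, ← ha, ← hb]; exact map_add f _ _
      | single g r =>
        rw [Representation.single_smul, Representation.single_smul]
        refine congrArg σ.asModuleEquiv.symm ((map_smul e.toLinearEquiv r _).trans
          (congrArg (r • ·) ?_))
        exact LinearMap.congr_fun (e.isIntertwining' g) (ρ.asModuleEquiv v) }

end RegularClass

/-! ### Finiteness and cohomology of the kernel -/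

section Kernel

variable {R G : Type u} [CommRing R] [Group G] {φ : G →* Multiplicative ℤ}

/-- Vanishing Novikov cohomology gives type FP_k for every k. The length is bounded because C stays
a projective resolution over the group ring of the kernel, over which RG is free. -/
theorem isFP_ker (hφ : φ ≠ 1) (C : ProjRes (MonoidAlgebra R G) (TrivMod R G))
    (hC : ∀ i, Module.Finite (MonoidAlgebra R G) (C.X i)) {N : ℕ}
    (hN : ∀ i, N < i → Subsingleton (C.X i))
    (hv : ∀ (M : Type u) [AddCommGroup M] [Module (MonoidAlgebra R G) M], IsNovikov R φ M →
      ∀ i, C.HomExact M i) : IsFP R φ.ker := by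
  obtain ⟨t, ht⟩ := exists_isGen hφ
  have := free_groupRing (R := R) hφ
  have h1 : ∀ k, ModFP (MonoidAlgebra R φ.ker) k
      (Res (MonoidAlgebra R G) (MonoidAlgebra R φ.ker) (TrivMod R G)) := fun k =>
    (groupLaurent R ht).modFP_of_extZero_nov
      (L := Res (MonoidAlgebra R G) (MonoidAlgebra R φ.ker) (TrivMod R G))
      (fun j => modFP_of_projRes C fun i _ => hC i)
      (fun s N _ _ i => (ProjRes.homExact_iff _ i C).1 (hv _ (isNovikov_nov ht s N) i))
  obtain ⟨D, hD, hD'⟩ := exists_finite_projRes N h1 fun M _ _ i hi => by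
    refine (ProjRes.homExact_iff M i (C.res (MonoidAlgebra R φ.ker))).1 fun f _ => ?_
    have : Subsingleton ((C.res (MonoidAlgebra R φ.ker)).X i) := hN i hi
    have h0 : f = 0 := LinearMap.ext fun x => by
      rw [Subsingleton.elim x 0, map_zero, map_zero]
    rw [h0, ProjRes.isCobdry_iff]
    exact ⟨0, (LinearMap.zero_comp _).symm⟩
  exact isFP_of_projRes (D.congr (resTrivEquiv R φ.ker)) hD N hD'

theorem exists_cohomology_shift (hφ : φ ≠ 1) (C : ProjRes (MonoidAlgebra R G) (TrivMod R G))
    (hv : ∀ (M : Type u) [AddCommGroup M] [Module (MonoidAlgebra R G) M], IsNovikov R φ M →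
      ∀ i, C.HomExact M i) (i : ℕ) :
    ∃ e : groupCohomology (Rep.leftRegular R φ.ker) i ≃ₗ[R]
        groupCohomology (Rep.leftRegular R G) (i + 1),
      ∀ k x, e (cohomologyRep R φ.ker i k x) = cohomologyRep R G (i + 1) k (e x) := by
  obtain ⟨t, ht⟩ := exists_isGen hφ
  have := free_groupRing (R := R) hφ
  obtain ⟨q, q1, q2, q3⟩ := exists_regularClass C (i + 1)
  obtain ⟨p, p1, p2, p3⟩ := exists_regularClass
    ((C.res (MonoidAlgebra R φ.ker)).congr (resTrivEquiv R φ.ker)) i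
  have hp : ∀ z, p z = 0 ↔ (C.res (MonoidAlgebra R φ.ker)).IsCobdry i z.1 := fun z => by
    refine (p2 z).trans ?_
    cases i <;> exact Iff.rfl
  obtain ⟨e, he⟩ := (groupLaurent R ht).exists_shift C
    (fun s i => hv _ (isNovikov_nov ht s _) i) i p q p1 q1 hp q2
  -- Right multiplication by the element r k⁻¹ of the group ring induces the scalar r together with
  -- the action of k. Setting k = 1 or r = 1 separates the two.
  have key : ∀ (r : R) (k : φ.ker) x, e (r • cohomologyRep R φ.ker i k x) =
      r • cohomologyRep R G (i + 1) k (e x) := fun r k =>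
    he (MonoidAlgebra.single k⁻¹ r) (fun x => r • cohomologyRep R φ.ker i k x)
      (fun y => r • cohomologyRep R G (i + 1) k y) (p3 k r) fun w => by
        rw [MonoidAlgebra.one_def, single_smul_single, mul_one, mul_one]
        exact q3 k r w
  refine ⟨{ e with map_smul' := fun r x => ?_ }, fun k x => ?_⟩
  · have := key r 1 x
    rw [map_one, Subgroup.coe_one, map_one] at this
    exact this
  · have := key 1 k x
    rw [one_smul, one_smul] at this
    exact this

end Kernel


/-! ### Vanishing of Novikov cohomology in all degrees -/

section Vanishing

variable {R G : Type u} [CommRing R] [Group G] {φ : G →* Multiplicative ℤ}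

/-- Degrees i ≤ k are covered by finiteness of the kernel and degrees i ≥ d - k' by duality. The
hypothesis d ≤ k + k' + 1 says that no degree lies between. -/
theorem homExact_of_isNovikov (hφ : φ ≠ 1) (C : ProjRes (MonoidAlgebra R G) (TrivMod R G))
    (hC : ∀ i, Module.Finite (MonoidAlgebra R G) (C.X i)) {N : ℕ}
    (hN : ∀ i, N < i → Subsingleton (C.X i)) {d k k' : ℕ}
    (hex : ∀ j, j ≠ d → C.HomExact (MonoidAlgebra R G) j)
    (hK : ModFP (MonoidAlgebra R φ.ker) k (TrivMod R φ.ker))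
    {L : Type u} [AddCommGroup L] [Module (MonoidAlgebra R G) L]
    (c : (cohomologyRep R G d).asModule ≃ₗ[MonoidAlgebra R G] L)
    (hL : ∀ (M : Type u) [AddCommGroup M] [Module (MonoidAlgebra R G) M], IsNovikov R φ M →
      ∀ e ≤ k', ExtZero (MonoidAlgebra R G) L M e) (hd : d ≤ k + k' + 1)
    (M : Type u) [AddCommGroup M] [Module (MonoidAlgebra R G) M] (hM : IsNovikov R φ M) (i : ℕ) :
    C.HomExact M i := by
  by_cases hi : i ≤ k
  · exact (ProjRes.homExact_iff M i C).2 (extZero_trivMod hφ hK hM i hi)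
  · obtain ⟨c'⟩ := nonempty_kerDualCokerMap_equiv C d
    exact homExact_of_duality (antipode R G) C hC hN hex (c.symm.trans c')
      (hL (CharMod (antipode R G) M) hM.charMod) i (by omega)

/-- H⁰(G; RG) embeds in H⁰ with Novikov coefficients, which vanishes. If the other degrees vanished
too, the dual complex would be acyclic and duality with L₀ = 0 would kill Hom(R, R), contradicting R
≠ 0. -/
theorem not_homExact_ne_zero [Nontrivial R] (hφ : φ ≠ 1)
    (C : ProjRes (MonoidAlgebra R G) (TrivMod R G))
    (hC : ∀ i, Module.Finite (MonoidAlgebra R G) (C.X i)) {N : ℕ}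
    (hN : ∀ i, N < i → Subsingleton (C.X i)) {k : ℕ}
    (hK : ModFP (MonoidAlgebra R φ.ker) k (TrivMod R φ.ker)) :
    ¬ ∀ j, j ≠ 0 → C.HomExact (MonoidAlgebra R G) j := by
  intro hex
  obtain ⟨t, ht⟩ := exists_isGen hφ
  have h0 := (groupLaurent R ht).homExact_zero C ((ProjRes.homExact_iff _ 0 C).2
    (extZero_trivMod hφ hK (isNovikov_nov ht 1 _) 0 (Nat.zero_le k)))
  have := subsingleton_ker_dualCokerMap (antipode R G) C h0
  let c : PUnit.{u + 1} ≃ₗ[MonoidAlgebra R G] LinearMap.ker (dualCokerMap (antipode R G) C 0) :=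
    { toFun := fun _ => 0
      invFun := fun _ => PUnit.unit
      left_inv := fun _ => rfl
      right_inv := fun _ => Subsingleton.elim _ _
      map_add' := fun _ _ => (add_zero 0).symm
      map_smul' := fun a _ => (smul_zero a).symm }
  have h1 := homExact_of_duality (M := TrivMod R G) (k := 0) (antipode R G) C hC hN hex c
    (fun e _ => extZero_of_subsingleton e) 0 le_rfl
  have h2 := extZero_zero_iff.1 ((ProjRes.homExact_iff _ 0 C).1 h1) LinearMap.id
  have h3 : trivOne R G = 0 := LinearMap.congr_fun h2 (trivOne R G)
  exact one_ne_zero (α := R) ((trivEquiv R G).symm.injective (h3.trans (map_zero _).symm))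

/-- Passage from the cohomology of `G` to the cohomology of the kernel of `φ`. -/
theorem exists_cohomology_ker [Nontrivial R] (hφ : φ ≠ 1) (hFP : IsFP R G) {d k k' : ℕ}
    (hex : ∀ j, j ≠ d → Subsingleton (groupCohomology (Rep.leftRegular R G) j))
    (hK : ModFP (MonoidAlgebra R φ.ker) k (TrivMod R φ.ker))
    {L : Type u} [AddCommGroup L] [Module (MonoidAlgebra R G) L]
    (c : (cohomologyRep R G d).asModule ≃ₗ[MonoidAlgebra R G] L)
    (hL : d ≠ 0 → ∀ (M : Type u) [AddCommGroup M] [Module (MonoidAlgebra R G) M], IsNovikov R φ M →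
      ∀ e ≤ k', ExtZero (MonoidAlgebra R G) L M e) (hd : d ≤ k + k' + 1) :
    IsFP R φ.ker ∧ ∃ m, d = m + 1 ∧
      (∀ i, i ≠ m → Subsingleton (groupCohomology (Rep.leftRegular R φ.ker) i)) ∧
      ∃ e : groupCohomology (Rep.leftRegular R φ.ker) m ≃ₗ[R]
          groupCohomology (Rep.leftRegular R G) d,
        ∀ k x, e (cohomologyRep R φ.ker m k x) = cohomologyRep R G d k (e x) := by
  obtain ⟨C, hC, N, hN⟩ := exists_projRes_of_isFP hFP
  have hex' : ∀ j, j ≠ d → C.HomExact (MonoidAlgebra R G) j := fun j hj =>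
    (homExact_iff_subsingleton C j).2 (hex j hj)
  -- Excluding d = 0 makes the degree shift possible, and is the reason why `hL` is only required
  -- for d ≠ 0.
  obtain - | m := d
  · exact absurd hex' (not_homExact_ne_zero hφ C hC hN hK)
  have hv := fun (M : Type u) [AddCommGroup M] [Module (MonoidAlgebra R G) M] =>
    homExact_of_isNovikov hφ C hC hN hex' hK c (hL m.succ_ne_zero) hd M
  refine ⟨isFP_ker hφ C hC hN hv, m, rfl, fun i hi => ?_, exists_cohomology_shift hφ C hv m⟩
  obtain ⟨e, -⟩ := exists_cohomology_shift hφ C hv i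
  have := hex (i + 1) (by omega)
  exact e.toEquiv.subsingleton

theorem exists_cohomology_ker_pair [Nontrivial R] (hφ : φ ≠ 1) (hFP : IsFP R G) {ι : Type u}
    [Nonempty ι] (H : ι → Subgroup G) (hφH : ∀ i, φ.comp (H i).subtype ≠ 1) {d : ℕ}
    (hex : ∀ j, j ≠ d → Subsingleton (groupCohomology (Rep.leftRegular R G) j))
    (hK : ModFP (MonoidAlgebra R φ.ker) ((d + 1) / 2) (TrivMod R φ.ker))
    (hK' : ∀ i, ModFP (MonoidAlgebra R (φ.comp (H i).subtype).ker) (d / 2)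
      (TrivMod R (φ.comp (H i).subtype).ker))
    (c : (cohomologyRep R G d).Equiv (assocModule R H).toRepresentation) :
    IsFP R φ.ker ∧ ∃ m, d = m + 1 ∧
      (∀ i, i ≠ m → Subsingleton (groupCohomology (Rep.leftRegular R φ.ker) i)) ∧
      ∃ e : groupCohomology (Rep.leftRegular R φ.ker) m ≃ₗ[R]
          groupCohomology (Rep.leftRegular R G) d,
        ∀ k x, e (cohomologyRep R φ.ker m k x) = cohomologyRep R G d k (e x) := by
  -- Here d = n - 1 and k = ⌊n/2⌋; the augmentation sequence costs one degree, so k' = k - 1. The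
  -- truncated subtraction matters only at d = 0, where no Ext vanishing is asked for.
  refine exists_cohomology_ker (k' := (d + 1) / 2 - 1) (L := DeltaMod R H) hφ hFP hex hK
    (asModuleCongr c) (fun hd0 M _ _ hM i hi => ?_) (by omega)
  obtain ⟨k, hk⟩ : ∃ k, (d + 1) / 2 = k + 1 := ⟨(d + 1) / 2 - 1, by omega⟩
  rw [hk] at hK
  exact extZero_delta H hφ hφH hK (k' := d / 2) (by omega) hK' hM i (by omega)

end Vanishing

/-! ### Equivariant transport and the size of the index type -/

section Reindex

/-- Composition of isomorphisms that are equivariant along a homomorphism of groups. -/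
theorem nonempty_equiv_of_equivariant {R K G V W X Y : Type*} [CommRing R] [Group K] [Group G]
    [AddCommMonoid V] [Module R V] [AddCommMonoid W] [Module R W] [AddCommMonoid X] [Module R X]
    [AddCommMonoid Y] [Module R Y] {ρ : Representation R K V} {σ : Representation R G W}
    {τ : Representation R G X} {π : Representation R K Y} (f : K →* G) (e : V ≃ₗ[R] W)
    (he : ∀ k v, e (ρ k v) = σ (f k) (e v)) (c : σ.Equiv τ) (E : Y ≃ₗ[R] X)
    (hE : ∀ k y, E (π k y) = τ (f k) (E y)) : Nonempty (ρ.Equiv π) := by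
  refine ⟨Representation.Equiv.mk ((e.trans c.toLinearEquiv).trans E.symm) fun k =>
    LinearMap.ext fun v => E.injective ?_⟩
  have h1 : c.toLinearEquiv (σ (f k) (e v)) = τ (f k) (c.toLinearEquiv (e v)) :=
    LinearMap.congr_fun (c.isIntertwining' (f k)) (e v)
  change E (E.symm (c.toLinearEquiv (e (ρ k v)))) = E (π k (E.symm (c.toLinearEquiv (e v))))
  rw [hE, E.apply_symm_apply, E.apply_symm_apply, he, h1]

variable (R : Type*) [CommRing R] {G K : Type*} [Group G] [Group K] {ι κ : Type*}

/-- An equivariant bijection of coset spaces induces an isomorphism of the associated modules. -/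
theorem exists_assocModule_equiv (f : K →* G) (H : ι → Subgroup G) (S : κ → Subgroup K)
    (e : (Σ p, K ⧸ S p) ≃ (Σ i, G ⧸ H i)) (he : ∀ (k : K) y, e (k • y) = f k • e y) :
    ∃ E : (assocModule R S).toSubmodule ≃ₗ[R] (assocModule R H).toSubmodule,
      ∀ k v, E ((assocModule R S).toRepresentation k v) =
        (assocModule R H).toRepresentation (f k) (E v) := by
  let E₀ := MonoidAlgebra.mapDomainLinearEquiv R R e
  have haug : augmentation R (Σ i, G ⧸ H i) ∘ₗ E₀.toLinearMap = augmentation R (Σ p, K ⧸ S p) := by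
    refine MonoidAlgebra.lhom_ext' fun x => LinearMap.ext_ring ?_
    change augmentation R (Σ i, G ⧸ H i) (E₀ (MonoidAlgebra.single x 1)) =
      augmentation R (Σ p, K ⧸ S p) (MonoidAlgebra.single x 1)
    rw [MonoidAlgebra.mapDomainLinearEquiv_single, augmentation_single, augmentation_single]
  have hmap : (assocModule R S).toSubmodule.map E₀.toLinearMap = (assocModule R H).toSubmodule := by
    change (LinearMap.ker (augmentation R (Σ p, K ⧸ S p))).map E₀.toLinearMap =
      LinearMap.ker (augmentation R (Σ i, G ⧸ H i))
    rw [← haug, LinearMap.ker_comp]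
    exact Submodule.map_comap_eq_of_surjective E₀.surjective _
  have hact : ∀ k, E₀.toLinearMap ∘ₗ Representation.ofMulAction R K (Σ p, K ⧸ S p) k =
      Representation.ofMulAction R G (Σ i, G ⧸ H i) (f k) ∘ₗ E₀.toLinearMap := fun k => by
    refine MonoidAlgebra.lhom_ext' fun x => LinearMap.ext_ring ?_
    change E₀ (Representation.ofMulAction R K (Σ p, K ⧸ S p) k (MonoidAlgebra.single x 1)) =
      Representation.ofMulAction R G (Σ i, G ⧸ H i) (f k) (E₀ (MonoidAlgebra.single x 1))
    rw [Representation.ofMulAction_single, MonoidAlgebra.mapDomainLinearEquiv_single,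
      MonoidAlgebra.mapDomainLinearEquiv_single, Representation.ofMulAction_single, he]
  exact ⟨E₀.ofSubmodules _ _ hmap, fun k v => Subtype.ext (LinearMap.congr_fun (hact k) v.1)⟩

theorem exists_assocModule_reindex (H : ι → Subgroup G) (e : κ ≃ ι) :
    Nonempty ((assocModule R (H ∘ e)).toRepresentation.Equiv (assocModule R H).toRepresentation) := by
  obtain ⟨E, hE⟩ := exists_assocModule_equiv R (MonoidHom.id G) H (H ∘ e)
    (Equiv.sigmaCongrLeft (β := fun i => G ⧸ H i) e) fun k y => rfl
  exact ⟨Representation.Equiv.mk E fun k => LinearMap.ext fun v => hE k v⟩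

/-- The differences of base cosets bᵢ - b_{i₀} lie in the associated module and are distinct. This
moves the tuple into the universe of G, where the Ext arguments take place. -/
theorem small_of_assocModule [Nontrivial R] (H : ι → Subgroup G) {V : Type u}
    (e : (assocModule R H).toSubmodule ≃ V) : Small.{u} ι := by
  by_cases hι : Nonempty ι
  · obtain ⟨i₀⟩ := hι
    let b : ι → MonoidAlgebra R (Σ i, G ⧸ H i) := fun i =>
      MonoidAlgebra.single ⟨i, ((1 : G) : G ⧸ H i)⟩ 1
    let f : ι → (assocModule R H).toSubmodule := fun i => ⟨b i - b i₀, by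
      change augmentation R (Σ i, G ⧸ H i) (b i - b i₀) = 0
      rw [map_sub, augmentation_single, augmentation_single, sub_self]⟩
    refine small_of_injective (f := fun i => e (f i)) fun i j h => ?_
    have h1 : b i = b j := sub_left_injective (congrArg Subtype.val (e.injective h))
    have h2 := MonoidAlgebra.single_left_injective (one_ne_zero (α := R)) h1
    exact congrArg Sigma.fst h2
  · have := not_nonempty_iff.1 hι
    exact small_of_injective (β := PUnit.{u + 1}) (f := fun _ => PUnit.unit)
      (Function.injective_of_subsingleton _)

end Reindex

/-! ### Orbits of K on the coset spaces -/

section Cosets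

variable {G : Type*} [Group G] {ι : Type*} (H : ι → Subgroup G) (K : Subgroup G)
  (x : ∀ i, DoubleCoset.Quotient (H i : Set G) (K : Set G) → G)

theorem mem_restrictTuple (p : Σ i, DoubleCoset.Quotient (H i : Set G) (K : Set G)) (k : K) :
    k ∈ restrictTuple H K x p ↔ x p.1 p.2 * k * (x p.1 p.2)⁻¹ ∈ H p.1 := by
  rw [restrictTuple, Subgroup.mem_subgroupOf, Subgroup.mem_map]
  constructor
  · rintro ⟨h, hh, h'⟩
    rw [← h']
    simpa [mul_assoc] using hh
  · intro h
    exact ⟨_, h, by simp [mul_assoc]⟩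

/-- The decomposition of the coset spaces of `G` into orbits of `K`. -/
def orbitMap (y : Σ p, K ⧸ restrictTuple H K x p) : Σ i, G ⧸ H i :=
  ⟨y.1.1, Quotient.lift (s := QuotientGroup.leftRel (restrictTuple H K x y.1))
    (fun k : K => (((k : G) * (x y.1.1 y.1.2)⁻¹ : G) : G ⧸ H y.1.1))
    (fun a b hab => by
      have h := (mem_restrictTuple H K x y.1 _).1 (QuotientGroup.leftRel_apply.1 hab)
      refine QuotientGroup.eq.2 ?_
      simpa [mul_assoc] using h) y.2⟩

theorem orbitMap_mk (p : Σ i, DoubleCoset.Quotient (H i : Set G) (K : Set G)) (k : K) :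
    orbitMap H K x ⟨p, (k : K ⧸ restrictTuple H K x p)⟩ =
      ⟨p.1, (((k : G) * (x p.1 p.2)⁻¹ : G) : G ⧸ H p.1)⟩ := rfl

theorem orbitMap_smul (k : K) (y : Σ p, K ⧸ restrictTuple H K x p) :
    orbitMap H K x (k • y) = (k : G) • orbitMap H K x y := by
  obtain ⟨p, q⟩ := y
  obtain ⟨a, rfl⟩ := QuotientGroup.mk_surjective q
  refine congrArg (Sigma.mk p.1) ?_
  change ((((k * a : K) : G) * (x p.1 p.2)⁻¹ : G) : G ⧸ H p.1) =
    (((k : G) * ((a : G) * (x p.1 p.2)⁻¹) : G) : G ⧸ H p.1)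
  rw [Subgroup.coe_mul, mul_assoc]

/-- Inversion matches the K-orbits on G/Hᵢ with the double cosets in Hᵢ\G/K. The stabiliser in K of
the coset x⁻¹Hᵢ is x⁻¹Hᵢx ∩ K, the corresponding member of `restrictTuple`. -/
theorem orbitMap_bijective (hx : ∀ i q, DoubleCoset.mk (H i) K (x i q) = q) :
    Function.Bijective (orbitMap H K x) := by
  constructor
  · rintro ⟨⟨i, q⟩, a⟩ ⟨⟨i', q'⟩, a'⟩ h
    obtain ⟨a, rfl⟩ := QuotientGroup.mk_surjective a
    obtain ⟨a', rfl⟩ := QuotientGroup.mk_surjective a'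
    rw [orbitMap_mk, orbitMap_mk] at h
    obtain rfl : i = i' := congrArg Sigma.fst h
    have h1 := QuotientGroup.eq.1 (eq_of_heq (Sigma.mk.inj_iff.1 h).2)
    dsimp only at h1
    obtain rfl : q = q' := by
      rw [← hx i q, ← hx i q']
      refine ((DoubleCoset.eq _ _ _ _).2 ⟨_, (H i).inv_mem h1, _, (a⁻¹ * a' : K).2, ?_⟩)
      simp [mul_assoc]
    refine congrArg (Sigma.mk _) (QuotientGroup.eq.2 ((mem_restrictTuple H K x _ _).2 ?_))
    simpa [mul_assoc] using h1
  · rintro ⟨i, g⟩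
    obtain ⟨g, rfl⟩ := QuotientGroup.mk_surjective g
    -- The coset of g lies in the orbit indexed by the double coset of g⁻¹.
    obtain ⟨h, hh, k, hk, e⟩ := (DoubleCoset.eq _ _ _ _).1 (hx i (DoubleCoset.mk (H i) K g⁻¹))
    refine ⟨⟨⟨i, DoubleCoset.mk (H i) K g⁻¹⟩, ((⟨k⁻¹, K.inv_mem hk⟩ : K) : K ⧸ restrictTuple H K x _)⟩, ?_⟩
    rw [orbitMap_mk]
    refine congrArg (Sigma.mk i) (QuotientGroup.eq.2 ?_)
    have : g = k⁻¹ * (x i (DoubleCoset.mk (H i) K g⁻¹))⁻¹ * h⁻¹ := by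
      rw [← inv_inj]
      exact e.trans (by simp [mul_assoc])
    dsimp only
    generalize x i (DoubleCoset.mk (H i) K g⁻¹) = y at *
    rw [this]
    simpa [mul_assoc] using hh

theorem exists_assocModule_restrict (R : Type*) [CommRing R]
    (hx : ∀ i q, DoubleCoset.mk (H i) K (x i q) = q) :
    ∃ E : (assocModule R (restrictTuple H K x)).toSubmodule ≃ₗ[R] (assocModule R H).toSubmodule,
      ∀ (k : K) v, E ((assocModule R (restrictTuple H K x)).toRepresentation k v) =
        (assocModule R H).toRepresentation (k : G) (E v) :=
  exists_assocModule_equiv R K.subtype H _ (Equiv.ofBijective _ (orbitMap_bijective H K x hx))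
    (orbitMap_smul H K x)

end Cosets

end PDPair

end

/-! ### The theorem -/

theorem mainTheorem8 {R G : Type u} [CommRing R] [Nontrivial R] [Group G]
    {ι : Type v} (H : ι → Subgroup G) (n : ℤ)
    (hPD : PDPair.IsOrientablePDPair R H n)
    (φ : G →* Multiplicative ℤ) (hφ : φ ≠ 1)
    (hφH : ∀ i, φ.comp (H i).subtype ≠ 1)
    (hker : PDPair.IsFPn R φ.ker (n / 2))
    (hkerH : ∀ i, PDPair.IsFPn R (φ.comp (H i).subtype).ker ((n - 1) / 2))
    (x : ∀ i, DoubleCoset.Quotient (H i : Set G) (φ.ker : Set G) → G)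
    (hx : ∀ i q, DoubleCoset.mk (H i) φ.ker (x i q) = q) :
    PDPair.IsOrientablePDPair R (PDPair.restrictTuple H φ.ker x) (n - 1) := by
  constructor
  · intro hι
    -- Double coset spaces are non-empty, so the restricted tuple is empty only if the original one
    -- is.
    have : IsEmpty ι := ⟨fun i => hι.false ⟨i, DoubleCoset.mk (H i) φ.ker 1⟩⟩
    obtain ⟨hFP, d, rfl, hex, ⟨c⟩⟩ := hPD.1 this
    -- With L₀ = R, the same finiteness serves for k and k', and d ≤ 2⌊d/2⌋ + 1.
    have hK := PDPair.modFP_of_isFPn (k := d / 2) (by omega) hker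
    obtain ⟨hFP', m, rfl, hex', e, he⟩ := PDPair.exists_cohomology_ker (L := PDPair.TrivMod R G) hφ
      hFP hex hK (PDPair.asModuleCongr c)
      (fun _ M _ _ hM i hi => PDPair.extZero_trivMod hφ hK hM i hi) (by omega)
    exact ⟨hFP', m, by omega, hex', PDPair.nonempty_equiv_of_equivariant φ.ker.subtype e he c
      (LinearEquiv.refl R R) fun _ _ => rfl⟩
  · rintro ⟨i₀, -⟩
    obtain ⟨hFP, d, hd, hex, ⟨c⟩⟩ := hPD.2 ⟨i₀⟩
    obtain rfl : n = d + 1 := by omega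
    -- The associated module is in bijection with a cohomology group in universe u, so the index
    -- type can be shrunk to that universe.
    have := PDPair.small_of_assocModule R H c.symm.toLinearEquiv.toEquiv
    let ε := (equivShrink.{u} ι).symm
    have : Nonempty (Shrink.{u} ι) := ⟨ε.symm i₀⟩
    obtain ⟨c'⟩ := PDPair.exists_assocModule_reindex R H ε
    have hK := PDPair.modFP_of_isFPn (k := (d + 1) / 2) (by omega) hker
    have hK' : ∀ i, PDPair.ModFP (MonoidAlgebra R (φ.comp (H i).subtype).ker) (d / 2)
        (PDPair.TrivMod R (φ.comp (H i).subtype).ker) := fun i =>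
      PDPair.modFP_of_isFPn (by omega) (hkerH i)
    obtain ⟨hFP', m, rfl, hex', e, he⟩ := PDPair.exists_cohomology_ker_pair hφ hFP (H ∘ ε)
      (fun j => hφH (ε j)) hex hK (fun j => hK' (ε j)) (c.trans c'.symm)
    obtain ⟨E, hE⟩ := PDPair.exists_assocModule_restrict H φ.ker x R hx
    exact ⟨hFP', m, by omega, hex',
      PDPair.nonempty_equiv_of_equivariant φ.ker.subtype e he c E hE⟩
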